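/- Conventions. Let $\mathfrak g$ be a seven-dimensional real Lie algebra. For an endomorphism $D$ of a vector space and a $k$-form $\alpha$ put $(\vartheta(D)\alpha)(v_1,\dots,v_k)=-\sum_i\alpha(v_1,\dots,Dv_i,\dots,v_k)$, and let $d$ be the Chevalley–Eilenberg differential of $\mathfrak g$. A $G_2$-structure on $\mathfrak g$ is a $3$-form $\varphi_0$ for which there is a basis $(e_i)$ of $\mathfrak g$ (an adapted frame), with dual basis $(e^i)$, such that $$\varphi_0=e^{127}+e^{347}+e^{567}+e^{135}-e^{146}-e^{236}-e^{245};$$ the induced metric $g_{\varphi_0}$ and orientation are those for which an adapted frame is orthonormal and oriented. Let $\star_0$ be the Hodge star, $\phi_0=\star_0\varphi_0$, and $\Delta_0=dd^*+d^*d$ the Hodge Laplacian. The $G_2$-structure is coclosed if $d\phi_0=0$. The form $\phi_0$ is a (coflow) soliton with constant $c\in\mathbb R$ if $-\Delta_0\phi_0=-4c\,\phi_0+\vartheta(D)\phi_0$ for some derivation $D$ of the Lie algebra $\mathfrak g$, and it is a soliton if this holds for some $c\in\mathbb R$. Let $\mathfrak h$ be an abelian ideal of $\mathfrak g$ of dimension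 six, $\varphi_0$ a coclosed $G_2$-structure on $\mathfrak g$, $e_7$ a $g_{\varphi_0}$-unit vector orthogonal to $\mathfrak h$, $A=\mathrm{ad}_{e_7}|_{\mathfrak h}$ (so $\mathfrak g=\mathbb R e_7\ltimes_A\mathfrak h$), $h_0=g_{\varphi_0}|_{\mathfrak h}$, $\omega_0=(e_7\lrcorner\varphi_0)|_{\mathfrak h}$ and $\psi_0=-(e_7\lrcorner\phi_0)|_{\mathfrak h}$. Assume that $A$ is normal with respect to $h_0$, and let $S(0)$ and $L(0)$ be its symmetric and skew-symmetric parts. Then there are an $h_0$-orthonormal basis $(f_1,\dots,f_6)$ of $\mathfrak h$, an angle $\theta\in[0,2\pi]$ and $s_1,s_2,s_3\in\mathbb R$ with $$\omega_0=f^{12}+f^{34}+f^{56},\qquad \psi_0=-f^{246}+f^{136}+f^{145}+f^{235},$$ $$S(0)f_{2i-1}=s_i(\cos\theta\, f_{2i-1}+\sin\theta\, f_{2i}),\qquad S(0)f_{2i}=-s_i(-\sin\theta\, f_{2i-1}+\cos\theta\, f_{2i}),\quad i=1,2,3.$$ For any such basis, real $\theta$ and $s_1,s_2,s_3$, put $a=\cos\theta$,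 $b=\sin\theta$, $s^2=s_1^2+s_2^2+s_3^2$, $l=\sum_{k=1}^3 f^{2k}(L(0)f_{2k-1})$ (the imaginary part of the complex trace of $L(0)$ for the complex structure $f_{2k-1}\mapsto f_{2k}\mapsto -f_{2k-1}$), and let $\Sigma(0)$ be the endomorphism of $\mathfrak h$ that is block diagonal in $(f_1,\dots,f_6)$ with blocks $$\Sigma_i=s_js_k\begin{pmatrix}-2+4a^2&-4ab\\-4ab&2-4a^2\end{pmatrix},\qquad \{i,j,k\}=\{1,2,3\}.$$ Then $\phi_0$ is a soliton if and only if $$4b(1-4a^2)s_1s_2s_3=0\quad\text{and}\quad[\Sigma(0),L(0)]=0.$$ In such a case $\phi_0$ is a soliton with constant $c=l^2+s^2$, that is, with $\delta:=l^2+s^2-c=0$; and if moreover $A\neq0$, then every constant $c$ with which $\phi_0$ is a soliton satisfies $\delta=0$, and hence $c\ge0$. -/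

import Mathlib

noncomputable section

namespace Coflow

/-- Real alternating `k`-forms on a real vector space `V`. -/
abbrev Form (V : Type*) [AddCommGroup V] [Module ℝ V] (k : ℕ) : Type _ := V [⋀^Fin k]→ₗ[ℝ] ℝ

section Linear

variable {V : Type*} [AddCommGroup V] [Module ℝ V]

/-- The action `ϑ` of an endomorphism `D` on `k`-forms,
`(ϑ(D) α)(v₁, …, v_k) = - ∑ i, α (v₁, …, D vᵢ, …, v_k)`. -/
def theta {k : ℕ} (D : Module.End ℝ V) (α : Form V k) : Form V k :=
  { (-∑ i : Fin k, α.toMultilinearMap.compLinearMap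
      (Function.update (fun _ => LinearMap.id) i D)) with
    map_eq_zero_of_eq' := by
      intro v i j hij hne
      have key : ∀ m : Fin k,
          (fun a => (Function.update (fun _ : Fin k => (LinearMap.id : V →ₗ[ℝ] V)) m D) a (v a))
            = Function.update v m (D (v m)) := by
        intro m
        funext a
        by_cases h : a = m
        · subst h; simp
        · simp [h]
      have h2 : ∑ m : Fin k, α (Function.update v m (D (v m))) = 0 := by
        rw [Finset.sum_eq_add i j hne]
        · have hs : Function.update v j (D (v j))
              = (Function.update v i (D (v i))) ∘ Equiv.swap i j := by
            funext a
            by_cases hi : a = i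
            · subst hi; simp [Function.update_of_ne hne, Function.update_of_ne hne.symm, hij]
            · by_cases hj : a = j
              · subst hj; simp [hij]
              · simp [Equiv.swap_apply_of_ne_of_ne hi hj, hi, hj]
          rw [hs, α.map_swap _ hne]
          simp
        · intro m _ hm
          refine α.map_eq_zero_of_eq _ ?_ hne
          rw [Function.update_of_ne hm.1.symm, Function.update_of_ne hm.2.symm, hij]
        · simp
        · simp
      simpa [MultilinearMap.compLinearMap_apply, key] using h2 }

theorem theta_apply {k : ℕ} (D : Module.End ℝ V) (α : Form V k) (v : Fin k → V) :
    theta D α v = -∑ i, α (Function.update v i (D (v i))) := by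
  have key : ∀ m : Fin k,
      (fun a => (Function.update (fun _ : Fin k => (LinearMap.id : V →ₗ[ℝ] V)) m D) a (v a))
        = Function.update v m (D (v m)) := by
    intro m
    funext a
    by_cases h : a = m
    · subst h; simp
    · simp [h]
  change (-∑ i : Fin k, α.toMultilinearMap.compLinearMap
      (Function.update (fun _ => LinearMap.id) i D)) v = _
  simp [MultilinearMap.compLinearMap_apply, key]

/-- The form `e^{i₁} ∧ ⋯ ∧ e^{i_k}`, where `(eⁱ)` is the basis dual to `e`. -/
def coForm {ι : Type*} (e : Module.Basis ι ℝ V) {k : ℕ} (idx : Fin k → ι) : Form V k :=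
  (Matrix.detRowAlternating (n := Fin k) (R := ℝ)).compLinearMap
    (LinearMap.pi fun a => e.coord (idx a))

theorem coForm_apply {ι : Type*} (e : Module.Basis ι ℝ V) {k : ℕ} (idx : Fin k → ι)
    (v : Fin k → V) :
    coForm e idx v = (Matrix.of fun b a => e.coord (idx a) (v b)).det := rfl

/-- The scalar product for which the basis `e` is orthonormal. -/
def metric {n : ℕ} (e : Module.Basis (Fin n) ℝ V) : LinearMap.BilinForm ℝ V :=
  ∑ i, (e.coord i).smulRight (e.coord i)

/-- Contraction of an `n`-form, `n = k + l`, with `k` vectors (inserted in the first places). -/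
def contract {n k l : ℕ} (h : k + l = n) (u : Fin k → V) (α : Form V n) : Form V l where
  toFun v := α (fun i => Fin.append u v (Fin.cast h.symm i))
  map_update_add' := by
    intro _ v i x y
    subst h
    have key : ∀ z : V, (fun j => Fin.append u (@Function.update _ _ _ v i z) (Fin.cast rfl j))
        = Function.update (Fin.append u v) (Fin.natAdd k i) z := by
      intro z
      funext j
      refine Fin.addCases (fun a => ?_) (fun a => ?_) j
      · have : Fin.castAdd l a ≠ Fin.natAdd k i := by
          intro hh
          have := congrArg Fin.val hh
          simp at this
          omega
        simp [Function.update_of_ne this]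
      · by_cases hai : a = i
        · subst hai; simp
        · have : Fin.natAdd k a ≠ Fin.natAdd k i := by
            simpa using hai
          simp [Function.update_of_ne this, Function.update_of_ne hai]
    simp only [key]
    exact α.map_update_add _ _ _ _
  map_update_smul' := by
    intro _ v i c x
    subst h
    have key : ∀ z : V, (fun j => Fin.append u (@Function.update _ _ _ v i z) (Fin.cast rfl j))
        = Function.update (Fin.append u v) (Fin.natAdd k i) z := by
      intro z
      funext j
      refine Fin.addCases (fun a => ?_) (fun a => ?_) j
      · have : Fin.castAdd l a ≠ Fin.natAdd k i := by
          intro hh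
          have := congrArg Fin.val hh
          simp at this
          omega
        simp [Function.update_of_ne this]
      · by_cases hai : a = i
        · subst hai; simp
        · have : Fin.natAdd k a ≠ Fin.natAdd k i := by
            simpa using hai
          simp [Function.update_of_ne this, Function.update_of_ne hai]
    simp only [key]
    exact α.map_update_smul _ _ _ _
  map_eq_zero_of_eq' := by
    intro v i j hv hij
    subst h
    refine α.map_eq_zero_of_eq _ (i := Fin.natAdd k i) (j := Fin.natAdd k j) ?_ ?_
    · simpa using hv
    · simpa using hij

/-- The Hodge star `Λ^k → Λ^l`, `k + l = n`, of the scalar product and of the orientation for which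
`e` is an oriented orthonormal basis, characterized by `α ∧ ⋆β = ⟨α, β⟩ e^{1…n}`: explicitly
`(⋆α)(v) = (1/k!) ∑_{i₁,…,i_k} α(e_{i₁}, …, e_{i_k}) e^{1…n}(e_{i₁}, …, e_{i_k}, v)`. -/
def hodgeStar {n k l : ℕ} (e : Module.Basis (Fin n) ℝ V) (h : k + l = n) (α : Form V k) : Form V l :=
  ((k.factorial : ℝ)⁻¹) • ∑ f : Fin k → Fin n,
    α (fun i => e (f i)) • contract h (fun i => e (f i)) e.det

/-- `e` is an adapted frame for the `3`-form `φ`: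
`φ = e^{127} + e^{347} + e^{567} + e^{135} - e^{146} - e^{236} - e^{245}`.
A `3`-form on a seven-dimensional space is (the fundamental form of) a linear `G₂`-structure if and
only if it has an adapted frame. The metric `g_φ` and the orientation induced by `φ` are those for
which an adapted frame (hence every adapted frame) is orthonormal and oriented. -/
def IsG2Frame (φ : Form V 3) (e : Module.Basis (Fin 7) ℝ V) : Prop :=
  φ = coForm e ![0, 1, 6] + coForm e ![2, 3, 6] + coForm e ![4, 5, 6] + coForm e ![0, 2, 4]
    - coForm e ![0, 3, 5] - coForm e ![1, 2, 5] - coForm e ![1, 3, 4]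

/-- `f = (f₁, Jf₁, f₂, Jf₂, f₃, Jf₃)` is an adapted frame of the linear `SU(3)`-structure `(ω, ψ)`
with scalar product `h`: it is `h`-orthonormal, `ω = f^{12} + f^{34} + f^{56}`, and `ψ` is the
imaginary part of `(f¹ + i f²) ∧ (f³ + i f⁴) ∧ (f⁵ + i f⁶)`. -/
def IsSU3Frame (h : LinearMap.BilinForm ℝ V) (ω : Form V 2) (ψ : Form V 3)
    (f : Module.Basis (Fin 6) ℝ V) : Prop :=
  (∀ i j, h (f i) (f j) = if i = j then 1 else 0) ∧
  ω = coForm f ![0, 1] + coForm f ![2, 3] + coForm f ![4, 5] ∧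
  ψ = -coForm f ![1, 3, 5] + coForm f ![0, 2, 5] + coForm f ![0, 3, 4] + coForm f ![1, 2, 4]

/-- The normal form of a symmetric endomorphism `S` with respect to a frame
`f = (f₁, Jf₁, f₂, Jf₂, f₃, Jf₃)`: `S fᵢ = sᵢ (cos θ fᵢ + sin θ Jfᵢ)` and
`S Jfᵢ = - sᵢ (- sin θ fᵢ + cos θ Jfᵢ)`. -/
def IsNormalForm (S : Module.End ℝ V) (f : Module.Basis (Fin 6) ℝ V) (θ : ℝ)
    (s : Fin 3 → ℝ) : Prop :=
  S (f 0) = s 0 • (Real.cos θ • f 0 + Real.sin θ • f 1) ∧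
  S (f 1) = -(s 0 • (-(Real.sin θ • f 0) + Real.cos θ • f 1)) ∧
  S (f 2) = s 1 • (Real.cos θ • f 2 + Real.sin θ • f 3) ∧
  S (f 3) = -(s 1 • (-(Real.sin θ • f 2) + Real.cos θ • f 3)) ∧
  S (f 4) = s 2 • (Real.cos θ • f 4 + Real.sin θ • f 5) ∧
  S (f 5) = -(s 2 • (-(Real.sin θ • f 4) + Real.cos θ • f 5))

/-- The endomorphism `Σ` (restricted to the six-dimensional space), block diagonal in the frame
`f = (f₁, Jf₁, f₂, Jf₂, f₃, Jf₃)`, with `i`-th block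
`sⱼ s_k [[-2 + 4a², -4ab], [-4ab, 2 - 4a²]]`, `{i, j, k} = {1, 2, 3}`, `a = cos θ`, `b = sin θ`. -/
def bigSigma (f : Module.Basis (Fin 6) ℝ V) (θ : ℝ) (s : Fin 3 → ℝ) : Module.End ℝ V :=
  let p := -2 + 4 * Real.cos θ ^ 2
  let q := -4 * Real.cos θ * Real.sin θ
  Matrix.toLin f f
    !![p * (s 1 * s 2), q * (s 1 * s 2), 0, 0, 0, 0;
       q * (s 1 * s 2), -p * (s 1 * s 2), 0, 0, 0, 0;
       0, 0, p * (s 0 * s 2), q * (s 0 * s 2), 0, 0;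
       0, 0, q * (s 0 * s 2), -p * (s 0 * s 2), 0, 0;
       0, 0, 0, 0, p * (s 0 * s 1), q * (s 0 * s 1);
       0, 0, 0, 0, q * (s 0 * s 1), -p * (s 0 * s 1)]

/-- The imaginary part of the complex trace of a complex linear `L`, where the complex structure `J`
is given by the frame `f = (f₁, Jf₁, f₂, Jf₂, f₃, Jf₃)`: the `k`-th diagonal entry of the complex
matrix of `L` with respect to `(f₁, f₂, f₃)` has as imaginary part the `Jf_k`-coordinate
of `L f_k`. -/
def imTrace (f : Module.Basis (Fin 6) ℝ V) (L : Module.End ℝ V) : ℝ :=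
  f.coord 1 (L (f 0)) + f.coord 3 (L (f 2)) + f.coord 5 (L (f 4))

end Linear

section LieAlg

variable {𝔤 : Type*} [LieRing 𝔤] [LieAlgebra ℝ 𝔤]

/-- The linear map `x ↦ ϑ(ad x) α`, that is, the Lie derivative of `α` along `x`. -/
def adTheta {k : ℕ} (α : Form 𝔤 k) : 𝔤 →ₗ[ℝ] Form 𝔤 k where
  toFun x := theta (LieAlgebra.ad ℝ 𝔤 x) α
  map_add' x y := by
    ext v
    simp [theta_apply, AlternatingMap.map_update_add, Finset.sum_add_distrib, add_comm]
  map_smul' c x := by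
    ext v
    simp [theta_apply, AlternatingMap.map_update_smul, Finset.mul_sum]

/-- The Chevalley–Eilenberg differential (the exterior derivative of left-invariant forms),
`dα(v₀, …, v_k) = ∑_{i<j} (-1)^{i+j} α([vᵢ, vⱼ], v₀, …, v̂ᵢ, …, v̂ⱼ, …, v_k)`, written as
`dα(v₀, …, v_k) = (1/2) ∑ i, (-1)^i (ϑ(ad vᵢ) α)(v₀, …, v̂ᵢ, …, v_k)`. -/
def d {k : ℕ} (α : Form 𝔤 k) : Form 𝔤 (k + 1) :=
  (2⁻¹ : ℝ) • AlternatingMap.alternatizeUncurryFin (adTheta α)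

/-- The codifferential `d* = (-1)^k ⋆ d ⋆` on `k`-forms in dimension seven (here `k = m + 1`). -/
def codiff (e : Module.Basis (Fin 7) ℝ 𝔤) {m l : ℕ} (h : m + 1 + l = 7) (α : Form 𝔤 (m + 1)) :
    Form 𝔤 m :=
  ((-1 : ℝ) ^ (m + 1)) • hodgeStar e (by omega : l + 1 + m = 7) (d (hodgeStar e h α))

/-- The Hodge Laplacian `Δ = d d* + d* d` on `4`-forms. -/
def laplacian (e : Module.Basis (Fin 7) ℝ 𝔤) (α : Form 𝔤 4) : Form 𝔤 4 :=
  d (codiff e (by norm_num : 3 + 1 + 3 = 7) α) + codiff e (by norm_num : 4 + 1 + 2 = 7) (d α)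

/-- The soliton equation `-Δ Φ = -4 c Φ + ϑ(D) Φ` for the `4`-form `Φ`, with constant `c` and
some derivation `D` of the Lie algebra. -/
def IsSolitonWith (e : Module.Basis (Fin 7) ℝ 𝔤) (Φ : Form 𝔤 4) (c : ℝ) : Prop :=
  ∃ D : LieDerivation ℝ 𝔤 𝔤, -laplacian e Φ = (-4 * c) • Φ + theta D.toLinearMap Φ

/-- The `4`-form `Φ` is a soliton of the Laplacian coflow. -/
def IsSoliton (e : Module.Basis (Fin 7) ℝ 𝔤) (Φ : Form 𝔤 4) : Prop :=
  ∃ c : ℝ, IsSolitonWith e Φ c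

end LieAlg

end Coflow

end

noncomputable section

namespace Coflow

open Module

/-! ### Orthonormal bases and the Hodge star -/

section Star

variable {V : Type*} [AddCommGroup V] [Module ℝ V] {n : ℕ}

/-! Write Φ = ⋆φ = ½ω² − e⁷∧ψ on ℝe₇ ⋉_A 𝔥. Closedness of Φ says ϑ(A)(½ω²) = 0, and since ω∧ is
injective on 2-forms in dimension six (`eq_zero_of_wedge_stdOmega`), this means A ∈ 𝔰𝔭(ω). The
transpose of A is then also in 𝔰𝔭(ω), so S anticommutes with the complex structure J and L lies in
𝔲(3). A symmetric S anticommuting with J has a unitary eigenbasis; multiplying it by a common phase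
normalizes the complex volume form, and because S is antilinear this phase reappears in S as the
angle θ.

For closed Φ one has ΔΦ = dd*Φ. It vanishes on 𝔥, and its contraction with e₇ is ϑ(A)ϑ(Aᵀ) applied
to that of Φ (`res_laplacian_curryLeft`). As A = S + L is normal, ϑ(A)ϑ(Aᵀ) = ϑ(S)² − ϑ(L)². On ψ
the first square is s² + ϑ(Σ) (`theta_theta_normalForm`) and the second is −l²
(`theta_theta_unitary`), since L acts on the complex volume form through its trace.

If A ≠ 0, a derivation D preserves 𝔥, sends e₇ to some x₀ in 𝔥, and restricts to B with [B, A] = 0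
(`derivation_structure`). The soliton equation splits: on 𝔥 it says B + c ∈ 𝔰𝔭(ω), and along e₇ it
says ϑ(B + c + Σ)ψ + (l² + s² − c)ψ + x₀⌟½ω² = 0. The components of this last equation are
independent, so `soliton_linear_system` gives c = l² + s² and makes B + c + Σ skew; thus −Σ is the
symmetric part of B + c. An endomorphism commuting with a normal A commutes with Aᵀ as well, hence
so does its symmetric part: Σ commutes with A and Aᵀ, that is, with S and L. In the normal form, [Σ,
S] = 0 is the scalar condition 4b(1 − 4a²)s₁s₂s₃ = 0.

Conversely, if Σ commutes with S and L, then B = −c − Σ extends to a derivation killing e₇ and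
solves the equation with c = l² + s². If A = 0, then S = L = 0 and both conditions are void. -/

theorem metric_apply (e : Basis (Fin n) ℝ V) (x y : V) :
    metric e x y = ∑ i, e.coord i x * e.coord i y := by
  simp [metric, LinearMap.sum_apply]

theorem metric_basis (e : Basis (Fin n) ℝ V) (i j : Fin n) :
    metric e (e i) (e j) = if i = j then 1 else 0 := by
  simp [metric_apply, Finsupp.single_apply]

theorem metric_basis_left (e : Basis (Fin n) ℝ V) (i : Fin n) (x : V) :
    metric e (e i) x = e.coord i x := by
  simp [metric_apply, Finsupp.single_apply]

theorem metric_comm (e : Basis (Fin n) ℝ V) (x y : V) : metric e x y = metric e y x := by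
  simp [metric_apply, mul_comm]

theorem metric_pos (e : Basis (Fin n) ℝ V) {x : V} (hx : x ≠ 0) : 0 < metric e x x := by
  rw [metric_apply]
  have h0 : ∀ i ∈ Finset.univ, 0 ≤ e.coord i x * e.coord i x := fun i _ => mul_self_nonneg _
  rcases (Finset.sum_nonneg h0).lt_or_eq with h | h
  · exact h
  · exfalso
    have := (Finset.sum_eq_zero_iff_of_nonneg h0).1 h.symm
    refine hx (e.forall_coord_eq_zero_iff.1 fun i => ?_)
    simpa using this i (Finset.mem_univ i)

theorem metric_eq_of_orthonormal (e F : Basis (Fin n) ℝ V)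
    (h : ∀ i j, metric e (F i) (F j) = if i = j then 1 else 0) : metric e = metric F := by
  refine LinearMap.BilinForm.ext_basis F fun i j => ?_
  rw [h, metric_basis]

/-- A family orthonormal for a bilinear form is linearly independent. -/
theorem linearIndependent_of_orthonormal {ι : Type*} [Fintype ι] [DecidableEq ι]
    (B : LinearMap.BilinForm ℝ V) (v : ι → V)
    (h : ∀ i j, B (v i) (v j) = if i = j then 1 else 0) : LinearIndependent ℝ v := by
  rw [Fintype.linearIndependent_iff]
  intro c hc i
  have := congrArg (B (v i)) hc
  simpa [map_sum, h] using this

variable {e F : Basis (Fin n) ℝ V}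

theorem coord_comm (h : metric e = metric F) (i j : Fin n) :
    e.coord i (F j) = F.coord j (e i) := by
  rw [← metric_basis_left, h, metric_comm, metric_basis_left]

/-- The change of basis between two bases with the same metric is orthogonal, so the contraction of
two linear forms does not see which one is used. -/
theorem sum_mul_linear (h : metric e = metric F) (a b : V →ₗ[ℝ] ℝ) :
    ∑ i, a (e i) * b (e i) = ∑ i, a (F i) * b (F i) := by
  have hF : ∀ j, F j = ∑ i, e.coord i (F j) • e i := fun j => (e.sum_repr (F j)).symm
  have key : ∀ i i', ∑ j, e.coord i (F j) * e.coord i' (F j) = if i = i' then 1 else 0 := by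
    intro i i'
    simp_rw [coord_comm h]
    rw [← metric_apply, ← h, metric_basis]
  have ha : ∀ (a : V →ₗ[ℝ] ℝ) j, a (F j) = ∑ i, e.coord i (F j) * a (e i) := by
    intro a j
    conv_lhs => rw [hF j]
    rw [map_sum]
    simp_rw [map_smul, smul_eq_mul]
  simp_rw [ha a, ha b, Finset.sum_mul_sum]
  rw [Finset.sum_comm]
  refine Finset.sum_congr rfl fun i _ => ?_
  rw [Finset.sum_comm]
  have : ∀ i', ∑ j, e.coord i (F j) * a (e i) * (e.coord i' (F j) * b (e i'))
      = (if i = i' then 1 else 0) * (a (e i) * b (e i')) := by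
    intro i'
    rw [← key, Finset.sum_mul]
    exact Finset.sum_congr rfl fun j _ => by ring
  simp_rw [this]
  simp

/-- Full contractions are independent of the orthonormal basis: induction on the degree, the linear
case being applied to the first slot. -/
theorem sum_mul_multilinear (h : metric e = metric F) {k : ℕ}
    (α β : MultilinearMap ℝ (fun _ : Fin k => V) ℝ) :
    ∑ f : Fin k → Fin n, α (fun i => e (f i)) * β (fun i => e (f i))
      = ∑ f : Fin k → Fin n, α (fun i => F (f i)) * β (fun i => F (f i)) := by
  induction k with
  | zero =>
    refine Finset.sum_congr rfl fun f _ => ?_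
    congr 2 <;> exact Subsingleton.elim _ _
  | succ k ih =>
    have hc : ∀ (G : Basis (Fin n) ℝ V) (γ : MultilinearMap ℝ (fun _ : Fin (k + 1) => V) ℝ)
        (i : Fin n) (f : Fin k → Fin n),
        γ (fun a => G ((Fin.cons i f : Fin (k + 1) → Fin n) a))
          = γ.curryLeft (G i) (fun a => G (f a)) := by
      intro G γ i f
      rw [MultilinearMap.curryLeft_apply]
      congr 1
      funext a
      refine Fin.cases ?_ (fun a => ?_) a <;> simp
    have hs : ∀ G : Basis (Fin n) ℝ V, ∑ f : Fin (k + 1) → Fin n, α (fun i => G (f i)) * β (fun i => G (f i))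
        = ∑ i, ∑ f : Fin k → Fin n, α.curryLeft (G i) (fun a => G (f a))
            * β.curryLeft (G i) (fun a => G (f a)) := by
      intro G
      rw [← (Fin.consEquiv fun _ : Fin (k + 1) => Fin n).sum_comp, Fintype.sum_prod_type]
      refine Finset.sum_congr rfl fun i _ => Finset.sum_congr rfl fun f _ => ?_
      rw [← hc, ← hc]
      rfl
    rw [hs, hs]
    simp_rw [ih]
    rw [Finset.sum_comm, Finset.sum_comm (γ := Fin n)]
    refine Finset.sum_congr rfl fun f _ => ?_
    have := sum_mul_linear h
      { toFun := fun x => α.curryLeft x (fun a => F (f a))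
        map_add' := by intros; simp
        map_smul' := by intros; simp }
      { toFun := fun x => β.curryLeft x (fun a => F (f a))
        map_add' := by intros; simp
        map_smul' := by intros; simp }
    simpa using this

theorem det_mul_self_of_metric_eq (h : metric e = metric F) : e.det F * e.det F = 1 := by
  have h1 : e.det F = F.det e := by
    rw [Basis.det_apply, Basis.det_apply, ← Matrix.det_transpose]
    congr 1
    ext i j
    simpa [Basis.toMatrix_apply] using (coord_comm h j i)
  have h2 : e.det F * F.det e = 1 := by
    rw [Basis.det_apply, Basis.det_apply, ← Matrix.det_mul, Basis.toMatrix_mul_toMatrix_flip,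
      Matrix.det_one]
  rw [← h2, h1]

theorem form_sum_apply {ι : Type*} (s : Finset ι) {k : ℕ} (α : ι → Form V k) (v : Fin k → V) :
    (∑ i ∈ s, α i) v = ∑ i ∈ s, α i v :=
  map_sum ({ toFun := fun β => β v, map_zero' := rfl, map_add' := fun _ _ => rfl } :
    Form V k →+ ℝ) α s

theorem hodgeStar_apply {k l : ℕ} (e : Basis (Fin n) ℝ V) (hn : k + l = n) (α : Form V k)
    (v : Fin l → V) :
    hodgeStar e hn α v = ((k.factorial : ℝ)⁻¹) * ∑ f : Fin k → Fin n,
      α (fun i => e (f i)) * e.det (fun i => Fin.append (fun i => e (f i)) v (Fin.cast hn.symm i)) := by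
  simp only [hodgeStar, AlternatingMap.smul_apply, form_sum_apply, smul_eq_mul]
  rfl

/-- The metric determines the star up to the orientation sign `e.det F` = ±1. This allows frames for
which the orientation is never checked. -/
theorem hodgeStar_eq_smul (h : metric e = metric F) {k l : ℕ} (hn : k + l = n) (α : Form V k) :
    hodgeStar e hn α = e.det F • hodgeStar F hn α := by
  subst hn
  ext v
  rw [AlternatingMap.smul_apply, hodgeStar_apply, hodgeStar_apply, smul_eq_mul, mul_left_comm]
  congr 1
  rw [Finset.mul_sum]
  let γ : MultilinearMap ℝ (fun _ : Fin k ⊕ Fin l => V) ℝ :=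
    e.det.toMultilinearMap.domDomCongr finSumFinEquiv.symm
  let β : MultilinearMap ℝ (fun _ : Fin k => V) ℝ :=
    { toFun := fun u => γ.currySum u v
      map_update_add' := by intros; simp only [MultilinearMap.map_update_add, _root_.add_apply]
      map_update_smul' := by
        intros; simp only [MultilinearMap.map_update_smul, _root_.smul_apply] }
  have hβ : ∀ u : Fin k → V, e.det (fun i => Fin.append u v (Fin.cast rfl i)) = β u := by
    intro u
    change _ = e.det (fun i => (Sum.rec u v (finSumFinEquiv.symm i) : V))
    congr 1
    funext i
    refine Fin.addCases (fun a => ?_) (fun a => ?_) i <;> simp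
  have := sum_mul_multilinear h α.toMultilinearMap β
  simp_rw [hβ]
  refine this.trans (Finset.sum_congr rfl fun f _ => ?_)
  rw [← hβ, mul_left_comm]
  conv_lhs => rw [AlternatingMap.eq_smul_basis_det F e.det]
  rfl

theorem hodgeStar_smul {k l : ℕ} (e : Basis (Fin n) ℝ V) (hn : k + l = n) (c : ℝ) (α : Form V k) :
    hodgeStar e hn (c • α) = c • hodgeStar e hn α := by
  ext v
  simp only [hodgeStar_apply, AlternatingMap.smul_apply, smul_eq_mul, mul_assoc, ← Finset.mul_sum]
  ring

theorem hodgeStar_add {k l : ℕ} (e : Basis (Fin n) ℝ V) (hn : k + l = n) (α β : Form V k) :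
    hodgeStar e hn (α + β) = hodgeStar e hn α + hodgeStar e hn β := by
  ext v
  simp only [hodgeStar_apply, AlternatingMap.add_apply, add_mul, mul_add, Finset.sum_add_distrib]

/-- Evaluates the star on basis vectors: of all the terms in its defining sum only k! survive, and
these are equal, which cancels the factor 1/k!. -/
theorem hodgeStar_perm {k l : ℕ} (e : Basis (Fin (k + l)) ℝ V) (hn : k + l = k + l) (α : Form V k)
    (σ : Equiv.Perm (Fin (k + l))) :
    hodgeStar e hn α (fun j => e (σ (Fin.natAdd k j)))
      = (Equiv.Perm.sign σ : ℤ) * α (fun i => e (σ (Fin.castAdd l i))) := by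
  rw [hodgeStar_apply]
  have hsub : ∑ f : Fin k → Fin (k + l), α (fun i => e (f i)) *
        e.det (fun i => Fin.append (fun i => e (f i)) (fun j => e (σ (Fin.natAdd k j)))
          (Fin.cast hn.symm i))
      = ∑ τ : Equiv.Perm (Fin k), α (fun i => e (σ (Fin.castAdd l (τ i)))) *
        e.det (fun i => Fin.append (fun i => e (σ (Fin.castAdd l (τ i))))
          (fun j => e (σ (Fin.natAdd k j))) (Fin.cast hn.symm i)) := by
    symm
    let emb : Equiv.Perm (Fin k) → (Fin k → Fin (k + l)) := fun τ i => σ (Fin.castAdd l (τ i))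
    have hinj : Function.Injective emb := by
      intro τ τ' hh
      ext i
      have := congrFun hh i
      simpa [emb, Fin.ext_iff] using this
    rw [← Finset.sum_image (f := fun f : Fin k → Fin (k + l) => α (fun i => e (f i)) *
        e.det (fun i => Fin.append (fun i => e (f i)) (fun j => e (σ (Fin.natAdd k j)))
          (Fin.cast hn.symm i))) (g := emb) (s := Finset.univ) (fun a _ b _ hab => hinj hab)]
    -- A repeated index kills α, and an index already used in the last l slots kills the
    -- determinant; what remains are the rearrangements of the first block.
    refine Finset.sum_subset (Finset.subset_univ _) fun f _ hf => ?_
    by_cases hfi : Function.Injective f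
    · by_cases hr : ∃ i j, f i = σ (Fin.natAdd k j)
      · obtain ⟨i, j, hij⟩ := hr
        rw [AlternatingMap.map_eq_zero_of_eq e.det _ (i := Fin.castAdd l i) (j := Fin.natAdd k j)]
        · simp
        · simp [hij]
        · intro hh
          have := congrArg Fin.val hh
          simp at this
          omega
      · exfalso
        push Not at hr
        have : ∀ i, ∃ m : Fin k, σ (Fin.castAdd l m) = f i := by
          intro i
          obtain ⟨b, hb⟩ := σ.surjective (f i)
          revert hb
          refine Fin.addCases (fun a => ?_) (fun a => ?_) b
          · exact fun hb => ⟨a, hb⟩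
          · exact fun hb => absurd hb.symm (hr i a)
        choose m hm using this
        have hmi : Function.Injective m := by
          intro a b hab
          apply hfi
          rw [← hm, ← hm, hab]
        apply hf
        refine Finset.mem_image.2 ⟨Equiv.ofBijective m (Finite.injective_iff_bijective.1 hmi),
          Finset.mem_univ _, ?_⟩
        funext i
        exact hm i
    · rw [Function.Injective] at hfi
      push Not at hfi
      obtain ⟨i, j, hij, hne⟩ := hfi
      rw [AlternatingMap.map_eq_zero_of_eq α _ (i := i) (j := j) (by simp [hij]) hne, zero_mul]
  rw [hsub]
  have hterm : ∀ τ : Equiv.Perm (Fin k), α (fun i => e (σ (Fin.castAdd l (τ i)))) *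
        e.det (fun i => Fin.append (fun i => e (σ (Fin.castAdd l (τ i))))
          (fun j => e (σ (Fin.natAdd k j))) (Fin.cast hn.symm i))
      = (Equiv.Perm.sign σ : ℤ) * α (fun i => e (σ (Fin.castAdd l i))) := by
    intro τ
    have h1 : α (fun i => e (σ (Fin.castAdd l (τ i))))
        = (Equiv.Perm.sign τ : ℤ) * α (fun i => e (σ (Fin.castAdd l i))) := by
      have := α.map_perm (fun i => e (σ (Fin.castAdd l i))) τ
      simpa [Units.smul_def, Function.comp_def] using this
    let τ' : Equiv.Perm (Fin (k + l)) := finSumFinEquiv.permCongr (Equiv.Perm.sumCongr τ 1)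
    have h2 : (fun i => Fin.append (fun i => e (σ (Fin.castAdd l (τ i))))
          (fun j => e (σ (Fin.natAdd k j))) (Fin.cast hn.symm i)) = e ∘ (σ * τ') := by
      funext i
      refine Fin.addCases (fun a => ?_) (fun a => ?_) i <;> simp [τ', Equiv.permCongr_apply]
    have hs : Equiv.Perm.sign τ' = Equiv.Perm.sign τ := by
      simp [τ', Equiv.Perm.sign_permCongr, Equiv.Perm.sign_sumCongr]
    rw [h1, h2, AlternatingMap.map_perm, Basis.det_self, Equiv.Perm.sign_mul, hs]
    have h3 : ((Equiv.Perm.sign τ : ℤ) : ℝ) * (Equiv.Perm.sign τ : ℤ) = 1 := by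
      rw [← Int.cast_mul, ← Units.val_mul, Int.units_mul_self]
      simp
    simp only [Units.smul_def, Units.val_mul, zsmul_eq_mul, Int.cast_mul, mul_one]
    linear_combination (α (fun i => e (σ (Fin.castAdd l i))) * (Equiv.Perm.sign σ : ℤ)) * h3
  simp_rw [hterm]
  simp only [Finset.sum_const, Finset.card_univ, Fintype.card_perm, Fintype.card_fin, nsmul_eq_mul]
  rw [← mul_assoc, inv_mul_cancel₀ (by positivity), one_mul]

theorem hodgeStar_perm_cast {k l : ℕ} (e : Basis (Fin n) ℝ V) (hn : k + l = n) (α : Form V k)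
    (σ : Equiv.Perm (Fin n)) {u : Fin l → V} {w : Fin k → V}
    (hu : ∀ j, u j = e (σ (Fin.cast hn (Fin.natAdd k j))))
    (hw : ∀ i, w i = e (σ (Fin.cast hn (Fin.castAdd l i)))) :
    hodgeStar e hn α u = ((Equiv.Perm.sign σ : ℤ) : ℝ) * α w := by
  subst hn
  rw [funext hu, funext hw]
  exact hodgeStar_perm e rfl α σ

theorem coForm_basis_det (e : Basis (Fin n) ℝ V) (u : Fin n → V) :
    e.det u = coForm e id u := by
  rw [coForm_apply, Basis.det_apply, ← Matrix.det_transpose]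
  rfl

/-- The trace of an endomorphism, read off in a basis, is minus the factor by which it acts on
volume forms. -/
theorem theta_det (e : Basis (Fin n) ℝ V) (X : End ℝ V) :
    theta X e.det = -(∑ i, e.coord i (X (e i))) • e.det := by
  rw [AlternatingMap.eq_smul_basis_det e (theta X e.det)]
  congr 1
  rw [theta_apply]
  congr 1
  refine Finset.sum_congr rfl fun i _ => ?_
  rw [Basis.det_apply, Basis.toMatrix_update, Basis.toMatrix_self]
  have := Matrix.cramer_apply (1 : Matrix (Fin n) (Fin n) ℝ) (e.repr (X (e i))) i
  rw [Matrix.cramer_one] at this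
  exact this.symm

theorem append_update_left' {V : Type*} {k l : ℕ} (u : Fin k → V) (v : Fin l → V) (i : Fin k) (z : V) :
    Fin.append (Function.update u i z) v = Function.update (Fin.append u v) (Fin.castAdd l i) z := by
  funext j
  refine Fin.addCases (fun a => ?_) (fun a => ?_) j
  · by_cases h : a = i
    · subst h; simp
    · have : Fin.castAdd l a ≠ Fin.castAdd l i := by simpa using h
      simp [Function.update_of_ne h, Function.update_of_ne this]
  · have : Fin.natAdd k a ≠ Fin.castAdd l i := by
      intro hh
      have := congrArg Fin.val hh
      simp at this
      omega
    simp [Function.update_of_ne this]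

theorem append_update_right' {V : Type*} {k l : ℕ} (u : Fin k → V) (v : Fin l → V) (i : Fin l) (z : V) :
    Fin.append u (Function.update v i z) = Function.update (Fin.append u v) (Fin.natAdd k i) z := by
  funext j
  refine Fin.addCases (fun a => ?_) (fun a => ?_) j
  · have : Fin.castAdd l a ≠ Fin.natAdd k i := by
      intro hh
      have := congrArg Fin.val hh
      simp at this
      omega
    simp [Function.update_of_ne this]
  · by_cases h : a = i
    · subst h; simp
    · have : Fin.natAdd k a ≠ Fin.natAdd k i := by simpa using h
      simp [Function.update_of_ne h, Function.update_of_ne this]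

/-- Expanding X and its adjoint in the basis turns each side into a sum over a multi-index and one
further index; exchanging that index with the i-th entry is an involution matching the two sums. -/
theorem sum_update_adjoint (e : Basis (Fin n) ℝ V) (X X' : End ℝ V)
    (hX : ∀ x y, metric e (X x) y = metric e x (X' y)) {k : ℕ} (α : Form V k)
    (β : (Fin k → V) → ℝ)
    (hβ : ∀ u i (c : Fin n → ℝ), β (Function.update u i (∑ j, c j • e j))
      = ∑ j, c j * β (Function.update u i (e j))) (i : Fin k) :
    ∑ f : Fin k → Fin n, α (Function.update (fun a => e (f a)) i (X (e (f i)))) *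
        β (fun a => e (f a))
      = ∑ f : Fin k → Fin n, α (fun a => e (f a)) *
        β (Function.update (fun a => e (f a)) i (X' (e (f i)))) := by
  have hexp : ∀ x : V, x = ∑ j, e.coord j x • e j := fun x => (e.sum_repr x).symm
  have hadj : ∀ a b, e.coord a (X (e b)) = e.coord b (X' (e a)) := by
    intro a b
    rw [← metric_basis_left, ← metric_basis_left, metric_comm, hX]
  have hupd : ∀ (f : Fin k → Fin n) j, Function.update (fun a => e (f a)) i (e j)
      = fun a => e (Function.update f i j a) := by
    intro f j
    funext a
    by_cases h : a = i
    · subst h; simp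
    · simp [h]
  have h1 : ∀ f : Fin k → Fin n, α (Function.update (fun a => e (f a)) i (X (e (f i))))
      = ∑ j, e.coord j (X (e (f i))) * α (fun a => e (Function.update f i j a)) := by
    intro f
    conv_lhs => rw [hexp (X (e (f i)))]
    rw [AlternatingMap.map_update_sum]
    simp_rw [AlternatingMap.map_update_smul, hupd, smul_eq_mul]
  have h2 : ∀ f : Fin k → Fin n, β (Function.update (fun a => e (f a)) i (X' (e (f i))))
      = ∑ j, e.coord j (X' (e (f i))) * β (fun a => e (Function.update f i j a)) := by
    intro f
    conv_lhs => rw [hexp (X' (e (f i)))]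
    rw [hβ]
    simp_rw [hupd]
  simp_rw [h1, h2, Finset.sum_mul, Finset.mul_sum]
  rw [← Fintype.sum_prod_type', ← Fintype.sum_prod_type']
  let sw : (Fin k → Fin n) × Fin n → (Fin k → Fin n) × Fin n :=
    fun p => (Function.update p.1 i p.2, p.1 i)
  have hsw : Function.Involutive sw := by
    rintro ⟨f, j⟩
    simp [sw]
  refine Fintype.sum_equiv hsw.toPerm _ _ ?_
  rintro ⟨f, j⟩
  simp only [Function.Involutive.coe_toPerm, sw, Function.update_self, Function.update_idem,
    Function.update_eq_self]
  rw [hadj]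
  ring

/-- Inside the contraction with the volume form, X moves to its adjoint X' acting on the first k
slots. The action of X' on all slots is multiplication by the trace, so the first k slots give the
trace minus the action on the last l slots, which is the action on ⋆α. -/
theorem hodgeStar_theta (e : Basis (Fin n) ℝ V) (X X' : End ℝ V)
    (hX : ∀ x y, metric e (X x) y = metric e x (X' y)) {k l : ℕ} (hn : k + l = n) (α : Form V k) :
    hodgeStar e hn (theta X α)
      = -(∑ i, e.coord i (X' (e i))) • hodgeStar e hn α - theta X' (hodgeStar e hn α) := by
  subst hn
  ext v
  rw [AlternatingMap.sub_apply, AlternatingMap.smul_apply, theta_apply, hodgeStar_apply,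
    hodgeStar_apply]
  simp_rw [hodgeStar_apply, theta_apply]
  set T := ∑ i, e.coord i (X' (e i))
  simp only [Fin.cast_refl, id_eq]
  change ((k.factorial : ℝ)⁻¹) * ∑ f : Fin k → Fin (k + l), _ * e.det (Fin.append _ _)
    = -T • (((k.factorial : ℝ)⁻¹) * ∑ f : Fin k → Fin (k + l), _ * e.det (Fin.append _ _))
      - -∑ j, (((k.factorial : ℝ)⁻¹) * ∑ f : Fin k → Fin (k + l), _ * e.det (Fin.append _ _))
  have hw : ∀ w : Fin (k + l) → V, (∑ i, e.det (Function.update w (Fin.castAdd l i) (X' (w (Fin.castAdd l i)))))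
      = T * e.det w - ∑ j, e.det (Function.update w (Fin.natAdd k j) (X' (w (Fin.natAdd k j)))) := by
    intro w
    have := DFunLike.congr_fun (theta_det e X') w
    rw [theta_apply, AlternatingMap.smul_apply, Fin.sum_univ_add, smul_eq_mul] at this
    linarith
  have hs : ∀ i : Fin k, ∑ f : Fin k → Fin (k + l),
        α (Function.update (fun a => e (f a)) i (X (e (f i)))) * e.det (Fin.append (fun a => e (f a)) v)
      = ∑ f : Fin k → Fin (k + l), α (fun a => e (f a)) *
        e.det (Function.update (Fin.append (fun a => e (f a)) v) (Fin.castAdd l i)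
          (X' (Fin.append (fun a => e (f a)) v (Fin.castAdd l i)))) := by
    intro i
    have := sum_update_adjoint e X X' hX α (fun u => e.det (Fin.append u v)) (by
      intro u i c
      simp_rw [append_update_left']
      rw [AlternatingMap.map_update_sum]
      simp_rw [AlternatingMap.map_update_smul, smul_eq_mul]) i
    rw [this]
    simp_rw [append_update_left', Fin.append_left]
  have hL : ∑ f : Fin k → Fin (k + l), (-∑ i, α (Function.update (fun a => e (f a)) i (X (e (f i)))))
        * e.det (Fin.append (fun a => e (f a)) v)
      = ∑ f : Fin k → Fin (k + l), α (fun a => e (f a)) *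
        (-T * e.det (Fin.append (fun a => e (f a)) v) + ∑ j, e.det (Fin.append (fun a => e (f a))
          (Function.update v j (X' (v j))))) := by
    simp_rw [neg_mul, Finset.sum_mul]
    rw [Finset.sum_neg_distrib, Finset.sum_comm]
    simp_rw [hs]
    rw [Finset.sum_comm, ← Finset.sum_neg_distrib]
    refine Finset.sum_congr rfl fun f _ => ?_
    rw [← Finset.mul_sum, hw]
    simp_rw [append_update_right', Fin.append_right]
    ring
  rw [hL]
  simp_rw [mul_add, Finset.sum_add_distrib, mul_add]
  rw [sub_neg_eq_add]
  congr 1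
  · rw [smul_eq_mul, mul_left_comm, Finset.mul_sum, Finset.mul_sum, Finset.mul_sum]
    exact Finset.sum_congr rfl fun f _ => by ring
  · rw [← Finset.mul_sum, Finset.sum_comm]
    simp_rw [Finset.mul_sum]

theorem hodgeStar_coForm {k l : ℕ} (e : Basis (Fin n) ℝ V) (hn : k + l = n) (idx : Fin k → Fin n)
    (v : Fin l → V) : hodgeStar e hn (coForm e idx) v
      = e.det (fun i => Fin.append (fun i => e (idx i)) v (Fin.cast hn.symm i)) := by
  subst hn
  rw [hodgeStar_apply]
  have h1 : ∀ f : Fin k → Fin (k + l), coForm e idx (fun i => e (f i))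
      = ∑ τ : Equiv.Perm (Fin k), ((Equiv.Perm.sign τ : ℤ) : ℝ)
        * (if f = idx ∘ τ then 1 else 0) := by
    intro f
    rw [coForm_apply, ← Matrix.det_transpose, Matrix.det_apply]
    refine Finset.sum_congr rfl fun τ _ => ?_
    rw [Units.smul_def, zsmul_eq_mul]
    congr 1
    simp only [Matrix.transpose_apply, Matrix.of_apply, Basis.coord_apply, Basis.repr_self,
      Finsupp.single_apply]
    rw [Finset.prod_boole]
    simp [funext_iff]
  simp_rw [h1, Finset.sum_mul, mul_assoc]
  rw [Finset.sum_comm]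
  have h2 : ∀ τ : Equiv.Perm (Fin k), ∑ f : Fin k → Fin (k + l), ((Equiv.Perm.sign τ : ℤ) : ℝ)
        * ((if f = idx ∘ τ then 1 else 0) * e.det (fun i => Fin.append (fun i => e (f i)) v (Fin.cast rfl i)))
      = e.det (fun i => Fin.append (fun i => e (idx i)) v (Fin.cast rfl i)) := by
    intro τ
    rw [← Finset.mul_sum]
    simp only [ite_mul, one_mul, zero_mul, Finset.sum_ite_eq', Finset.mem_univ, if_true,
      Function.comp_apply]
    let τ' : Equiv.Perm (Fin (k + l)) := finSumFinEquiv.permCongr (Equiv.Perm.sumCongr τ 1)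
    have hs : Equiv.Perm.sign τ' = Equiv.Perm.sign τ := by
      simp [τ', Equiv.Perm.sign_permCongr, Equiv.Perm.sign_sumCongr]
    have h3 : (fun i => Fin.append (fun i => e (idx (τ i))) v (Fin.cast rfl i))
        = (fun i => Fin.append (fun i => e (idx i)) v (Fin.cast rfl i)) ∘ τ' := by
      funext i
      refine Fin.addCases (fun a => ?_) (fun a => ?_) i <;> simp [τ', Equiv.permCongr_apply]
    rw [h3, AlternatingMap.map_perm, hs, Units.smul_def, zsmul_eq_mul, ← mul_assoc, ← Int.cast_mul,
      ← Units.val_mul, Int.units_mul_self]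
    simp
  simp_rw [h2]
  simp only [Finset.sum_const, Finset.card_univ, Fintype.card_perm, Fintype.card_fin, nsmul_eq_mul]
  rw [← mul_assoc, inv_mul_cancel₀ (by positivity), one_mul]

end Star

/-! ### The star of coordinate forms and of the G₂-form -/

section Star

variable {V : Type*} [AddCommGroup V] [Module ℝ V]

/-- After the columns are permuted by σ, the determinant giving the star is block triangular with an
identity block; what remains is the complementary minor. -/
theorem hodgeStar_coForm_perm {k l : ℕ} (e : Basis (Fin (k + l)) ℝ V) (hn : k + l = k + l)
    (σ : Equiv.Perm (Fin (k + l))) :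
    hodgeStar e hn (coForm e fun i => σ (Fin.castAdd l i))
      = ((Equiv.Perm.sign σ : ℤ) : ℝ) • coForm e fun j => σ (Fin.natAdd k j) := by
  ext v
  rw [hodgeStar_coForm, coForm_basis_det, AlternatingMap.smul_apply, coForm_apply, coForm_apply,
    smul_eq_mul]
  set M : Matrix (Fin (k + l)) (Fin (k + l)) ℝ := Matrix.of fun b a =>
    e.coord (id a) (Fin.append (fun i => e (σ (Fin.castAdd l i))) v (Fin.cast hn.symm b))
  have h1 : (M.submatrix id σ).det = (Equiv.Perm.sign σ : ℤ) * M.det := Matrix.det_permute' σ M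
  have h2 : ((M.submatrix id σ).submatrix finSumFinEquiv finSumFinEquiv).det
      = (M.submatrix id σ).det := Matrix.det_submatrix_equiv_self _ _
  have h3 : (M.submatrix id σ).submatrix finSumFinEquiv finSumFinEquiv
      = Matrix.fromBlocks 1 0
        (Matrix.of fun (b : Fin l) (a : Fin k) => e.coord (σ (Fin.castAdd l a)) (v b))
        (Matrix.of fun (b : Fin l) (a : Fin l) => e.coord (σ (Fin.natAdd k a)) (v b)) := by
    have hne : ∀ (i : Fin k) (j : Fin l), Fin.castAdd l i ≠ Fin.natAdd k j := by
      intro i j hh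
      have := congrArg Fin.val hh
      simp at this
      omega
    ext i j
    rcases i with i | i <;> rcases j with j | j
    · simp [M, Finsupp.single_apply, Matrix.one_apply]
    · simp [M, hne]
    · simp [M]
    · simp [M]
  rw [h3, Matrix.det_fromBlocks_zero₁₂, Matrix.det_one, one_mul] at h2
  rw [h2, h1, ← mul_assoc, ← Int.cast_mul, ← Units.val_mul, Int.units_mul_self]
  simp

theorem hodgeStar_coForm_seven (e : Basis (Fin 7) ℝ V) (hn : 3 + 4 = 7) (a b c i j k l : Fin 7)
    (s : ℤ) (σ : Equiv.Perm (Fin 7)) (hσ : ∀ m, σ m = ![a, b, c, i, j, k, l] m)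
    (hs : ((Equiv.Perm.sign σ : ℤˣ) : ℤ) = s) :
    hodgeStar e hn (coForm e ![a, b, c]) = (s : ℝ) • coForm e ![i, j, k, l] := by
  have := hodgeStar_coForm_perm (k := 3) (l := 4) e rfl σ
  rw [hs] at this
  convert this using 2
  · congr 1
    funext m
    rw [hσ]
    fin_cases m <;> rfl
  · congr 1
    funext m
    rw [hσ]
    fin_cases m <;> rfl

theorem hodgeStar_eq_of_isG2Frame {φ : Form V 3} {e : Basis (Fin 7) ℝ V} (he : IsG2Frame φ e)
    (hn : 3 + 4 = 7) : hodgeStar e hn φ =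
      coForm e ![2, 3, 4, 5] + coForm e ![0, 1, 4, 5] + coForm e ![0, 1, 2, 3]
        - coForm e ![1, 3, 5, 6] + coForm e ![1, 2, 4, 6] + coForm e ![0, 3, 4, 6]
        + coForm e ![0, 2, 5, 6] := by
  rw [he]
  have h1 := hodgeStar_coForm_seven e hn 0 1 6 2 3 4 5 1
    ⟨![0, 1, 6, 2, 3, 4, 5], ![0, 1, 3, 4, 5, 6, 2], by decide, by decide⟩ (fun _ => rfl) (by decide)
  have h2 := hodgeStar_coForm_seven e hn 2 3 6 0 1 4 5 1
    ⟨![2, 3, 6, 0, 1, 4, 5], ![3, 4, 0, 1, 5, 6, 2], by decide, by decide⟩ (fun _ => rfl) (by decide)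
  have h3 := hodgeStar_coForm_seven e hn 4 5 6 0 1 2 3 1
    ⟨![4, 5, 6, 0, 1, 2, 3], ![3, 4, 5, 6, 0, 1, 2], by decide, by decide⟩ (fun _ => rfl) (by decide)
  have h4 := hodgeStar_coForm_seven e hn 0 2 4 1 3 5 6 (-1)
    ⟨![0, 2, 4, 1, 3, 5, 6], ![0, 3, 1, 4, 2, 5, 6], by decide, by decide⟩ (fun _ => rfl) (by decide)
  have h5 := hodgeStar_coForm_seven e hn 0 3 5 1 2 4 6 (-1)
    ⟨![0, 3, 5, 1, 2, 4, 6], ![0, 3, 4, 1, 5, 2, 6], by decide, by decide⟩ (fun _ => rfl) (by decide)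
  have h6 := hodgeStar_coForm_seven e hn 1 2 5 0 3 4 6 (-1)
    ⟨![1, 2, 5, 0, 3, 4, 6], ![3, 0, 1, 4, 5, 2, 6], by decide, by decide⟩ (fun _ => rfl) (by decide)
  have h7 := hodgeStar_coForm_seven e hn 1 3 4 0 2 5 6 (-1)
    ⟨![1, 3, 4, 0, 2, 5, 6], ![3, 0, 4, 1, 2, 5, 6], by decide, by decide⟩ (fun _ => rfl) (by decide)
  simp only [sub_eq_add_neg, ← neg_one_smul ℝ (coForm e _), hodgeStar_add, hodgeStar_smul, h1, h2, h3, h4, h5, h6, h7]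
  push_cast
  module

end Star

/-! ### The differential and the codifferential -/

section Differential

variable {𝔤 : Type*} [LieRing 𝔤] [LieAlgebra ℝ 𝔤]

theorem d_apply {k : ℕ} (α : Form 𝔤 k) (v : Fin (k + 1) → 𝔤) :
    d α v = 2⁻¹ * ∑ i : Fin (k + 1), (-1) ^ (i : ℕ) *
      theta (LieAlgebra.ad ℝ 𝔤 (v i)) α (i.removeNth v) := by
  simp [d, AlternatingMap.alternatizeUncurryFin_apply, adTheta]

theorem theta_ad_eq_zero {k : ℕ} (α : Form 𝔤 k) (y : 𝔤) (v : Fin k → 𝔤)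
    (h : ∀ i, ⁅y, v i⁆ = 0) : theta (LieAlgebra.ad ℝ 𝔤 y) α v = 0 := by
  rw [theta_apply, neg_eq_zero]
  refine Finset.sum_eq_zero fun i _ => ?_
  rw [LieAlgebra.ad_apply, h]
  exact α.map_coord_zero i (by simp)

theorem d_apply_of_commute {k : ℕ} (α : Form 𝔤 k) (v : Fin (k + 1) → 𝔤)
    (h : ∀ i j, ⁅v i, v j⁆ = 0) : d α v = 0 := by
  rw [d_apply, Finset.sum_eq_zero, mul_zero]
  intro i _
  rw [theta_ad_eq_zero α (v i) (i.removeNth v) fun j => h _ _, mul_zero]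

/-- The i = 0 term of `d_apply` is ϑ(ad x)α. In each other term only the bracket of vᵢ with x
survives, and these terms add up to ϑ(ad x)α a second time; the factor 1/2 removes the repetition.
-/
theorem d_apply_cons {k : ℕ} (α : Form 𝔤 k) (x : 𝔤) (v : Fin k → 𝔤)
    (h : ∀ i j, ⁅v i, v j⁆ = 0) :
    d α (Matrix.vecCons x v) = theta (LieAlgebra.ad ℝ 𝔤 x) α v := by
  rw [d_apply, Fin.sum_univ_succ]
  have h0 : (0 : Fin (k + 1)).removeNth (Matrix.vecCons x v : Fin (k + 1) → 𝔤) = v := by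
    funext j; simp [Fin.removeNth]
  have hs : ∀ i : Fin k, (-1 : ℝ) ^ ((i.succ : Fin (k + 1)) : ℕ) *
      theta (LieAlgebra.ad ℝ 𝔤 (Matrix.vecCons x v i.succ)) α
        (i.succ.removeNth (Matrix.vecCons x v : Fin (k + 1) → 𝔤))
      = -α (Function.update v i ⁅x, v i⁆) := by
    intro i
    cases k with
    | zero => exact i.elim0
    | succ k =>
      have hr : i.succ.removeNth (Matrix.vecCons x v : Fin (k + 2) → 𝔤)
          = Matrix.vecCons x (i.removeNth v) := by
        funext j
        refine Fin.cases ?_ (fun j => ?_) j <;> simp [Fin.removeNth]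
      rw [hr, theta_apply, Fin.sum_univ_succ, Finset.sum_eq_zero, add_zero]
      · have hu : Function.update v i ⁅x, v i⁆ = i.insertNth ⁅x, v i⁆ (i.removeNth v) := by
          rw [Fin.insertNth_removeNth]
        have hc : Function.update (Matrix.vecCons x (i.removeNth v)) 0
            (LieAlgebra.ad ℝ 𝔤 (Matrix.vecCons x v i.succ) (Matrix.vecCons x (i.removeNth v) 0))
            = Matrix.vecCons (-⁅x, v i⁆) (i.removeNth v) := by
          funext j
          refine Fin.cases ?_ (fun j => ?_) j <;> simp
        have hneg : α (Matrix.vecCons (-⁅x, v i⁆) (i.removeNth v))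
            = -α (Matrix.vecCons ⁅x, v i⁆ (i.removeNth v)) := by
          have := α.map_vecCons_smul (i.removeNth v) (-1) ⁅x, v i⁆
          simpa using this
        rw [hu, AlternatingMap.map_insertNth, hc, hneg]
        simp [pow_succ]
      · intro j _
        have : (LieAlgebra.ad ℝ 𝔤 (Matrix.vecCons x v i.succ))
            (Matrix.vecCons x (i.removeNth v) j.succ) = 0 := by
          simp [Fin.removeNth, h]
        rw [this]
        exact α.map_coord_zero j.succ (by simp)
  simp_rw [hs]
  rw [h0]
  simp only [Fin.val_zero, pow_zero, Matrix.cons_val_zero, Finset.sum_neg_distrib]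
  rw [theta_apply]
  simp only [LieAlgebra.ad_apply]
  ring

theorem d_smul (c : ℝ) {k : ℕ} (β : Form 𝔤 k) : d (c • β) = c • d β := by
  ext v
  simp only [d_apply, theta_apply, AlternatingMap.smul_apply, smul_eq_mul, Finset.mul_sum, mul_neg]
  exact Finset.sum_congr rfl fun i _ => by
    congr 1
    exact Finset.sum_congr rfl fun j _ => by ring

theorem codiff_zero (e : Basis (Fin 7) ℝ 𝔤) {m l : ℕ} (h : m + 1 + l = 7) :
    codiff e h (0 : Form 𝔤 (m + 1)) = 0 := by
  have hd : d (0 : Form 𝔤 l) = 0 := by simpa using d_smul 0 (0 : Form 𝔤 l)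
  have hs : ∀ {k l : ℕ} (hn : k + l = 7), hodgeStar e hn (0 : Form 𝔤 k) = 0 := fun hn => by
    simpa using hodgeStar_smul e hn 0 0
  rw [codiff, hs, hd, hs, smul_zero]

theorem laplacian_of_closed (e : Basis (Fin 7) ℝ 𝔤) {Φ : Form 𝔤 4} (hΦ : d Φ = 0) :
    laplacian e Φ = d (codiff e (by norm_num : 3 + 1 + 3 = 7) Φ) := by
  unfold laplacian
  rw [hΦ, codiff_zero, add_zero]

/-- The Hodge Laplacian of a closed `4`-form on an almost abelian Lie algebra: the components
along the abelian ideal. -/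
theorem laplacian_apply_of_commute (e : Basis (Fin 7) ℝ 𝔤) {Φ : Form 𝔤 4} (hΦ : d Φ = 0)
    (v : Fin 4 → 𝔤) (h : ∀ i j, ⁅v i, v j⁆ = 0) : laplacian e Φ v = 0 := by
  rw [laplacian_of_closed e hΦ]
  exact d_apply_of_commute _ _ h

/-- Two stars enter, so the orientation sign appears squared. -/
theorem codiff_eq_of_metric_eq {e F : Basis (Fin 7) ℝ 𝔤} (h : metric e = metric F) {m l : ℕ}
    (hml : m + 1 + l = 7) (α : Form 𝔤 (m + 1)) : codiff e hml α = codiff F hml α := by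
  rw [codiff, codiff, hodgeStar_eq_smul h, hodgeStar_eq_smul h, d_smul, hodgeStar_smul, smul_smul (e.det F),
    det_mul_self_of_metric_eq h, one_smul]

end Differential

/-! ### The Laplacian of a closed 4-form on an almost abelian Lie algebra -/

section AlmostAbelian

variable {𝔤 : Type*} [LieRing 𝔤] [LieAlgebra ℝ 𝔤] {𝔥 : LieIdeal ℝ 𝔤}

/-- The restriction of a form to an ideal. -/
def res (𝔥 : LieIdeal ℝ 𝔤) {k : ℕ} (α : Form 𝔤 k) : Form 𝔥 k :=
  α.compLinearMap 𝔥.toSubmodule.subtype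

theorem res_apply {k : ℕ} (α : Form 𝔤 k) (v : Fin k → 𝔥) :
    res 𝔥 α v = α fun i => (v i : 𝔤) := rfl

/-- Supplies the index arrangement for evaluating the star on three vectors of the ideal: the normal
index first, the given indices last. The order of the three middle indices is left open because
their sign will enter twice. -/
theorem exists_perm_of_injective (g : Fin 3 → Fin 6) (hg : Function.Injective g) :
    ∃ σ : Equiv.Perm (Fin 7), σ 0 = 6 ∧ ∀ j : Fin 3, σ (Fin.natAdd 4 j) = (g j).castSucc := by
  let f : Fin 7 → Fin 7 := Fin.append (n := 3) (m := 4) (fun _ => 6) (fun j => (g j).castSucc)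
  obtain ⟨σ, hσ⟩ := Finset.exists_equiv_extend_of_card_eq (α := Fin 7) (β := Fin 7)
    (t := Finset.univ) (by simp) (s := {0, 4, 5, 6}) (f := f) (by simp) (by
      have hn : ∀ a : Fin 6, a.castSucc ≠ (6 : Fin 7) := fun a => (Fin.castSucc_lt_last a).ne
      have h4 : f 4 = (g 0).castSucc := rfl
      have h5 : f 5 = (g 1).castSucc := rfl
      have h6 : f 6 = (g 2).castSucc := rfl
      have h0 : f 0 = 6 := rfl
      have hi : ∀ a b, g a = g b → a = b := fun a b h => hg h
      have h01 := hi 0 1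
      have h02 := hi 0 2
      have h12 := hi 1 2
      intro a ha b hb hab
      simp only [Finset.coe_insert, Finset.coe_singleton, Set.mem_insert_iff,
        Set.mem_singleton_iff] at ha hb
      rcases ha with rfl | rfl | rfl | rfl <;> rcases hb with rfl | rfl | rfl | rfl <;>
        simp only [h0, h4, h5, h6, Fin.castSucc_inj] at hab <;>
        first
          | rfl
          | exact absurd hab (hn _)
          | exact absurd hab.symm (hn _)
          | exact absurd (hi _ _ hab) (by decide))
  refine ⟨σ.trans (Equiv.subtypeUnivEquiv fun x => Finset.mem_univ x), ?_, fun j => ?_⟩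
  · exact hσ 0 (by simp)
  · have : (f (Fin.natAdd 4 j)) = (g j).castSucc := Fin.append_right (m := 4) _ _ j
    rw [← this]
    exact hσ _ (by fin_cases j <;> decide)

/-- On forms, d* = ⋆d⋆ in degree four. On the ideal, d is contraction with the normal direction
followed by ϑ(ad F₆), and `hodgeStar_theta` carries this action through the star to minus the action
of the transpose, as ad F₆ is trace free. -/
theorem codiff_apply_basis {F : Basis (Fin 7) ℝ 𝔤} {X' : End ℝ 𝔤}
    (hcomm : ∀ i j : Fin 6, ⁅F i.castSucc, F j.castSucc⁆ = 0)
    (hX : ∀ x y, metric F (LieAlgebra.ad ℝ 𝔤 (F 6) x) y = metric F x (X' y))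
    (htr : ∑ i, F.coord i (LieAlgebra.ad ℝ 𝔤 (F 6) (F i)) = 0) (Φ : Form 𝔤 4)
    (g : Fin 3 → Fin 6) (hg : Function.Injective g) :
    codiff F (by norm_num : 3 + 1 + 3 = 7) Φ (fun j => F (g j).castSucc)
      = theta X' Φ (Matrix.vecCons (F 6) fun j => F (g j).castSucc) := by
  obtain ⟨σ, hσ0, hσ⟩ := exists_perm_of_injective g hg
  have hstar : theta (LieAlgebra.ad ℝ 𝔤 (F 6)) (hodgeStar F (by norm_num : 4 + 3 = 7) Φ)
      = -hodgeStar F (by norm_num : 4 + 3 = 7) (theta X' Φ) := by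
    rw [hodgeStar_theta F X' (LieAlgebra.ad ℝ 𝔤 (F 6))
      (fun x y => by rw [metric_comm, ← hX, metric_comm]), htr]
    simp
  have hne : ∀ j : Fin 3, ∃ m : Fin 6, σ (Fin.castAdd 3 j.succ) = m.castSucc := by
    intro j
    refine Fin.exists_castSucc_eq.2 (fun h => ?_) |>.imp fun _ h => h.symm
    have : σ (Fin.castAdd 3 j.succ) = σ 0 := by rw [hσ0]; exact h
    have := congrArg Fin.val (σ.injective this)
    simp at this
  choose m hm using hne
  have hv : (fun i : Fin 4 => F (σ (Fin.castAdd 3 i)))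
      = Matrix.vecCons (F 6) fun j => F (m j).castSucc := by
    funext i
    refine Fin.cases ?_ (fun j => ?_) i
    · exact congrArg F hσ0
    · simp [hm]
  have hw : (fun j : Fin 3 => F (σ (Fin.natAdd 4 j))) = fun j => F (g j).castSucc :=
    funext fun j => congrArg F (hσ j)
  have h1 := hodgeStar_perm_cast F (by norm_num : 4 + 3 = 7)
    (d (hodgeStar F (by norm_num : 4 + 3 = 7) Φ)) σ (fun j => (congrFun hw j).symm) fun i => (congrFun hv i).symm
  rw [d_apply_cons _ _ _ fun i j => hcomm _ _, hstar, AlternatingMap.neg_apply] at h1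
  -- Exchanging the two blocks of three indices, three transpositions, moves the arguments from one
  -- star to the other; the resulting −1 cancels the sign in `hstar`.
  let π : Equiv.Perm (Fin 7) :=
    ⟨![0, 4, 5, 6, 1, 2, 3], ![0, 4, 5, 6, 1, 2, 3], by decide, by decide⟩
  have hπ : Equiv.Perm.sign π = -1 := by decide
  have hv1 : (fun j : Fin 3 => F ((σ * π) (Fin.natAdd 4 j))) = fun j => F (m j).castSucc := by
    funext j
    rw [← hm]
    fin_cases j <;> rfl
  have hv2 : (fun i : Fin 4 => F ((σ * π) (Fin.castAdd 3 i)))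
      = Matrix.vecCons (F 6) fun j => F (g j).castSucc := by
    funext i
    refine Fin.cases ?_ (fun j => ?_) i
    · exact congrArg F hσ0
    · simp only [Matrix.cons_val_succ, ← hσ]
      fin_cases j <;> rfl
  have h2 := hodgeStar_perm_cast F (by norm_num : 4 + 3 = 7) (theta X' Φ) (σ * π)
    (fun j => (congrFun hv1 j).symm) fun i => (congrFun hv2 i).symm
  rw [Equiv.Perm.sign_mul, hπ] at h2
  have hcod : codiff F (by norm_num : 3 + 1 + 3 = 7) Φ = hodgeStar F (by norm_num : 4 + 3 = 7)
      (d (hodgeStar F (by norm_num : 4 + 3 = 7) Φ)) := by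
    unfold codiff
    norm_num
  rw [hcod, h1, h2]
  have h3 : ((Equiv.Perm.sign σ : ℤ) : ℝ) * (Equiv.Perm.sign σ : ℤ) = 1 := by
    rw [← Int.cast_mul, ← Units.val_mul, Int.units_mul_self]
    simp
  push_cast
  linear_combination (theta X' Φ (Matrix.vecCons (F 6) fun j => F (g j).castSucc)) * h3

variable {f : Basis (Fin 6) ℝ 𝔥} {F : Basis (Fin 7) ℝ 𝔤}

/-- The extended frame is orthonormal, but neither its orientation nor its adaptedness to the
G₂-form is claimed; equality of metrics is all that is used later. -/
theorem exists_extend_basis (e : Basis (Fin 7) ℝ 𝔤) {e₇ : 𝔤} (h_unit : metric e e₇ e₇ = 1)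
    (h_perp : ∀ x ∈ 𝔥, metric e e₇ x = 0) (f : Basis (Fin 6) ℝ 𝔥)
    (hf : ∀ i j, metric e (f i) (f j) = if i = j then 1 else 0) :
    ∃ F : Basis (Fin 7) ℝ 𝔤, (∀ i, F i.castSucc = f i) ∧ F 6 = e₇ ∧ metric e = metric F := by
  let v : Fin 7 → 𝔤 := Fin.snoc (n := 6) (α := fun _ => 𝔤) (fun i => (f i : 𝔤)) e₇
  have hv6 : v (Fin.last 6) = e₇ := Fin.snoc_last (α := fun _ => 𝔤) _ _
  have hv : ∀ i : Fin 6, v i.castSucc = f i := by simp [v]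
  have hon : ∀ i j, metric e (v i) (v j) = if i = j then 1 else 0 := by
    intro i j
    refine Fin.lastCases ?_ (fun i => ?_) i <;> refine Fin.lastCases ?_ (fun j => ?_) j
    · rw [hv6, h_unit, if_pos rfl]
    · rw [hv6, hv, h_perp _ (f j).2, if_neg (Fin.castSucc_lt_last j).ne']
    · rw [hv6, hv, metric_comm, h_perp _ (f i).2, if_neg (Fin.castSucc_lt_last i).ne]
    · simp [hv, hf]
  let F := basisOfLinearIndependentOfCardEqFinrank
    (linearIndependent_of_orthonormal (metric e) v hon)
    (by rw [Module.finrank_eq_card_basis e])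
  have hF : ∀ i, F i = v i := fun i => by simp [F]
  refine ⟨F, fun i => by rw [hF, hv], by rw [hF]; exact hv6, ?_⟩
  exact metric_eq_of_orthonormal e F fun i j => by rw [hF, hF, hon]

theorem coord_castSucc_mem (hF : ∀ i, F i.castSucc = f i) (i : Fin 6) (x : 𝔥) :
    F.coord i.castSucc (x : 𝔤) = f.coord i x := by
  have : F.coord i.castSucc ∘ₗ 𝔥.toSubmodule.subtype = f.coord i := by
    refine f.ext fun j => ?_
    change F.coord i.castSucc (f j : 𝔤) = _
    rw [← hF]
    simp [Finsupp.single_apply]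
  exact LinearMap.congr_fun this x

theorem coord_last_mem (hF : ∀ i, F i.castSucc = f i) (x : 𝔥) : F.coord 6 (x : 𝔤) = 0 := by
  have : F.coord 6 ∘ₗ 𝔥.toSubmodule.subtype = 0 := by
    refine f.ext fun j => ?_
    have hj : j.castSucc ≠ (6 : Fin 7) := (Fin.castSucc_lt_last j).ne
    change F.coord 6 (f j : 𝔤) = _
    rw [← hF]
    simp [hj]
  exact LinearMap.congr_fun this x

theorem eq_add_smul (hF : ∀ i, F i.castSucc = f i) (x : 𝔤) :
    x = ((∑ i : Fin 6, F.coord i.castSucc x • f i : 𝔥) : 𝔤) + F.coord 6 x • F 6 := by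
  conv_lhs => rw [← F.sum_repr x, Fin.sum_univ_castSucc]
  simp [← hF]

/-- Forms on `𝔤` are determined by their restriction to a hyperplane and by the restriction of
their contraction with a transversal vector. -/
theorem form_ext (hF : ∀ i, F i.castSucc = f i) {k : ℕ} {α β : Form 𝔤 (k + 1)}
    (h0 : res 𝔥 α = res 𝔥 β) (h1 : res 𝔥 (α.curryLeft (F 6)) = res 𝔥 (β.curryLeft (F 6))) :
    α = β := by
  have h1' : ∀ w : Fin k → 𝔥, α (Matrix.vecCons (F 6) fun i => (w i : 𝔤))
      = β (Matrix.vecCons (F 6) fun i => (w i : 𝔤)) := fun w => DFunLike.congr_fun h1 w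
  refine Basis.ext_alternating F fun v hv => ?_
  by_cases h : ∃ i, v i = Fin.last 6
  · obtain ⟨i, hi⟩ := h
    have hne : ∀ j, ∃ m : Fin 6, m.castSucc = v (i.succAbove j) := by
      intro j
      refine Fin.exists_castSucc_eq.2 fun h => ?_
      exact Fin.succAbove_ne i j (hv (h.trans hi.symm))
    choose m hm using hne
    have : (fun j => F (v j)) = i.insertNth (F 6) fun j => ((f (m j) : 𝔥) : 𝔤) := by
      rw [Fin.eq_insertNth_iff]
      refine ⟨by rw [hi]; rfl, funext fun j => ?_⟩
      simp [Fin.removeNth, ← hm, hF]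
    rw [this, AlternatingMap.map_insertNth, AlternatingMap.map_insertNth, h1']
  · push Not at h
    choose m hm using fun j => Fin.exists_castSucc_eq.2 (h j)
    have : (fun j => F (v j)) = fun j => ((f (m j) : 𝔥) : 𝔤) := by
      funext j
      rw [← hm, hF]
    rw [this]
    exact DFunLike.congr_fun h0 _

theorem trace_ad (hF : ∀ i, F i.castSucc = f i) (A : End ℝ 𝔥)
    (hA : ∀ x : 𝔥, ⁅F 6, (x : 𝔤)⁆ = A x) :
    ∑ i, F.coord i (LieAlgebra.ad ℝ 𝔤 (F 6) (F i)) = ∑ i, f.coord i (A (f i)) := by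
  rw [Fin.sum_univ_castSucc]
  have : LieAlgebra.ad ℝ 𝔤 (F 6) (F (Fin.last 6)) = 0 := lie_self (F 6)
  rw [this, map_zero, add_zero]
  refine Finset.sum_congr rfl fun i _ => ?_
  rw [hF, LieAlgebra.ad_apply, hA, coord_castSucc_mem hF]

theorem res_laplacian (h_ab : ∀ x y : 𝔥, ⁅(x : 𝔤), (y : 𝔤)⁆ = 0) (e : Basis (Fin 7) ℝ 𝔤)
    {Φ : Form 𝔤 4} (hΦ : d Φ = 0) : res 𝔥 (laplacian e Φ) = 0 := by
  ext v
  exact laplacian_apply_of_commute e hΦ _ fun i j => h_ab _ _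

theorem res_d_curryLeft (h_ab : ∀ x y : 𝔥, ⁅(x : 𝔤), (y : 𝔤)⁆ = 0) (x : 𝔤) (A : End ℝ 𝔥)
    (hA : ∀ y : 𝔥, ⁅x, (y : 𝔤)⁆ = A y) {k : ℕ} (α : Form 𝔤 k) :
    res 𝔥 ((d α).curryLeft x) = theta A (res 𝔥 α) := by
  ext v
  rw [res_apply, AlternatingMap.curryLeft_apply_apply, d_apply_cons _ _ _ fun i j => h_ab _ _,
    theta_apply, theta_apply]
  congr 1
  refine Finset.sum_congr rfl fun i _ => ?_
  rw [res_apply, LieAlgebra.ad_apply, hA]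
  congr 1
  funext j
  by_cases h : j = i
  · subst h; simp
  · simp [h]

/-- The codifferential contributes the action of the transpose A', and the outer differential then
contributes that of A. -/
theorem res_laplacian_curryLeft (h_ab : ∀ x y : 𝔥, ⁅(x : 𝔤), (y : 𝔤)⁆ = 0)
    (hF : ∀ i, F i.castSucc = f i) {e : Basis (Fin 7) ℝ 𝔤} (he : metric e = metric F)
    (A A' : End ℝ 𝔥) (hA : ∀ x : 𝔥, ⁅F 6, (x : 𝔤)⁆ = A x)
    (hA' : ∀ x y : 𝔥, metric F (A x) (y : 𝔤) = metric F (x : 𝔤) (A' y))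
    (htr : ∑ i, f.coord i (A (f i)) = 0) {Φ : Form 𝔤 4} (hΦ : d Φ = 0) :
    res 𝔥 ((laplacian e Φ).curryLeft (F 6))
      = theta A (theta A' (res 𝔥 (Φ.curryLeft (F 6)))) := by
  -- The transpose of ad F₆ on all of 𝔤: since ad F₆ kills F₆ and maps into 𝔥, its transpose is A'
  -- on 𝔥 and zero on F₆.
  let X' : End ℝ 𝔤 := F.constr ℝ (Fin.snoc (n := 6) (α := fun _ => 𝔤) (fun i => (A' (f i) : 𝔤)) 0)
  have hX6 : X' (F (Fin.last 6)) = 0 :=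
    (F.constr_basis ℝ _ _).trans (Fin.snoc_last (α := fun _ => 𝔤) _ _)
  have hX' : ∀ x : 𝔥, X' (x : 𝔤) = A' x := by
    intro x
    have : X' ∘ₗ 𝔥.toSubmodule.subtype = 𝔥.toSubmodule.subtype ∘ₗ A' := by
      refine f.ext fun i => ?_
      change X' (f i : 𝔤) = (A' (f i) : 𝔤)
      rw [← hF]
      simp [X']
    exact LinearMap.congr_fun this x
  have hperp : ∀ x : 𝔥, metric F (x : 𝔤) (F (Fin.last 6)) = 0 := by
    intro x
    rw [metric_comm, metric_basis_left]
    exact coord_last_mem hF x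
  have hX : ∀ x y, metric F (LieAlgebra.ad ℝ 𝔤 (F 6) x) y = metric F x (X' y) := by
    have : (metric F).compLeft (LieAlgebra.ad ℝ 𝔤 (F 6)) = (metric F).compRight X' := by
      refine LinearMap.BilinForm.ext_basis F fun i j => ?_
      simp only [LinearMap.BilinForm.compLeft_apply, LinearMap.BilinForm.compRight_apply]
      refine Fin.lastCases ?_ (fun i => ?_) i
      · have h0 : LieAlgebra.ad ℝ 𝔤 (F 6) (F (Fin.last 6)) = 0 := lie_self (F 6)
        rw [h0, map_zero, LinearMap.zero_apply]
        refine Fin.lastCases ?_ (fun j => ?_) j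
        · rw [hX6, map_zero]
        · rw [hF, hX', metric_comm, hperp]
      · rw [hF, LieAlgebra.ad_apply, hA]
        refine Fin.lastCases ?_ (fun j => ?_) j
        · rw [hX6, map_zero, hperp]
        · rw [hF, hX', hA']
    exact fun x y => LinearMap.congr_fun₂ this x y
  have hcod : res 𝔥 (codiff e (by norm_num : 3 + 1 + 3 = 7) Φ)
      = theta A' (res 𝔥 (Φ.curryLeft (F 6))) := by
    refine Basis.ext_alternating f fun g hg => ?_
    have h1 := codiff_apply_basis (F := F) (X' := X') (fun i j => by rw [hF, hF, h_ab]) hX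
      ((trace_ad hF A hA).trans htr) Φ g hg
    rw [← codiff_eq_of_metric_eq he] at h1
    simp_rw [hF] at h1
    rw [res_apply, h1, theta_apply, theta_apply, Fin.sum_univ_succ]
    have h0 : Φ (Function.update (Matrix.vecCons (F 6) fun j => ((f (g j) : 𝔥) : 𝔤)) 0
        (X' (Matrix.vecCons (F 6) (fun j => ((f (g j) : 𝔥) : 𝔤)) 0))) = 0 := by
      refine Φ.map_coord_zero 0 ?_
      rw [Function.update_self]
      exact hX6
    rw [h0, zero_add]
    congr 1
    refine Finset.sum_congr rfl fun i _ => ?_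
    rw [res_apply, AlternatingMap.curryLeft_apply_apply]
    congr 1
    funext j
    refine Fin.cases ?_ (fun j => ?_) j
    · rw [Function.update_of_ne (Fin.succ_ne_zero i).symm]
      rfl
    · by_cases h : j = i
      · subst h; simp [hX']
      · have : j.succ ≠ i.succ := by simpa using h
        simp [this, h]
  rw [laplacian_of_closed e hΦ, res_d_curryLeft h_ab _ A hA, hcod]

end AlmostAbelian

/-! ### Evaluation of forms and the G₂ contraction identity -/

section Forms

variable {V : Type*} [AddCommGroup V] [Module ℝ V] {ι : Type*}

theorem coForm_two (e : Basis ι ℝ V) (a b : ι) (x y : V) :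
    coForm e ![a, b] ![x, y] = e.coord a x * e.coord b y - e.coord b x * e.coord a y := by
  rw [coForm_apply, Matrix.det_fin_two]
  rfl

theorem coForm_three (e : Basis ι ℝ V) (a b c : ι) (x y z : V) :
    coForm e ![a, b, c] ![x, y, z] =
      e.coord a x * e.coord b y * e.coord c z - e.coord a x * e.coord c y * e.coord b z
        - e.coord b x * e.coord a y * e.coord c z + e.coord b x * e.coord c y * e.coord a z
        + e.coord c x * e.coord a y * e.coord b z - e.coord c x * e.coord b y * e.coord a z := by
  rw [coForm_apply, Matrix.det_fin_three]
  rfl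

theorem coForm_four (e : Basis ι ℝ V) (a b c d : ι) (x y z w : V) :
    coForm e ![a, b, c, d] ![x, y, z, w] =
      e.coord a x * coForm e ![b, c, d] ![y, z, w] - e.coord b x * coForm e ![a, c, d] ![y, z, w]
        + e.coord c x * coForm e ![a, b, d] ![y, z, w]
        - e.coord d x * coForm e ![a, b, c] ![y, z, w] := by
  simp only [coForm_three]
  rw [coForm_apply, Matrix.det_succ_row_zero, Fin.sum_univ_four]
  simp only [Matrix.det_fin_three, Matrix.submatrix_apply, Matrix.of_apply]
  simp [Fin.succAbove, Fin.lt_def]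
  ring

theorem form_ext_two {α β : Form V 2} (h : ∀ x y, α ![x, y] = β ![x, y]) : α = β := by
  ext v
  have : v = ![v 0, v 1] := by funext i; fin_cases i <;> rfl
  rw [this]
  exact h _ _

theorem form_ext_three {α β : Form V 3} (h : ∀ x y z, α ![x, y, z] = β ![x, y, z]) : α = β := by
  ext v
  have : v = ![v 0, v 1, v 2] := by funext i; fin_cases i <;> rfl
  rw [this]
  exact h _ _ _

theorem form_ext_four {α β : Form V 4} (h : ∀ x y z w, α ![x, y, z, w] = β ![x, y, z, w]) :
    α = β := by
  ext v
  have : v = ![v 0, v 1, v 2, v 3] := by funext i; fin_cases i <;> rfl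
  rw [this]
  exact h _ _ _ _

theorem coord_self [DecidableEq ι] (e : Basis ι ℝ V) (i j : ι) :
    e.coord i (e j) = if j = i then 1 else 0 := by
  simp [Finsupp.single_apply]

theorem theta_two (D : End ℝ V) (α : Form V 2) (x y : V) :
    theta D α ![x, y] = -(α ![D x, y] + α ![x, D y]) := by
  have h0 : Function.update ![x, y] 0 (D x) = ![D x, y] := by
    funext i; fin_cases i <;> rfl
  have h1 : Function.update ![x, y] 1 (D y) = ![x, D y] := by
    funext i; fin_cases i <;> rfl
  rw [theta_apply, Fin.sum_univ_two, ← h0, ← h1]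
  rfl

theorem theta_three (D : End ℝ V) (α : Form V 3) (x y z : V) :
    theta D α ![x, y, z] = -(α ![D x, y, z] + α ![x, D y, z] + α ![x, y, D z]) := by
  have h0 : Function.update ![x, y, z] 0 (D x) = ![D x, y, z] := by
    funext i; fin_cases i <;> rfl
  have h1 : Function.update ![x, y, z] 1 (D y) = ![x, D y, z] := by
    funext i; fin_cases i <;> rfl
  have h2 : Function.update ![x, y, z] 2 (D z) = ![x, y, D z] := by
    funext i; fin_cases i <;> rfl
  rw [theta_apply, Fin.sum_univ_three, ← h0, ← h1, ← h2]
  rfl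

theorem theta_four (D : End ℝ V) (α : Form V 4) (x y z w : V) :
    theta D α ![x, y, z, w] = -(α ![D x, y, z, w] + α ![x, D y, z, w] + α ![x, y, D z, w] + α ![x, y, z, D w]) := by
  have h0 : Function.update ![x, y, z, w] 0 (D x) = ![D x, y, z, w] := by
    funext i; fin_cases i <;> rfl
  have h1 : Function.update ![x, y, z, w] 1 (D y) = ![x, D y, z, w] := by
    funext i; fin_cases i <;> rfl
  have h2 : Function.update ![x, y, z, w] 2 (D z) = ![x, y, D z, w] := by
    funext i; fin_cases i <;> rfl
  have h3 : Function.update ![x, y, z, w] 3 (D w) = ![x, y, z, D w] := by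
    funext i; fin_cases i <;> rfl
  rw [theta_apply, Fin.sum_univ_four, ← h0, ← h1, ← h2, ← h3]
  rfl

/-- The value of a `G₂` form and its dual: the dual form in terms of the cross product. -/
theorem g2_identity_frame {φ : Form V 3} {e : Basis (Fin 7) ℝ V} (he : IsG2Frame φ e)
    (u v w z : V) : hodgeStar e (by norm_num : 3 + 4 = 7) φ ![u, v, w, z] =
      ∑ i, φ ![v, w, e i] * φ ![e i, u, z] - metric e u v * metric e w z
        + metric e u w * metric e v z := by
  rw [hodgeStar_eq_of_isG2Frame he, he]
  simp only [AlternatingMap.add_apply, AlternatingMap.sub_apply, coForm_four]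
  simp only [coForm_three, metric_apply, Fin.sum_univ_seven, coord_self]
  simp only [show ∀ i j : Fin 7, (i = j) = (i.val = j.val) from fun i j => propext Fin.ext_iff]
  norm_num
  ring

/-- The right-hand side depends on φ and the metric only, so the identity passes from the adapted
frame to any orthonormal one. This replaces the choice of an adapted frame whose last vector is the
given normal. -/
theorem g2_identity {φ : Form V 3} {e F : Basis (Fin 7) ℝ V} (he : IsG2Frame φ e)
    (h : metric e = metric F) (u v w z : V) :
    hodgeStar e (by norm_num : 3 + 4 = 7) φ ![u, v, w, z] =
      ∑ i, φ ![v, w, F i] * φ ![F i, u, z] - metric F u v * metric F w z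
        + metric F u w * metric F v z := by
  rw [g2_identity_frame he, ← h]
  have hlast : ∀ y : V, φ ![v, w, y] = φ ![y, v, w] := by
    intro y
    have := φ.map_perm ![v, w, y] (finRotate 3)
    rw [show ![v, w, y] ∘ finRotate 3 = ![w, y, v] by funext i; fin_cases i <;> rfl,
      sign_finRotate] at this
    have h2 := φ.map_perm ![w, y, v] (finRotate 3)
    rw [show ![w, y, v] ∘ finRotate 3 = ![y, v, w] by funext i; fin_cases i <;> rfl,
      sign_finRotate] at h2
    rw [h2, this]
    simp
  simp_rw [hlast]
  congr 2
  exact sum_mul_linear h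
    { toFun := fun y => φ.curryLeft y ![v, w]
      map_add' := by intros; simp
      map_smul' := by intros; simp }
    { toFun := fun y => φ.curryLeft y ![u, z]
      map_add' := by intros; simp
      map_smul' := by intros; simp }

end Forms

/-! ### Restriction of φ and ⋆φ to the hyperplane -/

section Frames

variable {𝔤 : Type*} [LieRing 𝔤] [LieAlgebra ℝ 𝔤] {𝔥 : LieIdeal ℝ 𝔤}
  {f : Basis (Fin 6) ℝ 𝔥} {F : Basis (Fin 7) ℝ 𝔤} {e : Basis (Fin 7) ℝ 𝔤} {φ : Form 𝔤 3}

theorem res_vec_two (α : Form 𝔤 2) (x y : 𝔥) : res 𝔥 α ![x, y] = α ![(x : 𝔤), (y : 𝔤)] := by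
  rw [res_apply]; congr 1; funext i; fin_cases i <;> rfl

theorem res_vec_three (α : Form 𝔤 3) (x y z : 𝔥) :
    res 𝔥 α ![x, y, z] = α ![(x : 𝔤), (y : 𝔤), (z : 𝔤)] := by
  rw [res_apply]; congr 1; funext i; fin_cases i <;> rfl

theorem res_vec_four (α : Form 𝔤 4) (x y z w : 𝔥) :
    res 𝔥 α ![x, y, z, w] = α ![(x : 𝔤), (y : 𝔤), (z : 𝔤), (w : 𝔤)] := by
  rw [res_apply]; congr 1; funext i; fin_cases i <;> rfl

theorem metric_mem (hF : ∀ i, F i.castSucc = f i) (x y : 𝔥) :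
    metric F (x : 𝔤) (y : 𝔤) = metric f x y := by
  rw [metric_apply, metric_apply, Fin.sum_univ_castSucc]
  simp_rw [coord_castSucc_mem hF]
  have := coord_last_mem hF x
  rw [show F.coord (Fin.last 6) (x : 𝔤) = 0 from this, zero_mul, add_zero]

theorem metric_last_mem (hF : ∀ i, F i.castSucc = f i) (x : 𝔥) : metric F (F 6) (x : 𝔤) = 0 := by
  rw [metric_basis_left, coord_last_mem hF]

theorem map_swap_first (φ : Form 𝔤 3) (x y z : 𝔤) : φ ![x, y, z] = -φ ![y, x, z] := by
  have := φ.map_swap ![y, x, z] (i := 0) (j := 1) (by decide)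
  rw [← this]
  congr 1
  funext i
  fin_cases i <;> rfl

theorem map_rotate (φ : Form 𝔤 3) (x y z : 𝔤) : φ ![x, y, z] = φ ![z, x, y] := by
  rw [map_swap_first φ z x y]
  have := φ.map_swap ![x, z, y] (i := 1) (j := 2) (by decide)
  rw [← this]
  congr 1
  funext i
  fin_cases i <;> rfl

/-- The `3`-forms `ψ` and `φ` on the hyperplane are related by the complex structure. -/
theorem res_hodgeStar_curryLeft (he : IsG2Frame φ e) (h : metric e = metric F)
    (hF : ∀ i, F i.castSucc = f i) (x y z : 𝔥) :
    res 𝔥 ((hodgeStar e (by norm_num : 3 + 4 = 7) φ).curryLeft (F 6)) ![x, y, z]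
      = -∑ i, res 𝔥 φ ![x, y, f i] * res 𝔥 (φ.curryLeft (F 6)) ![f i, z] := by
  rw [res_vec_three, AlternatingMap.curryLeft_apply_apply]
  have := g2_identity he h (F 6) x y z
  refine this.trans ?_
  rw [metric_last_mem hF, metric_last_mem hF, Fin.sum_univ_castSucc]
  have h0 : φ ![F (Fin.last 6), F 6, z] = 0 :=
    φ.map_eq_zero_of_eq _ (i := 0) (j := 1) rfl (by decide)
  rw [h0]
  simp only [zero_mul, mul_zero, add_zero, sub_zero]
  rw [← Finset.sum_neg_distrib]
  refine Finset.sum_congr rfl fun i _ => ?_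
  rw [res_vec_three, res_vec_two, AlternatingMap.curryLeft_apply_apply, hF,
    map_swap_first φ (f i : 𝔤)]
  ring

theorem res_hodgeStar (he : IsG2Frame φ e) (h : metric e = metric F)
    (hF : ∀ i, F i.castSucc = f i) (x y z w : 𝔥) :
    res 𝔥 (hodgeStar e (by norm_num : 3 + 4 = 7) φ) ![x, y, z, w]
      = ∑ i, res 𝔥 φ ![y, z, f i] * res 𝔥 φ ![f i, x, w]
        + res 𝔥 (φ.curryLeft (F 6)) ![y, z] * res 𝔥 (φ.curryLeft (F 6)) ![x, w]
        - metric f x y * metric f z w + metric f x z * metric f y w := by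
  rw [res_vec_four, g2_identity he h x y z w, Fin.sum_univ_castSucc]
  simp only [metric_mem hF]
  congr 3
  · refine Finset.sum_congr rfl fun i _ => ?_
    rw [res_vec_three, res_vec_three, hF]
  · rw [res_vec_two, res_vec_two, AlternatingMap.curryLeft_apply_apply,
      AlternatingMap.curryLeft_apply_apply, map_rotate φ (y : 𝔤)]
    rfl

theorem expand_last (ρ : Form 𝔥 3) (f : Basis (Fin 6) ℝ 𝔥) (x y z : 𝔥) :
    ρ ![x, y, z] = ∑ i, f.coord i z * ρ ![x, y, f i] := by
  have h : ∀ z : 𝔥, ρ ![x, y, z] = ρ (Function.update ![x, y, 0] 2 z) := by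
    intro z
    congr 1
    funext i
    fin_cases i <;> rfl
  conv_lhs => rw [← f.sum_repr z]
  rw [h, AlternatingMap.map_update_sum]
  refine Finset.sum_congr rfl fun i _ => ?_
  rw [AlternatingMap.map_update_smul, ← h]
  rfl

/-- A unit normal vector completes an `SU(3)` frame to a `G₂` frame: the form `φ` on the
hyperplane. -/
theorem res_of_frame (he : IsG2Frame φ e) (h : metric e = metric F)
    (hF : ∀ i, F i.castSucc = f i)
    (hω : res 𝔥 (φ.curryLeft (F 6)) = coForm f ![0, 1] + coForm f ![2, 3] + coForm f ![4, 5])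
    (hψ : -res 𝔥 ((hodgeStar e (by norm_num : 3 + 4 = 7) φ).curryLeft (F 6))
      = -coForm f ![1, 3, 5] + coForm f ![0, 2, 5] + coForm f ![0, 3, 4] + coForm f ![1, 2, 4]) :
    res 𝔥 φ = coForm f ![0, 2, 4] - coForm f ![0, 3, 5] - coForm f ![1, 2, 5]
      - coForm f ![1, 3, 4] := by
  have key : ∀ x y z : 𝔥, (-coForm f ![1, 3, 5] + coForm f ![0, 2, 5] + coForm f ![0, 3, 4]
      + coForm f ![1, 2, 4]) ![x, y, z] = ∑ i, res 𝔥 φ ![x, y, f i] * (coForm f ![0, 1]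
        + coForm f ![2, 3] + coForm f ![4, 5]) ![f i, z] := by
    intro x y z
    rw [← hψ, ← hω, AlternatingMap.neg_apply, res_hodgeStar_curryLeft he h hF, neg_neg]
  refine form_ext_three fun x y z => ?_
  rw [expand_last (res 𝔥 φ) f]
  -- Since ω pairs each basis vector with exactly one partner, a basis vector in the last slot
  -- isolates a single value ρ(x, y, fⱼ).
  have h0 := key x y (f 0)
  have h1 := key x y (f 1)
  have h2 := key x y (f 2)
  have h3 := key x y (f 3)
  have h4 := key x y (f 4)
  have h5 := key x y (f 5)
  simp only [AlternatingMap.add_apply, AlternatingMap.sub_apply, AlternatingMap.neg_apply,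
    coForm_three, coForm_two, Fin.sum_univ_six, coord_self] at h0 h1 h2 h3 h4 h5 ⊢
  simp only [show ∀ i j : Fin 6, (i = j) = (i.val = j.val) from fun i j => propext Fin.ext_iff]
    at h0 h1 h2 h3 h4 h5
  norm_num at h0 h1 h2 h3 h4 h5
  simp only [← Basis.coord_apply] at h0 h1 h2 h3 h4 h5
  linear_combination -f.coord 0 z * h1 + f.coord 1 z * h0 - f.coord 2 z * h3 + f.coord 3 z * h2
    - f.coord 4 z * h5 + f.coord 5 z * h4

/-- The dual `4`-form on the hyperplane is `ω ∧ ω / 2`. -/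
theorem res_hodgeStar_of_frame (he : IsG2Frame φ e) (h : metric e = metric F)
    (hF : ∀ i, F i.castSucc = f i)
    (hω : res 𝔥 (φ.curryLeft (F 6)) = coForm f ![0, 1] + coForm f ![2, 3] + coForm f ![4, 5])
    (hρ : res 𝔥 φ = coForm f ![0, 2, 4] - coForm f ![0, 3, 5] - coForm f ![1, 2, 5]
      - coForm f ![1, 3, 4]) (x y z w : 𝔥) :
    res 𝔥 (hodgeStar e (by norm_num : 3 + 4 = 7) φ) ![x, y, z, w]
      = res 𝔥 (φ.curryLeft (F 6)) ![x, y] * res 𝔥 (φ.curryLeft (F 6)) ![z, w]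
        - res 𝔥 (φ.curryLeft (F 6)) ![x, z] * res 𝔥 (φ.curryLeft (F 6)) ![y, w]
        + res 𝔥 (φ.curryLeft (F 6)) ![x, w] * res 𝔥 (φ.curryLeft (F 6)) ![y, z] := by
  rw [res_hodgeStar he h hF, hω, hρ]
  simp only [AlternatingMap.add_apply, AlternatingMap.sub_apply,
    coForm_three, coForm_two, Fin.sum_univ_six, coord_self, metric_apply]
  simp only [show ∀ i j : Fin 6, (i = j) = (i.val = j.val) from fun i j => propext Fin.ext_iff]
  norm_num
  ring

end Frames

/-! ### Unitary eigenbases of symmetric maps anticommuting with J -/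

section Eigenframe

open scoped InnerProductSpace

/-- Induction: the orthogonal complement of the vectors vᵢ, Jvᵢ found so far is S-invariant, because
Jvᵢ is an eigenvector for −sᵢ, and nonzero by dimension. A unit eigenvector of S there is orthogonal
to its own image under J, as J is skew. -/
theorem exists_unitary_eigenvectors {E : Type*} [NormedAddCommGroup E] [InnerProductSpace ℝ E]
    [FiniteDimensional ℝ E] (S J : E →ₗ[ℝ] E) (hS : S.IsSymmetric)
    (hJ : ∀ x y, ⟪J x, y⟫_ℝ = -⟪x, J y⟫_ℝ) (hSJ : ∀ x, S (J x) = -J (S x)) (n : ℕ)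
    (hn : 2 * n ≤ finrank ℝ E) :
    ∃ (v : Fin n → E) (s : Fin n → ℝ), (∀ i j, ⟪v i, v j⟫_ℝ = if i = j then 1 else 0) ∧
      (∀ i j, ⟪v i, J (v j)⟫_ℝ = 0) ∧ ∀ i, S (v i) = s i • v i := by
  induction n with
  | zero => exact ⟨fun i => i.elim0, fun i => i.elim0, fun i => i.elim0, fun i => i.elim0,
      fun i => i.elim0⟩
  | succ n ih =>
    obtain ⟨v, s, hv, hvJ, hvS⟩ := ih (by omega)
    let T : E →ₗ[ℝ] (Fin n ⊕ Fin n → ℝ) := LinearMap.pi fun i =>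
      (innerₛₗ ℝ (Sum.elim v (fun i => J (v i)) i) : E →ₗ[ℝ] ℝ)
    have hmem : ∀ x, x ∈ LinearMap.ker T ↔ (∀ i, ⟪v i, x⟫_ℝ = 0) ∧ ∀ i, ⟪J (v i), x⟫_ℝ = 0 := by
      intro x
      rw [LinearMap.mem_ker, funext_iff, Sum.forall]
      rfl
    have hW : LinearMap.ker T ≠ ⊥ := by
      refine LinearMap.ker_ne_bot_of_finrank_lt ?_
      simp only [Module.finrank_fintype_fun_eq_card, Fintype.card_sum, Fintype.card_fin]
      omega
    have hinv : ∀ x ∈ LinearMap.ker T, S x ∈ LinearMap.ker T := by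
      intro x hx
      rw [hmem] at hx ⊢
      refine ⟨fun i => ?_, fun i => ?_⟩
      · rw [← hS, hvS, real_inner_smul_left, hx.1, mul_zero]
      · rw [← hS, hSJ, hvS, map_smul, inner_neg_left, real_inner_smul_left, hx.2, mul_zero, neg_zero]
    have hpos : 0 < finrank ℝ (LinearMap.ker T) := by
      rw [Nat.pos_iff_ne_zero]
      exact fun h => hW (Submodule.finrank_eq_zero.1 h)
    have hSW := hS.restrict_invariant hinv
    let w := hSW.eigenvectorBasis rfl ⟨0, hpos⟩
    have hwS : S (w : E) = hSW.eigenvalues rfl ⟨0, hpos⟩ • (w : E) := by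
      have := congrArg (Subtype.val) (hSW.apply_eigenvectorBasis rfl ⟨0, hpos⟩)
      exact this
    have hw1 : ⟪(w : E), (w : E)⟫_ℝ = 1 := by
      have := (hSW.eigenvectorBasis rfl).orthonormal.1 ⟨0, hpos⟩
      rw [real_inner_self_eq_norm_sq]
      change ‖(w : E)‖ = 1 at this
      rw [this]
      norm_num
    have hwmem := (hmem w).1 w.2
    have hwJ : ⟪(w : E), J w⟫_ℝ = 0 := by
      have := hJ w w
      rw [real_inner_comm] at this
      linarith
    refine ⟨Fin.cons (w : E) v, Fin.cons (hSW.eigenvalues rfl ⟨0, hpos⟩) s, ?_, ?_, ?_⟩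
    · intro i j
      refine Fin.cases ?_ (fun i => ?_) i <;> refine Fin.cases ?_ (fun j => ?_) j
      · simpa using hw1
      · rw [Fin.cons_zero, Fin.cons_succ, real_inner_comm, hwmem.1, if_neg (Fin.succ_ne_zero j).symm]
      · rw [Fin.cons_zero, Fin.cons_succ, hwmem.1, if_neg (Fin.succ_ne_zero i)]
      · simp [hv]
    · intro i j
      refine Fin.cases ?_ (fun i => ?_) i <;> refine Fin.cases ?_ (fun j => ?_) j
      · exact hwJ
      · rw [Fin.cons_zero, Fin.cons_succ, real_inner_comm, hwmem.2]
      · rw [Fin.cons_zero, Fin.cons_succ, ← neg_eq_zero, ← hJ, hwmem.2]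
      · simp [hvJ]
    · intro i
      refine Fin.cases ?_ (fun i => ?_) i
      · exact hwS
      · simp [hvS]

variable {V : Type*} [AddCommGroup V] [Module ℝ V]

/-- The inner product space given by a positive definite bilinear form. -/
abbrev coreOfPos (B : LinearMap.BilinForm ℝ V) (hB : ∀ x y, B x y = B y x)
    (hpos : ∀ x, x ≠ 0 → 0 < B x x) : InnerProductSpace.Core ℝ V where
  inner x y := B x y
  conj_inner_symm x y := by simpa using hB y x
  re_inner_nonneg x := by
    by_cases h : x = 0
    · simp [h]
    · simpa using (hpos x h).le
  add_left x y z := by simp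
  smul_left x y r := by simp
  definite x h := by
    by_contra hx
    exact (hpos x hx).ne' h

theorem exists_orthonormal_basis (B : LinearMap.BilinForm ℝ V) (hB : ∀ x y, B x y = B y x)
    (hpos : ∀ x, x ≠ 0 → 0 < B x x) {n : ℕ} [FiniteDimensional ℝ V] (hn : finrank ℝ V = n) :
    ∃ f : Basis (Fin n) ℝ V, ∀ i j, B (f i) (f j) = if i = j then 1 else 0 := by
  let _ := (coreOfPos B hB hpos).toNormedAddCommGroup
  let _ : InnerProductSpace ℝ V := InnerProductSpace.ofCore (coreOfPos B hB hpos).toCore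
  let b := (stdOrthonormalBasis ℝ V).reindex (finCongr hn)
  refine ⟨b.toBasis, fun i j => ?_⟩
  have := orthonormal_iff_ite.1 b.orthonormal i j
  rw [← b.coe_toBasis] at this
  exact this

theorem exists_unitary_eigenbasis (B : LinearMap.BilinForm ℝ V) (hB : ∀ x y, B x y = B y x)
    (hpos : ∀ x, x ≠ 0 → 0 < B x x) [FiniteDimensional ℝ V] (hn : finrank ℝ V = 6)
    (S J : End ℝ V) (hS : ∀ x y, B (S x) y = B x (S y)) (hJ : ∀ x y, B (J x) y = -B x (J y))
    (hJ2 : ∀ x, J (J x) = -x) (hSJ : ∀ x, S (J x) = -J (S x)) :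
    ∃ (f : Basis (Fin 6) ℝ V) (s : Fin 3 → ℝ),
      (∀ i j, B (f i) (f j) = if i = j then 1 else 0) ∧
      (J (f 0) = f 1 ∧ J (f 2) = f 3 ∧ J (f 4) = f 5) ∧
      S (f 0) = s 0 • f 0 ∧ S (f 2) = s 1 • f 2 ∧ S (f 4) = s 2 • f 4 := by
  let _ := (coreOfPos B hB hpos).toNormedAddCommGroup
  let _ : InnerProductSpace ℝ V := InnerProductSpace.ofCore (coreOfPos B hB hpos).toCore
  obtain ⟨v, s, hv, hvJ, hvS⟩ := exists_unitary_eigenvectors S J hS hJ hSJ 3 (by omega)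
  replace hv : ∀ i j, B (v i) (v j) = if i = j then 1 else 0 := hv
  replace hvJ : ∀ i j, B (v i) (J (v j)) = 0 := hvJ
  have hJJ : ∀ i j, B (J (v i)) (J (v j)) = if i = j then 1 else 0 := by
    intro i j
    rw [hJ, hJ2, map_neg, neg_neg, hv]
  have hJv : ∀ i j, B (J (v i)) (v j) = 0 := fun i j => by rw [hB, hvJ]
  let w : Fin 6 → V := ![v 0, J (v 0), v 1, J (v 1), v 2, J (v 2)]
  have hw : ∀ i j, B (w i) (w j) = if i = j then 1 else 0 := by
    intro i j
    fin_cases i <;> fin_cases j <;> simp [w, hv, hvJ, hJJ, hJv]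
  let f := basisOfLinearIndependentOfCardEqFinrank (linearIndependent_of_orthonormal B w hw)
    (by rw [hn, Fintype.card_fin])
  have hf : ∀ i, f i = w i := fun i => by simp [f]
  refine ⟨f, s, fun i j => by rw [hf, hf, hw], ⟨?_, ?_, ?_⟩, ?_, ?_, ?_⟩
  all_goals simp [hf, w, hvS]

end Eigenframe

/-! ### Forms determined by their values on increasing indices; injectivity of ω∧ -/

section Ext

variable {V : Type*} [AddCommGroup V] [Module ℝ V] {n : ℕ}

theorem ext_strictMono (e : Basis (Fin n) ℝ V) {k : ℕ} {α β : Form V k}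
    (h : ∀ v : Fin k → Fin n, StrictMono v → α (fun i => e (v i)) = β fun i => e (v i)) :
    α = β := by
  refine Basis.ext_alternating e fun v hv => ?_
  have hs : StrictMono (v ∘ Tuple.sort v) :=
    (Tuple.monotone_sort v).strictMono_of_injective (hv.comp (Tuple.sort v).injective)
  have h1 := h _ hs
  have h2 : ∀ γ : Form V k, γ (fun i => e ((v ∘ Tuple.sort v) i))
      = Equiv.Perm.sign (Tuple.sort v) • γ fun i => e (v i) := fun γ =>
    γ.map_perm (fun i => e (v i)) (Tuple.sort v)
  rw [h2, h2] at h1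
  exact smul_left_cancel _ h1

theorem ext_three (e : Basis (Fin 6) ℝ V) {α β : Form V 3}
    (h : ∀ i j k : Fin 6, i < j → j < k → α ![e i, e j, e k] = β ![e i, e j, e k]) : α = β := by
  refine ext_strictMono e fun v hv => ?_
  have : (fun i => e (v i)) = ![e (v 0), e (v 1), e (v 2)] := by
    funext i; fin_cases i <;> rfl
  rw [this]
  exact h _ _ _ (hv (by decide)) (hv (by decide))

theorem ext_two (e : Basis (Fin 6) ℝ V) {α β : Form V 2}
    (h : ∀ i j : Fin 6, i < j → α ![e i, e j] = β ![e i, e j]) : α = β := by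
  refine ext_strictMono e fun v hv => ?_
  have : (fun i => e (v i)) = ![e (v 0), e (v 1)] := by
    funext i; fin_cases i <;> rfl
  rw [this]
  exact h _ _ (hv (by decide))

theorem forall_lt_two {P : Fin 6 → Fin 6 → Prop} (h : P 0 1 ∧ P 0 2 ∧ P 0 3 ∧ P 0 4 ∧ P 0 5 ∧
    P 1 2 ∧ P 1 3 ∧ P 1 4 ∧ P 1 5 ∧ P 2 3 ∧ P 2 4 ∧ P 2 5 ∧ P 3 4 ∧ P 3 5 ∧ P 4 5)
    (i j : Fin 6) (hij : i < j) : P i j := by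
  fin_cases i <;> fin_cases j <;> first | exact absurd hij (by decide) | tauto

theorem forall_lt_three {P : Fin 6 → Fin 6 → Fin 6 → Prop}
    (h012 : P 0 1 2) (h013 : P 0 1 3) (h014 : P 0 1 4) (h015 : P 0 1 5) (h023 : P 0 2 3)
    (h024 : P 0 2 4) (h025 : P 0 2 5) (h034 : P 0 3 4) (h035 : P 0 3 5) (h045 : P 0 4 5)
    (h123 : P 1 2 3) (h124 : P 1 2 4) (h125 : P 1 2 5) (h134 : P 1 3 4) (h135 : P 1 3 5)
    (h145 : P 1 4 5) (h234 : P 2 3 4) (h235 : P 2 3 5) (h245 : P 2 4 5) (h345 : P 3 4 5)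
    (i j k : Fin 6) (hij : i < j) (hjk : j < k) : P i j k := by
  fin_cases i <;> fin_cases j <;> first | exact absurd hij (by decide) | skip
  all_goals fin_cases k <;> first | exact absurd hjk (by decide) | assumption

/-- The form `e¹² + e³⁴ + e⁵⁶`. -/
def stdOmega (f : Basis (Fin 6) ℝ V) : Form V 2 :=
  coForm f ![0, 1] + coForm f ![2, 3] + coForm f ![4, 5]

theorem stdOmega_apply (f : Basis (Fin 6) ℝ V) (x y : V) : stdOmega f ![x, y] =
    f.coord 0 x * f.coord 1 y - f.coord 1 x * f.coord 0 y + (f.coord 2 x * f.coord 3 y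
      - f.coord 3 x * f.coord 2 y) + (f.coord 4 x * f.coord 5 y - f.coord 5 x * f.coord 4 y) := by
  simp only [stdOmega, AlternatingMap.add_apply, coForm_two]

/-- Multiplication by `ω` is injective on `2`-forms in dimension six. -/
theorem eq_zero_of_wedge_stdOmega (f : Basis (Fin 6) ℝ V) (η : Form V 2)
    (h : ∀ x y z w, η ![x, y] * stdOmega f ![z, w] + stdOmega f ![x, y] * η ![z, w]
      - (η ![x, z] * stdOmega f ![y, w] + stdOmega f ![x, z] * η ![y, w])
      + (η ![x, w] * stdOmega f ![y, z] + stdOmega f ![x, w] * η ![y, z]) = 0) : η = 0 := by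
  refine ext_two f (forall_lt_two ?_)
  have H := fun i j k l => h (f i) (f j) (f k) (f l)
  simp only [stdOmega_apply, coord_self] at H
  simp only [AlternatingMap.zero_apply]
  have h01 := H 0 1 2 3
  have h02 := H 0 1 4 5
  have h03 := H 2 3 4 5
  have h1 := H 0 2 4 5
  have h2 := H 0 3 4 5
  have h3 := H 1 2 4 5
  have h4 := H 1 3 4 5
  have h5 := H 0 4 2 3
  have h6 := H 0 5 2 3
  have h7 := H 1 4 2 3
  have h8 := H 1 5 2 3
  have h9 := H 2 4 0 1
  have h10 := H 2 5 0 1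
  have h11 := H 3 4 0 1
  have h12 := H 3 5 0 1
  clear H h
  simp only [show ∀ i j : Fin 6, (i = j) = (i.val = j.val) from fun i j => propext Fin.ext_iff]
    at *
  norm_num at *
  refine ⟨?_, ?_, ?_, ?_, ?_, ?_, ?_, ?_, ?_, ?_, ?_, ?_, ?_, ?_, ?_⟩ <;> linarith

end Ext

/-! ### Normalizing the phase of the complex volume form -/

section Trilinear

variable {V : Type*} [AddCommGroup V] [Module ℝ V]

theorem three_first (ρ : Form V 3) (a b : ℝ) (x x' y z : V) :
    ρ ![a • x + b • x', y, z] = a * ρ ![x, y, z] + b * ρ ![x', y, z] := by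
  have h : ∀ x : V, ρ ![x, y, z] = ρ (Function.update ![0, y, z] 0 x) := fun x => by
    congr 1; funext i; fin_cases i <;> rfl
  simp only [h, AlternatingMap.map_update_add, AlternatingMap.map_update_smul, smul_eq_mul]

theorem three_second (ρ : Form V 3) (a b : ℝ) (x y y' z : V) :
    ρ ![x, a • y + b • y', z] = a * ρ ![x, y, z] + b * ρ ![x, y', z] := by
  have h : ∀ y : V, ρ ![x, y, z] = ρ (Function.update ![x, 0, z] 1 y) := fun x => by
    congr 1; funext i; fin_cases i <;> rfl
  simp only [h, AlternatingMap.map_update_add, AlternatingMap.map_update_smul, smul_eq_mul]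

theorem three_third (ρ : Form V 3) (a b : ℝ) (x y z z' : V) :
    ρ ![x, y, a • z + b • z'] = a * ρ ![x, y, z] + b * ρ ![x, y, z'] := by
  have h : ∀ z : V, ρ ![x, y, z] = ρ (Function.update ![x, y, 0] 2 z) := fun x => by
    congr 1; funext i; fin_cases i <;> rfl
  simp only [h, AlternatingMap.map_update_add, AlternatingMap.map_update_smul, smul_eq_mul]

theorem three_neg_third (ρ : Form V 3) (x y z : V) : ρ ![x, y, -z] = -ρ ![x, y, z] := by
  simpa using three_third ρ (-1) 0 x y z z

theorem three_swap_first (ρ : Form V 3) (x y z : V) : ρ ![x, y, z] = -ρ ![y, x, z] := by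
  have := ρ.map_swap ![y, x, z] (i := 0) (j := 1) (by decide)
  rw [← this]
  congr 1
  funext i
  fin_cases i <;> rfl

theorem three_swap_last (ρ : Form V 3) (x y z : V) : ρ ![x, y, z] = -ρ ![x, z, y] := by
  have := ρ.map_swap ![x, z, y] (i := 1) (j := 2) (by decide)
  rw [← this]
  congr 1
  funext i
  fin_cases i <;> rfl

theorem three_self_last (ρ : Form V 3) (x y : V) : ρ ![x, y, y] = 0 :=
  ρ.map_eq_zero_of_eq _ (i := 1) (j := 2) rfl (by decide)

theorem three_self_outer (ρ : Form V 3) (x y : V) : ρ ![x, y, x] = 0 :=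
  ρ.map_eq_zero_of_eq _ (i := 0) (j := 2) rfl (by decide)

/-- A complex cube root of a unit complex number, in real terms. -/
theorem exists_cube_root (p q : ℝ) (h : p ^ 2 + q ^ 2 = 1) :
    ∃ c s : ℝ, c ^ 2 + s ^ 2 = 1 ∧ c ^ 3 - 3 * c * s ^ 2 = p ∧ 3 * c ^ 2 * s - s ^ 3 = q := by
  obtain ⟨z, hz⟩ := IsAlgClosed.exists_pow_nat_eq (⟨p, q⟩ : ℂ) (n := 3) (by norm_num)
  have hre := congrArg Complex.re hz
  have him := congrArg Complex.im hz
  simp [pow_succ] at hre him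
  have h1 : (z.re ^ 2 + z.im ^ 2) ^ 3 = 1 := by
    rw [← h, ← hre, ← him]
    ring
  refine ⟨z.re, z.im, ?_, ?_, ?_⟩
  · exact (pow_eq_one_iff_of_nonneg (by positivity) (by norm_num)).1 h1
  · rw [← hre]; ring
  · rw [← him]; ring

theorem exists_angle (a b : ℝ) (h : a ^ 2 + b ^ 2 = 1) :
    ∃ θ ∈ Set.Icc 0 (2 * Real.pi), Real.cos θ = a ∧ Real.sin θ = b := by
  have hz : ‖(⟨a, b⟩ : ℂ)‖ = 1 := by
    rw [Complex.norm_def, Complex.normSq_mk, ← sq, ← sq, h, Real.sqrt_one]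
  have hne : (⟨a, b⟩ : ℂ) ≠ 0 := by
    intro h0
    rw [h0] at hz
    simp at hz
  have hc : Real.cos (Complex.arg ⟨a, b⟩) = a := by
    rw [Complex.cos_arg hne, hz, div_one]
  have hs : Real.sin (Complex.arg ⟨a, b⟩) = b := by
    rw [Complex.sin_arg, hz, div_one]
  have h1 := Complex.neg_pi_lt_arg ⟨a, b⟩
  have h2 := Complex.arg_le_pi ⟨a, b⟩
  have hpi := Real.pi_pos
  by_cases h0 : 0 ≤ Complex.arg ⟨a, b⟩
  · exact ⟨_, ⟨h0, by linarith⟩, hc, hs⟩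
  · refine ⟨Complex.arg ⟨a, b⟩ + 2 * Real.pi, ⟨by linarith, by linarith⟩, ?_, ?_⟩
    · rw [Real.cos_add_two_pi, hc]
    · rw [Real.sin_add_two_pi, hs]

/-- The standard form of the imaginary part of a complex volume form. -/
def stdPsi (f : Basis (Fin 6) ℝ V) : Form V 3 :=
  -coForm f ![1, 3, 5] + coForm f ![0, 2, 5] + coForm f ![0, 3, 4] + coForm f ![1, 2, 4]

theorem stdPsi_apply (f : Basis (Fin 6) ℝ V) (x y z : V) : stdPsi f ![x, y, z] =
    -coForm f ![1, 3, 5] ![x, y, z] + coForm f ![0, 2, 5] ![x, y, z]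
      + coForm f ![0, 3, 4] ![x, y, z] + coForm f ![1, 2, 4] ![x, y, z] := rfl

/-- An orthonormal frame adapted to the complex structure is adapted to the `SU(3)`-structure as
soon as the complex volume form is normalized on it. -/
theorem isSU3Frame_of_unitary {B : LinearMap.BilinForm ℝ V} {J : End ℝ V} {ω : Form V 2}
    {ψ ρ : Form V 3} (hJ : ∀ x y, B (J x) y = ω ![x, y]) (hJ2 : ∀ x, J (J x) = -x)
    (hψ : ∀ x y z, ψ ![x, y, z] = -ρ ![x, y, J z])
    (hρ : ∀ x y z, ρ ![x, y, J z] = ρ ![x, J y, z]) (hρ' : ∀ x y z, ρ ![x, J y, z] = ρ ![J x, y, z])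
    {f : Basis (Fin 6) ℝ V} (hf : ∀ i j, B (f i) (f j) = if i = j then 1 else 0)
    (h0 : J (f 0) = f 1) (h2 : J (f 2) = f 3) (h4 : J (f 4) = f 5)
    (hp : ρ ![f 0, f 2, f 4] = 1) (hq : ρ ![f 0, f 2, f 5] = 0) : IsSU3Frame B ω ψ f := by
  have h1 : J (f 1) = -f 0 := by rw [← h0, hJ2]
  have h3 : J (f 3) = -f 2 := by rw [← h2, hJ2]
  have h5 : J (f 5) = -f 4 := by rw [← h4, hJ2]
  refine ⟨hf, ?_, ?_⟩
  · refine ext_two f ?_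
    have hr : ∀ i j, ω ![f i, f j] = B (J (f i)) (f j) := fun i j => (hJ _ _).symm
    change ∀ i j, i < j → ω ![f i, f j] = stdOmega f ![f i, f j]
    simp only [hr, stdOmega_apply, coord_self]
    refine forall_lt_two ?_
    simp only [h0, h1, h2, h3, h4, map_neg, LinearMap.neg_apply, hf]
    simp
  · refine ext_three f ?_
    change ∀ i j k, i < j → j < k → ψ ![f i, f j, f k] = stdPsi f ![f i, f j, f k]
    have hv : ∀ x z, ρ ![x, J x, z] = 0 := by
      intro x z
      have := three_swap_first ρ x (J x) z
      rw [← hρ'] at this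
      linarith
    have h01 : ∀ z, ρ ![f 0, f 1, z] = 0 := fun z => by rw [← h0, hv]
    have h34 : ρ ![f 0, f 3, f 4] = 0 := by rw [← h2, ← hρ, h4, hq]
    have h35 : ρ ![f 0, f 3, f 5] = -1 := by rw [← h2, ← hρ, h5, three_neg_third, hp]
    have h124 : ρ ![f 1, f 2, f 4] = 0 := by rw [← h0, ← hρ', h2, h34]
    have h125 : ρ ![f 1, f 2, f 5] = -1 := by rw [← h0, ← hρ', h2, h35]
    have h134 : ρ ![f 1, f 3, f 4] = -1 := by rw [← h2, ← hρ, h4, h125]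
    have h135 : ρ ![f 1, f 3, f 5] = 0 := by rw [← h2, ← hρ, h5, three_neg_third, h124, neg_zero]
    have h23' : ∀ z, ρ ![f 2, f 3, z] = 0 := fun z => by rw [← h2, hv]
    simp only [hψ, stdPsi_apply, coForm_three, coord_self]
    refine forall_lt_three ?_ ?_ ?_ ?_ ?_ ?_ ?_ ?_ ?_ ?_ ?_ ?_ ?_ ?_ ?_ ?_ ?_ ?_ ?_ ?_ <;>
      simp only [h2, h3, h4, h5, three_neg_third, three_self_last, h01, hp, hq, h34, h35, h124,
        h125, h134, h135, h23'] <;> simp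

/-- Multiplying the three complex lines by one unit number z multiplies the volume form by z³. Its
value on the eigenbasis is p − iq, so z is a cube root of p + iq. Antilinearity of S turns an
eigenvector v for s into zv with S(zv) = s z⁻²(zv), whence e^{iθ} = z⁻². -/
theorem exists_normalForm_of_eigenbasis {B : LinearMap.BilinForm ℝ V} {J S : End ℝ V}
    {ω : Form V 2} {ψ ρ : Form V 3} (hJ : ∀ x y, B (J x) y = ω ![x, y])
    (hJ2 : ∀ x, J (J x) = -x) (hψ : ∀ x y z, ψ ![x, y, z] = -ρ ![x, y, J z])
    (hρ : ∀ x y z, ρ ![x, y, J z] = ρ ![x, J y, z]) (hρ' : ∀ x y z, ρ ![x, J y, z] = ρ ![J x, y, z])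
    (hSJ : ∀ x, S (J x) = -J (S x)) (h_dim : finrank ℝ V = 6)
    {v : Basis (Fin 6) ℝ V} {s : Fin 3 → ℝ} (hv : ∀ i j, B (v i) (v j) = if i = j then 1 else 0)
    (h0 : J (v 0) = v 1) (h2 : J (v 2) = v 3) (h4 : J (v 4) = v 5)
    (hs0 : S (v 0) = s 0 • v 0) (hs2 : S (v 2) = s 1 • v 2) (hs4 : S (v 4) = s 2 • v 4)
    (hpq : ρ ![v 0, v 2, v 4] ^ 2 + ρ ![v 0, v 2, v 5] ^ 2 = 1) :
    ∃ (f : Basis (Fin 6) ℝ V) (θ : ℝ) (s : Fin 3 → ℝ), θ ∈ Set.Icc 0 (2 * Real.pi) ∧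
      IsSU3Frame B ω ψ f ∧ IsNormalForm S f θ s := by
  obtain ⟨p, hp⟩ : ∃ p, ρ ![v 0, v 2, v 4] = p := ⟨_, rfl⟩
  obtain ⟨q, hq⟩ : ∃ q, ρ ![v 0, v 2, v 5] = q := ⟨_, rfl⟩
  rw [hp, hq] at hpq
  obtain ⟨c, t, hct, hc, ht⟩ := exists_cube_root p q hpq
  have h1 : J (v 1) = -v 0 := by rw [← h0, hJ2]
  have h3 : J (v 3) = -v 2 := by rw [← h2, hJ2]
  have h5 : J (v 5) = -v 4 := by rw [← h4, hJ2]
  have hs1 : S (v 1) = -(s 0 • v 1) := by rw [← h0, hSJ, hs0, map_smul]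
  have hs3 : S (v 3) = -(s 1 • v 3) := by rw [← h2, hSJ, hs2, map_smul]
  have hs5 : S (v 5) = -(s 2 • v 5) := by rw [← h4, hSJ, hs4, map_smul]
  let w : Fin 6 → V := ![c • v 0 + t • v 1, (-t) • v 0 + c • v 1, c • v 2 + t • v 3,
    (-t) • v 2 + c • v 3, c • v 4 + t • v 5, (-t) • v 4 + c • v 5]
  have hw : ∀ i j, B (w i) (w j) = if i = j then 1 else 0 := by
    have e1 : c * c + t * t = 1 := by linarith [hct]
    have e2 : t * t + c * c = 1 := by linarith [hct]
    have e3 : -(c * t) + t * c = 0 := by ring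
    have e4 : -(t * c) + c * t = 0 := by ring
    intro i j
    fin_cases i <;> fin_cases j <;> simp [w, hv, e1, e2, e3, e4]
  let f := basisOfLinearIndependentOfCardEqFinrank (linearIndependent_of_orthonormal B w hw)
    (by rw [h_dim, Fintype.card_fin])
  have hf : ∀ i, f i = w i := fun i => by simp [f]
  have f0 : f 0 = c • v 0 + t • v 1 := hf 0
  have f1 : f 1 = (-t) • v 0 + c • v 1 := hf 1
  have f2 : f 2 = c • v 2 + t • v 3 := hf 2
  have f3 : f 3 = (-t) • v 2 + c • v 3 := hf 3
  have f4 : f 4 = c • v 4 + t • v 5 := hf 4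
  have f5 : f 5 = (-t) • v 4 + c • v 5 := hf 5
  -- These are the real and imaginary parts of z⁻² for z = c + it with |z| = 1.
  obtain ⟨θ, hθ, hcos, hsin⟩ := exists_angle (c ^ 2 - t ^ 2) (-2 * c * t) (by
    have : (c ^ 2 - t ^ 2) ^ 2 + (-2 * c * t) ^ 2 = (c ^ 2 + t ^ 2) ^ 2 := by ring
    rw [this, hct, one_pow])
  have r034 : ρ ![v 0, v 3, v 4] = q := by rw [← h2, ← hρ, h4, hq]
  have r035 : ρ ![v 0, v 3, v 5] = -p := by rw [← h2, ← hρ, h5, three_neg_third, hp]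
  have r124 : ρ ![v 1, v 2, v 4] = q := by rw [← h0, ← hρ', h2, r034]
  have r125 : ρ ![v 1, v 2, v 5] = -p := by rw [← h0, ← hρ', h2, r035]
  have r134 : ρ ![v 1, v 3, v 4] = -p := by rw [← h2, ← hρ, h4, r125]
  have r135 : ρ ![v 1, v 3, v 5] = -q := by rw [← h2, ← hρ, h5, three_neg_third, r124]
  refine ⟨f, θ, s, hθ, ?_, ?_⟩
  · refine isSU3Frame_of_unitary (J := J) (ρ := ρ) hJ hJ2 hψ hρ hρ' ?_ ?_ ?_ ?_ ?_ ?_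
    · intro i j
      rw [hf, hf, hw]
    · rw [f0, f1, map_add, map_smul, map_smul, h0, h1]; module
    · rw [f2, f3, map_add, map_smul, map_smul, h2, h3]; module
    · rw [f4, f5, map_add, map_smul, map_smul, h4, h5]; module
    · simp only [f0, f2, f4, three_first, three_second, three_third, r034, r035, r124, r125, r134,
        r135, hp, hq]
      linear_combination p * hc + q * ht + hpq
    · simp only [f0, f2, f5, three_first, three_second, three_third, r034, r035, r124, r125, r134,
        r135, hp, hq]
      linear_combination q * hc - p * ht
  · have key : ∀ x y : V, ∀ r : ℝ, c • (r • x) + t • (-(r • y))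
        = r • (Real.cos θ • (c • x + t • y) + Real.sin θ • ((-t) • x + c • y)) := by
      intro x y r
      rw [hcos, hsin]
      have e1 : c * r = r * ((c ^ 2 - t ^ 2) * c + (-2 * c * t) * (-t)) := by
        linear_combination -(c * r) * hct
      have e2 : -(t * r) = r * ((c ^ 2 - t ^ 2) * t + (-2 * c * t) * c) := by
        linear_combination (t * r) * hct
      calc c • (r • x) + t • (-(r • y)) = (c * r) • x + (-(t * r)) • y := by module
        _ = _ := by rw [e1, e2]; module
    have key' : ∀ x y : V, ∀ r : ℝ, (-t) • (r • x) + c • (-(r • y))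
        = -(r • (-(Real.sin θ • (c • x + t • y)) + Real.cos θ • ((-t) • x + c • y))) := by
      intro x y r
      rw [hcos, hsin]
      have e1 : -(t * r) = r * ((-2 * c * t) * c + (c ^ 2 - t ^ 2) * t) := by
        linear_combination (t * r) * hct
      have e2 : -(c * r) = r * ((-2 * c * t) * t - (c ^ 2 - t ^ 2) * c) := by
        linear_combination (c * r) * hct
      calc (-t) • (r • x) + c • (-(r • y)) = (-(t * r)) • x + (-(c * r)) • y := by module
        _ = _ := by rw [e1, e2]; module
    refine ⟨?_, ?_, ?_, ?_, ?_, ?_⟩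
    · rw [f0, f1, map_add, map_smul, map_smul, hs0, hs1, key]
    · rw [f0, f1, map_add, map_smul, map_smul, hs0, hs1, key']
    · rw [f2, f3, map_add, map_smul, map_smul, hs2, hs3, key]
    · rw [f2, f3, map_add, map_smul, map_smul, hs2, hs3, key']
    · rw [f4, f5, map_add, map_smul, map_smul, hs4, hs5, key]
    · rw [f4, f5, map_add, map_smul, map_smul, hs4, hs5, key']

end Trilinear

/-! ### The complex structure and existence of the adapted frame -/

section Existence

variable {𝔤 : Type*} [LieRing 𝔤] [LieAlgebra ℝ 𝔤] {𝔥 : LieIdeal ℝ 𝔤}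
  {e : Basis (Fin 7) ℝ 𝔤} {φ : Form 𝔤 3} {e₇ : 𝔤}

/-- The scalar product induced on an ideal. -/
abbrev resMetric (e : Basis (Fin 7) ℝ 𝔤) (𝔥 : LieIdeal ℝ 𝔤) : LinearMap.BilinForm ℝ 𝔥 :=
  (metric e).restrict 𝔥.toSubmodule

theorem resMetric_apply (x y : 𝔥) : resMetric e 𝔥 x y = metric e (x : 𝔤) (y : 𝔤) := rfl

theorem resMetric_comm (x y : 𝔥) : resMetric e 𝔥 x y = resMetric e 𝔥 y x := metric_comm e _ _

theorem resMetric_pos (x : 𝔥) (hx : x ≠ 0) : 0 < resMetric e 𝔥 x x :=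
  metric_pos e fun h => hx (Subtype.ext h)

theorem resMetric_eq_metric {F : Basis (Fin 7) ℝ 𝔤} {f : Basis (Fin 6) ℝ 𝔥}
    (h : metric e = metric F) (hF : ∀ i, F i.castSucc = f i) (x y : 𝔥) :
    resMetric e 𝔥 x y = metric f x y := by
  rw [resMetric_apply, h, metric_mem hF]

theorem two_swap {V : Type*} [AddCommGroup V] [Module ℝ V] (ω : Form V 2) (x y : V) :
    ω ![x, y] = -ω ![y, x] := by
  have := ω.map_swap ![y, x] (i := 0) (j := 1) (by decide)
  rw [← this]
  congr 1
  funext i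
  fin_cases i <;> rfl

/-- The complex structure on the orthogonal complement of a unit vector. -/
theorem exists_complexStructure (he : IsG2Frame φ e) (h_unit : metric e e₇ e₇ = 1)
    (h_perp : ∀ x ∈ 𝔥, metric e e₇ x = 0) (h_dim : finrank ℝ 𝔥 = 6) :
    ∃ J : End ℝ 𝔥, (∀ x y, resMetric e 𝔥 (J x) y = res 𝔥 (φ.curryLeft e₇) ![x, y]) ∧
      (∀ x, J (J x) = -x) ∧
      ∀ x y z, res 𝔥 ((hodgeStar e (by norm_num : 3 + 4 = 7) φ).curryLeft e₇) ![x, y, z]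
        = res 𝔥 φ ![x, y, J z] := by
  have : FiniteDimensional ℝ 𝔥 := Module.finite_of_finrank_pos (by omega)
  obtain ⟨f, hf⟩ := exists_orthonormal_basis (resMetric e 𝔥) resMetric_comm resMetric_pos h_dim
  obtain ⟨F, hF, hF6, hmet⟩ := exists_extend_basis e h_unit h_perp f hf
  subst hF6
  set ω := res 𝔥 (φ.curryLeft (F 6))
  have hB := resMetric_eq_metric (e := e) hmet hF
  have hω2 : ∀ (x y : 𝔥) (c : ℝ), (fun z => ω ![x + c • y, z]) = (fun z => ω ![x, z]) + c • fun z => ω ![y, z] := by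
    intro x y c
    funext z
    have h : ∀ x : 𝔥, ω ![x, z] = ω (Function.update ![0, z] 0 x) := fun x => by
      congr 1; funext i; fin_cases i <;> rfl
    simp only [h, AlternatingMap.map_update_add, AlternatingMap.map_update_smul, Pi.add_apply,
      Pi.smul_apply]
  let J : End ℝ 𝔥 :=
    { toFun := fun x => ∑ i, ω ![x, f i] • f i
      map_add' := fun x y => by
        have := fun z => congrFun (hω2 x y 1) z
        simp only [one_smul, Pi.add_apply] at this
        simp only [this, add_smul, Finset.sum_add_distrib]
      map_smul' := fun c x => by
        have := fun z => congrFun (hω2 0 x c) z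
        have h0 := fun z => congrFun (hω2 0 0 (-1)) z
        simp only [zero_add, Pi.add_apply, Pi.smul_apply, smul_zero, smul_eq_mul] at this h0
        have h0' : ∀ z, ω ![0, z] = 0 := fun z => by linarith [h0 z]
        simp only [this, h0', zero_add, mul_smul, Finset.smul_sum, RingHom.id_apply] }
  have hJf : ∀ x i, metric f (J x) (f i) = ω ![x, f i] := by
    intro x i
    rw [metric_comm, metric_basis_left]
    change f.coord i (∑ j, ω ![x, f j] • f j) = _
    simp only [map_sum, map_smul, coord_self, smul_eq_mul, mul_ite, mul_one, mul_zero,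
      Finset.sum_ite_eq', Finset.mem_univ, if_true]
  have hexp : ∀ x y : 𝔥, ω ![x, y] = ∑ i, f.coord i y * ω ![x, f i] := by
    intro x y
    have h : ∀ y : 𝔥, ω ![x, y] = ω (Function.update ![x, 0] 1 y) := fun x => by
      congr 1; funext i; fin_cases i <;> rfl
    conv_lhs => rw [← f.sum_repr y]
    rw [h, AlternatingMap.map_update_sum]
    refine Finset.sum_congr rfl fun i _ => ?_
    rw [AlternatingMap.map_update_smul, ← h]
    rfl
  have hJ : ∀ x y, metric f (J x) y = ω ![x, y] := by
    intro x y
    rw [hexp, metric_apply]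
    refine Finset.sum_congr rfl fun i _ => ?_
    rw [← metric_basis_left, metric_comm, hJf, mul_comm]
  have hskew : ∀ x y, metric f (J x) y = -metric f x (J y) := by
    intro x y
    rw [hJ, metric_comm, hJ, two_swap]
  have hJ2 : ∀ x, J (J x) = -x := by
    intro x
    -- J is an isometry: in `g2_identity` at (F₆, x, F₆, z) the left side is zero by alternation,
    -- leaving the contraction −⟨Jx, Jz⟩ and the metric term ⟨x, z⟩. As J is also skew, J² = −1.
    have hz : ∀ z : 𝔥, metric f (J x) (J z) = metric f x z := by
      intro z
      have h0 : hodgeStar e (by norm_num : 3 + 4 = 7) φ ![F 6, (x : 𝔤), F 6, (z : 𝔤)] = 0 :=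
        AlternatingMap.map_eq_zero_of_eq _ _ (i := 0) (j := 2) rfl (by decide)
      have h66 : metric F (F 6) (F 6) = 1 := by rw [metric_basis, if_pos rfl]
      have hl : φ ![F (Fin.last 6), F 6, (z : 𝔤)] = 0 :=
        φ.map_eq_zero_of_eq _ (i := 0) (j := 1) rfl (by decide)
      rw [g2_identity he hmet, metric_last_mem hF, metric_mem hF, h66, Fin.sum_univ_castSucc,
        hl] at h0
      have hs : ∀ i : Fin 6, φ ![(x : 𝔤), F 6, F i.castSucc] * φ ![F i.castSucc, F 6, (z : 𝔤)]
          = -(f.coord i (J x) * f.coord i (J z)) := by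
        intro i
        rw [← metric_basis_left, ← metric_basis_left, metric_comm, hJf, metric_comm, hJf, hF,
          map_swap_first φ (x : 𝔤), map_swap_first φ ((f i : 𝔥) : 𝔤), two_swap ω z, res_vec_two,
          res_vec_two, AlternatingMap.curryLeft_apply_apply, AlternatingMap.curryLeft_apply_apply]
        ring
      simp only [hs, Finset.sum_neg_distrib] at h0
      rw [metric_apply f (J x)]
      linarith
    refine f.ext_elem fun i => ?_
    change f.coord i _ = f.coord i _
    rw [← metric_basis_left, ← metric_basis_left, metric_comm, hskew, hz, map_neg, metric_comm]
  refine ⟨J, fun x y => by rw [hB, hJ], hJ2, fun x y z => ?_⟩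
  rw [res_hodgeStar_curryLeft he hmet hF, expand_last _ f x y (J z), ← Finset.sum_neg_distrib]
  refine Finset.sum_congr rfl fun i _ => ?_
  rw [← metric_basis_left, ← neg_eq_iff_eq_neg.2 (hskew (f i) z), hJ]
  ring

theorem exists_su3Frame_normalForm (he : IsG2Frame φ e) (h_unit : metric e e₇ e₇ = 1)
    (h_perp : ∀ x ∈ 𝔥, metric e e₇ x = 0) (h_dim : finrank ℝ 𝔥 = 6) (S : End ℝ 𝔥)
    (hS : ∀ x y, resMetric e 𝔥 (S x) y = resMetric e 𝔥 x (S y))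
    (hSω : ∀ x y, res 𝔥 (φ.curryLeft e₇) ![S x, y] = -res 𝔥 (φ.curryLeft e₇) ![x, S y]) :
    ∃ (f : Basis (Fin 6) ℝ 𝔥) (θ : ℝ) (s : Fin 3 → ℝ), θ ∈ Set.Icc 0 (2 * Real.pi) ∧
      IsSU3Frame (resMetric e 𝔥) (res 𝔥 (φ.curryLeft e₇))
        (-res 𝔥 ((hodgeStar e (by norm_num : 3 + 4 = 7) φ).curryLeft e₇)) f ∧
      IsNormalForm S f θ s := by
  have : FiniteDimensional ℝ 𝔥 := Module.finite_of_finrank_pos (by omega)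
  obtain ⟨J, hJ, hJ2, hψ⟩ := exists_complexStructure he h_unit h_perp h_dim
  set B := resMetric e 𝔥 with hBdef
  set ω := res 𝔥 (φ.curryLeft e₇)
  set ρ := res 𝔥 φ with hρdef
  have hskew : ∀ x y, B (J x) y = -B x (J y) := by
    intro x y
    rw [hJ, resMetric_comm, hJ, two_swap]
  have hnd : ∀ x y : 𝔥, (∀ z, B x z = B y z) → x = y := by
    intro x y h
    by_contra hne
    have := resMetric_pos (e := e) (x - y) (sub_ne_zero.2 hne)
    rw [(resMetric e 𝔥).map_sub x y, LinearMap.sub_apply, ← hBdef, h, sub_self] at this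
    exact lt_irrefl _ this
  -- S is symmetric for the metric and infinitesimally preserves ω = ⟨J·, ·⟩; together these say
  -- that S anticommutes with J.
  have hSJ : ∀ x, S (J x) = -J (S x) := by
    intro x
    refine hnd _ _ fun z => ?_
    rw [hS, hJ, map_neg, LinearMap.neg_apply, hJ, hSω, neg_neg]
  have hρ : ∀ x y z, ρ ![x, y, J z] = ρ ![x, J y, z] := by
    intro x y z
    rw [← hψ, three_swap_last, hψ, three_swap_last ρ x (J y)]
  have hρ' : ∀ x y z, ρ ![x, J y, z] = ρ ![J x, y, z] := by
    intro x y z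
    rw [← hρ, three_swap_first, ← neg_eq_iff_eq_neg.2 (three_swap_first ρ y (J x) z)]
    rw [hρ]
  obtain ⟨v, s, hv, ⟨h0, h2, h4⟩, hs0, hs2, hs4⟩ := exists_unitary_eigenbasis B resMetric_comm
    resMetric_pos h_dim S J hS hskew hJ2 hSJ
  set p := ρ ![v 0, v 2, v 4] with hp
  set q := ρ ![v 0, v 2, v 5] with hq
  -- The identity for ⋆φ at (v₀, v₂, v₀, v₂) says that v₀, v₂ ↦ ρ(v₀, v₂, ·) has norm one. This
  -- covector vanishes on v₀, Jv₀, v₂ and Jv₂, so its only components are p and q.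
  have hpq : p ^ 2 + q ^ 2 = 1 := by
    obtain ⟨F, hF, hF6, hmet⟩ := exists_extend_basis e h_unit h_perp v hv
    have h := res_hodgeStar he hmet hF (v 0) (v 2) (v 0) (v 2)
    have hz : res 𝔥 (hodgeStar e (by norm_num : 3 + 4 = 7) φ) ![v 0, v 2, v 0, v 2] = 0 :=
      AlternatingMap.map_eq_zero_of_eq _ _ (i := 0) (j := 2) rfl (by decide)
    have hm : metric v (v 0) (v 2) = 0 := by rw [metric_basis, if_neg (by decide)]
    have hm0 : metric v (v 0) (v 0) = 1 := by rw [metric_basis, if_pos rfl]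
    have hm2 : metric v (v 2) (v 2) = 1 := by rw [metric_basis, if_pos rfl]
    have hω02 : ω ![v 0, v 2] = 0 := by rw [← hJ, h0, hv, if_neg (by decide)]
    have h1 : ρ ![v 0, v 2, v 1] = 0 := by
      have h := (hρ (v 0) (v 2) (v 0)).trans (hρ' _ _ _)
      rw [h0] at h
      have e1 := three_swap_first ρ (v 1) (v 2) (v 0)
      have e2 := three_swap_last ρ (v 2) (v 1) (v 0)
      have e3 := three_swap_first ρ (v 2) (v 0) (v 1)
      linarith
    have h3 : ρ ![v 0, v 2, v 3] = 0 := by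
      have h := hρ (v 0) (v 2) (v 2)
      rw [three_swap_last ρ _ (J (v 2)), h2] at h
      linarith
    have hsw : ∀ i, ρ ![v 2, v 0, v i] = -ρ ![v 0, v 2, v i] := fun i => three_swap_first _ _ _ _
    have hrot : ∀ i, ρ ![v i, v 0, v 2] = ρ ![v 0, v 2, v i] := fun i => by
      rw [three_swap_first, three_swap_last, neg_neg]
    rw [hz, hF6, ← hρdef] at h
    change 0 = _ + ω ![v 2, v 0] * ω ![v 0, v 2] - _ + _ at h
    simp only [hsw, hrot, Fin.sum_univ_six, h1, h3, three_self_outer, three_self_last, hω02, hm, hm0, hm2,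
      ← hp, ← hq] at h
    linarith
  exact exists_normalForm_of_eigenbasis hJ hJ2 (fun x y z => by rw [AlternatingMap.neg_apply, hψ])
    hρ hρ' hSJ h_dim hv h0 h2 h4 hs0 hs2 hs4 hpq

end Existence

/-! ### The action ϑ and the quadratic terms of the Laplacian -/

section Theta

variable {V : Type*} [AddCommGroup V] [Module ℝ V] {k : ℕ}

theorem theta_add_left (X Y : End ℝ V) (α : Form V k) :
    theta (X + Y) α = theta X α + theta Y α := by
  ext v
  simp only [theta_apply, AlternatingMap.add_apply, LinearMap.add_apply,
    AlternatingMap.map_update_add, Finset.sum_add_distrib]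
  ring

theorem theta_smul_left (c : ℝ) (X : End ℝ V) (α : Form V k) :
    theta (c • X) α = c • theta X α := by
  ext v
  simp only [theta_apply, AlternatingMap.smul_apply, LinearMap.smul_apply,
    AlternatingMap.map_update_smul, smul_eq_mul, ← Finset.mul_sum]
  ring

theorem theta_neg_left (X : End ℝ V) (α : Form V k) : theta (-X) α = -theta X α := by
  ext v
  simp [theta_apply, AlternatingMap.map_update_neg]

theorem theta_add_right (X : End ℝ V) (α β : Form V k) :
    theta X (α + β) = theta X α + theta X β := by
  ext v
  simp only [theta_apply, AlternatingMap.add_apply, Finset.sum_add_distrib]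
  ring

theorem theta_smul_right (c : ℝ) (X : End ℝ V) (α : Form V k) :
    theta X (c • α) = c • theta X α := by
  ext v
  simp only [theta_apply, AlternatingMap.smul_apply, smul_eq_mul, ← Finset.mul_sum]
  ring

theorem theta_neg_right (X : End ℝ V) (α : Form V k) : theta X (-α) = -theta X α := by
  ext v
  simp [theta_apply]

theorem theta_one (α : Form V k) : theta (1 : End ℝ V) α = -(k : ℝ) • α := by
  ext v
  simp [theta_apply]

theorem theta_comm {X Y : End ℝ V} (h : X * Y = Y * X) (α : Form V 3) :
    theta X (theta Y α) = theta Y (theta X α) := by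
  have h' : ∀ x, X (Y x) = Y (X x) := fun x => LinearMap.congr_fun h x
  refine form_ext_three fun x y z => ?_
  simp only [theta_three, h']
  ring

/-- `Ψ = ω ∧ ω / 2`. -/
def IsHalfSquare (ω : Form V 2) (Ψ : Form V 4) : Prop :=
  ∀ x y z w, Ψ ![x, y, z, w] = ω ![x, y] * ω ![z, w] - ω ![x, z] * ω ![y, w]
    + ω ![x, w] * ω ![y, z]

/-- By the Leibniz rule ϑ(D)(½ω²) = ϑ(D)ω ∧ ω, so (ϑ(D)ω − cω) ∧ ω = 0, and wedging with ω is
injective. -/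
theorem theta_eq_smul_of_halfSquare {f : Basis (Fin 6) ℝ V} {Ψ : Form V 4}
    (h : IsHalfSquare (stdOmega f) Ψ) (D : End ℝ V) (c : ℝ) (hD : theta D Ψ = (2 * c) • Ψ) :
    theta D (stdOmega f) = c • stdOmega f := by
  rw [← sub_eq_zero]
  refine eq_zero_of_wedge_stdOmega f _ fun x y z w => ?_
  have h1 := DFunLike.congr_fun hD ![x, y, z, w]
  rw [theta_four, AlternatingMap.smul_apply, smul_eq_mul] at h1
  simp only [h x, h (D x)] at h1
  simp only [AlternatingMap.sub_apply, AlternatingMap.smul_apply, theta_two, smul_eq_mul]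
  linear_combination h1

theorem theta_halfSquare_of_eq_smul {ω : Form V 2} {Ψ : Form V 4}
    (h : IsHalfSquare ω Ψ) (D : End ℝ V) (c : ℝ) (hD : theta D ω = c • ω) :
    theta D Ψ = (2 * c) • Ψ := by
  refine form_ext_four fun x y z w => ?_
  have h1 := fun x y => DFunLike.congr_fun hD ![x, y]
  simp only [theta_two, AlternatingMap.smul_apply, smul_eq_mul] at h1
  rw [theta_four, AlternatingMap.smul_apply, smul_eq_mul]
  simp only [h x, h (D x)]
  linear_combination ω ![z, w] * h1 x y + ω ![x, y] * h1 z w - ω ![y, w] * h1 x z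
    - ω ![x, z] * h1 y w + ω ![y, z] * h1 x w + ω ![x, w] * h1 y z

variable (f : Basis (Fin 6) ℝ V)

theorem coord_apply_eq_sum (D : End ℝ V) (i : Fin 6) (x : V) :
    f.coord i (D x) = ∑ j, f.coord j x * f.coord i (D (f j)) := by
  conv_lhs => rw [← f.sum_repr x]
  rw [map_sum, map_sum]
  refine Finset.sum_congr rfl fun j _ => ?_
  rw [map_smul, map_smul, smul_eq_mul]
  rfl

variable {f} {S : End ℝ V} {θ : ℝ} {s : Fin 3 → ℝ}

theorem bigSigma_basis (f : Basis (Fin 6) ℝ V) (θ : ℝ) (s : Fin 3 → ℝ) :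
    bigSigma f θ s (f 0) = ((-2 + 4 * Real.cos θ ^ 2) * (s 1 * s 2)) • f 0
        + ((-4 * Real.cos θ * Real.sin θ) * (s 1 * s 2)) • f 1 ∧
    bigSigma f θ s (f 1) = ((-4 * Real.cos θ * Real.sin θ) * (s 1 * s 2)) • f 0
        + (-(-2 + 4 * Real.cos θ ^ 2) * (s 1 * s 2)) • f 1 ∧
    bigSigma f θ s (f 2) = ((-2 + 4 * Real.cos θ ^ 2) * (s 0 * s 2)) • f 2
        + ((-4 * Real.cos θ * Real.sin θ) * (s 0 * s 2)) • f 3 ∧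
    bigSigma f θ s (f 3) = ((-4 * Real.cos θ * Real.sin θ) * (s 0 * s 2)) • f 2
        + (-(-2 + 4 * Real.cos θ ^ 2) * (s 0 * s 2)) • f 3 ∧
    bigSigma f θ s (f 4) = ((-2 + 4 * Real.cos θ ^ 2) * (s 0 * s 1)) • f 4
        + ((-4 * Real.cos θ * Real.sin θ) * (s 0 * s 1)) • f 5 ∧
    bigSigma f θ s (f 5) = ((-4 * Real.cos θ * Real.sin θ) * (s 0 * s 1)) • f 4
        + (-(-2 + 4 * Real.cos θ ^ 2) * (s 0 * s 1)) • f 5 := by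
  unfold bigSigma
  refine ⟨?_, ?_, ?_, ?_, ?_, ?_⟩ <;> rw [Matrix.toLin_self, Fin.sum_univ_six] <;> simp

theorem bigSigma_coord (f : Basis (Fin 6) ℝ V) (θ : ℝ) (s : Fin 3 → ℝ) (x : V) :
    f.coord 0 (bigSigma f θ s x) = (s 1 * s 2) * ((-2 + 4 * Real.cos θ ^ 2) * f.coord 0 x
        + (-4 * Real.cos θ * Real.sin θ) * f.coord 1 x) ∧
    f.coord 1 (bigSigma f θ s x) = (s 1 * s 2) * ((-4 * Real.cos θ * Real.sin θ) * f.coord 0 x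
        - (-2 + 4 * Real.cos θ ^ 2) * f.coord 1 x) ∧
    f.coord 2 (bigSigma f θ s x) = (s 0 * s 2) * ((-2 + 4 * Real.cos θ ^ 2) * f.coord 2 x
        + (-4 * Real.cos θ * Real.sin θ) * f.coord 3 x) ∧
    f.coord 3 (bigSigma f θ s x) = (s 0 * s 2) * ((-4 * Real.cos θ * Real.sin θ) * f.coord 2 x
        - (-2 + 4 * Real.cos θ ^ 2) * f.coord 3 x) ∧
    f.coord 4 (bigSigma f θ s x) = (s 0 * s 1) * ((-2 + 4 * Real.cos θ ^ 2) * f.coord 4 x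
        + (-4 * Real.cos θ * Real.sin θ) * f.coord 5 x) ∧
    f.coord 5 (bigSigma f θ s x) = (s 0 * s 1) * ((-4 * Real.cos θ * Real.sin θ) * f.coord 4 x
        - (-2 + 4 * Real.cos θ ^ 2) * f.coord 5 x) := by
  obtain ⟨h0, h1, h2, h3, h4, h5⟩ := bigSigma_basis f θ s
  refine ⟨?_, ?_, ?_, ?_, ?_, ?_⟩ <;>
    rw [coord_apply_eq_sum, Fin.sum_univ_six, h0, h1, h2, h3, h4, h5] <;>
    simp only [map_add, map_smul, coord_self, smul_eq_mul] <;> simp <;> ring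

theorem normalForm_coord (hS : IsNormalForm S f θ s) (x : V) :
    f.coord 0 (S x) = s 0 * (Real.cos θ * f.coord 0 x + Real.sin θ * f.coord 1 x) ∧
    f.coord 1 (S x) = s 0 * (Real.sin θ * f.coord 0 x - Real.cos θ * f.coord 1 x) ∧
    f.coord 2 (S x) = s 1 * (Real.cos θ * f.coord 2 x + Real.sin θ * f.coord 3 x) ∧
    f.coord 3 (S x) = s 1 * (Real.sin θ * f.coord 2 x - Real.cos θ * f.coord 3 x) ∧
    f.coord 4 (S x) = s 2 * (Real.cos θ * f.coord 4 x + Real.sin θ * f.coord 5 x) ∧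
    f.coord 5 (S x) = s 2 * (Real.sin θ * f.coord 4 x - Real.cos θ * f.coord 5 x) := by
  obtain ⟨h0, h1, h2, h3, h4, h5⟩ := hS
  refine ⟨?_, ?_, ?_, ?_, ?_, ?_⟩ <;>
    rw [coord_apply_eq_sum, Fin.sum_univ_six, h0, h1, h2, h3, h4, h5] <;>
    simp only [map_add, map_neg, map_smul, coord_self, smul_eq_mul] <;> simp <;> ring

/-- This is where Σ comes from. Each monomial of ψ = Im(dz₁∧dz₂∧dz₃) takes one factor from each
complex line. Acting twice on line i gives sᵢ². Acting on lines i and j conjugates two factors,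
which, after conjugating the whole expression, is a conjugation on the third line k: 2ϑ(Sᵢ)ϑ(Sⱼ)ψ =
ϑ(Σₖ)ψ, with Σₖ : z ↦ 2sᵢsⱼe^{−2iθ}z̄. -/
theorem theta_theta_normalForm (hS : IsNormalForm S f θ s) :
    theta S (theta S (stdPsi f)) = (s 0 ^ 2 + s 1 ^ 2 + s 2 ^ 2) • stdPsi f
      + theta (bigSigma f θ s) (stdPsi f) := by
  refine form_ext_three fun x y z => ?_
  simp only [AlternatingMap.add_apply, AlternatingMap.smul_apply, theta_three, stdPsi_apply,
    coForm_three, smul_eq_mul]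
  have hS' := fun x => normalForm_coord hS x
  have hT := fun x => bigSigma_coord f θ s x
  -- Both sides are made homogeneous quadratic in cos θ and sin θ, after which the identity is
  -- polynomial and cos² + sin² = 1 is no longer needed.
  have hp : -2 + 4 * Real.cos θ ^ 2 = 2 * Real.cos θ ^ 2 - 2 * Real.sin θ ^ 2 := by
    linear_combination 2 * Real.sin_sq_add_cos_sq θ
  have hs : s 0 ^ 2 + s 1 ^ 2 + s 2 ^ 2
      = (s 0 ^ 2 + s 1 ^ 2 + s 2 ^ 2) * (Real.cos θ ^ 2 + Real.sin θ ^ 2) := by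
    rw [Real.cos_sq_add_sin_sq, mul_one]
  simp only [fun x => (hS' x).1, fun x => (hS' x).2.1, fun x => (hS' x).2.2.1,
    fun x => (hS' x).2.2.2.1, fun x => (hS' x).2.2.2.2.1, fun x => (hS' x).2.2.2.2.2,
    fun x => (hT x).1, fun x => (hT x).2.1, fun x => (hT x).2.2.1,
    fun x => (hT x).2.2.2.1, fun x => (hT x).2.2.2.2.1, fun x => (hT x).2.2.2.2.2]
  rw [hp, hs]
  ring

/-- The standard form of the real part of a complex volume form. -/
def stdRho (f : Basis (Fin 6) ℝ V) : Form V 3 :=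
  coForm f ![0, 2, 4] - coForm f ![0, 3, 5] - coForm f ![1, 2, 5] - coForm f ![1, 3, 4]

theorem stdRho_apply (f : Basis (Fin 6) ℝ V) (x y z : V) : stdRho f ![x, y, z] =
    coForm f ![0, 2, 4] ![x, y, z] - coForm f ![0, 3, 5] ![x, y, z]
      - coForm f ![1, 2, 5] ![x, y, z] - coForm f ![1, 3, 4] ![x, y, z] := rfl

/-- The linear relations between the matrix entries of an element of `𝔲(3)`. -/
theorem unitary_entries {L : End ℝ V}
    (hL : ∀ i j, f.coord i (L (f j)) = -f.coord j (L (f i)))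
    (hω : ∀ x y, stdOmega f ![L x, y] = -stdOmega f ![x, L y]) :
    ∃ l1 l2 l3 a b c d p q : ℝ, ∀ x,
      f.coord 0 (L x) = -l1 * f.coord 1 x - a * f.coord 2 x - b * f.coord 3 x - c * f.coord 4 x
        - d * f.coord 5 x ∧
      f.coord 1 (L x) = l1 * f.coord 0 x + b * f.coord 2 x - a * f.coord 3 x + d * f.coord 4 x
        - c * f.coord 5 x ∧
      f.coord 2 (L x) = a * f.coord 0 x - b * f.coord 1 x - l2 * f.coord 3 x - p * f.coord 4 x
        - q * f.coord 5 x ∧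
      f.coord 3 (L x) = b * f.coord 0 x + a * f.coord 1 x + l2 * f.coord 2 x + q * f.coord 4 x
        - p * f.coord 5 x ∧
      f.coord 4 (L x) = c * f.coord 0 x - d * f.coord 1 x + p * f.coord 2 x - q * f.coord 3 x
        - l3 * f.coord 5 x ∧
      f.coord 5 (L x) = d * f.coord 0 x + c * f.coord 1 x + q * f.coord 2 x + p * f.coord 3 x
        + l3 * f.coord 4 x := by
  have H := fun i j => hω (f i) (f j)
  simp only [stdOmega_apply, coord_self] at H
  have a1 := H 0 2
  have a2 := H 0 3
  have a3 := H 0 4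
  have a4 := H 0 5
  have a5 := H 2 4
  have a6 := H 2 5
  have a7 := H 1 2
  have a8 := H 1 3
  have a9 := H 1 4
  have a10 := H 1 5
  have a11 := H 3 4
  have a12 := H 3 5
  clear H
  simp only [show ∀ i j : Fin 6, (i = j) = (i.val = j.val) from fun i j => propext Fin.ext_iff]
    at a1 a2 a3 a4 a5 a6 a7 a8 a9 a10 a11 a12
  norm_num at a1 a2 a3 a4 a5 a6 a7 a8 a9 a10 a11 a12
  simp only [← Basis.coord_apply] at a1 a2 a3 a4 a5 a6 a7 a8 a9 a10 a11 a12
  have d0 := hL 0 0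
  have d1 := hL 1 1
  have d2 := hL 2 2
  have d3 := hL 3 3
  have d4 := hL 4 4
  have d5 := hL 5 5
  have s01 := hL 0 1
  have s02 := hL 0 2
  have s03 := hL 0 3
  have s04 := hL 0 4
  have s05 := hL 0 5
  have s12 := hL 1 2
  have s13 := hL 1 3
  have s14 := hL 1 4
  have s15 := hL 1 5
  have s23 := hL 2 3
  have s24 := hL 2 4
  have s25 := hL 2 5
  have s34 := hL 3 4
  have s35 := hL 3 5
  have s45 := hL 4 5
  have e00 : f.coord 0 (L (f 0)) = 0 := by linarith
  have e01 : f.coord 0 (L (f 1)) = -f.coord 1 (L (f 0)) := by linarith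
  have e02 : f.coord 0 (L (f 2)) = -f.coord 2 (L (f 0)) := by linarith
  have e03 : f.coord 0 (L (f 3)) = -f.coord 3 (L (f 0)) := by linarith
  have e04 : f.coord 0 (L (f 4)) = -f.coord 4 (L (f 0)) := by linarith
  have e05 : f.coord 0 (L (f 5)) = -f.coord 5 (L (f 0)) := by linarith
  have e11 : f.coord 1 (L (f 1)) = 0 := by linarith
  have e12 : f.coord 1 (L (f 2)) = f.coord 3 (L (f 0)) := by linarith
  have e13 : f.coord 1 (L (f 3)) = -f.coord 2 (L (f 0)) := by linarith
  have e14 : f.coord 1 (L (f 4)) = f.coord 5 (L (f 0)) := by linarith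
  have e15 : f.coord 1 (L (f 5)) = -f.coord 4 (L (f 0)) := by linarith
  have e21 : f.coord 2 (L (f 1)) = -f.coord 3 (L (f 0)) := by linarith
  have e22 : f.coord 2 (L (f 2)) = 0 := by linarith
  have e23 : f.coord 2 (L (f 3)) = -f.coord 3 (L (f 2)) := by linarith
  have e24 : f.coord 2 (L (f 4)) = -f.coord 4 (L (f 2)) := by linarith
  have e25 : f.coord 2 (L (f 5)) = -f.coord 5 (L (f 2)) := by linarith
  have e31 : f.coord 3 (L (f 1)) = f.coord 2 (L (f 0)) := by linarith
  have e33 : f.coord 3 (L (f 3)) = 0 := by linarith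
  have e34 : f.coord 3 (L (f 4)) = f.coord 5 (L (f 2)) := by linarith
  have e35 : f.coord 3 (L (f 5)) = -f.coord 4 (L (f 2)) := by linarith
  have e41 : f.coord 4 (L (f 1)) = -f.coord 5 (L (f 0)) := by linarith
  have e43 : f.coord 4 (L (f 3)) = -f.coord 5 (L (f 2)) := by linarith
  have e44 : f.coord 4 (L (f 4)) = 0 := by linarith
  have e45 : f.coord 4 (L (f 5)) = -f.coord 5 (L (f 4)) := by linarith
  have e51 : f.coord 5 (L (f 1)) = f.coord 4 (L (f 0)) := by linarith
  have e53 : f.coord 5 (L (f 3)) = f.coord 4 (L (f 2)) := by linarith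
  have e55 : f.coord 5 (L (f 5)) = 0 := by linarith
  refine ⟨f.coord 1 (L (f 0)), f.coord 3 (L (f 2)), f.coord 5 (L (f 4)), f.coord 2 (L (f 0)),
    f.coord 3 (L (f 0)), f.coord 4 (L (f 0)), f.coord 5 (L (f 0)), f.coord 4 (L (f 2)),
    f.coord 5 (L (f 2)), fun x => ?_⟩
  simp only [coord_apply_eq_sum f L _ x, Fin.sum_univ_six, e00, e01, e02, e03, e04, e05, e11, e12, e13, e14, e15, e21, e22, e23, e24, e25, e31, e33,
    e34, e35, e41, e43, e44, e45, e51, e53, e55]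
  refine ⟨?_, ?_, ?_, ?_, ?_, ?_⟩ <;> ring

/-- A complex linear L acts on the volume form by minus its complex trace, here −il. So ϑ(L) rotates
the real part ρ and the imaginary part ψ into each other with speed l. -/
theorem theta_theta_unitary {L : End ℝ V}
    (hL : ∀ i j, f.coord i (L (f j)) = -f.coord j (L (f i)))
    (hω : ∀ x y, stdOmega f ![L x, y] = -stdOmega f ![x, L y]) :
    theta L (theta L (stdPsi f)) = -(imTrace f L ^ 2) • stdPsi f := by
  obtain ⟨l1, l2, l3, a, b, c, d, p, q, h⟩ := unitary_entries hL hω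
  have hl : imTrace f L = l1 + l2 + l3 := by
    rw [imTrace, (h (f 0)).2.1, (h (f 2)).2.2.2.1, (h (f 4)).2.2.2.2.2]
    simp only [coord_self]
    simp
  have h1 : theta L (stdPsi f) = -imTrace f L • stdRho f := by
    refine form_ext_three fun x y z => ?_
    simp only [theta_three, stdPsi_apply, AlternatingMap.smul_apply, stdRho_apply, coForm_three,
      smul_eq_mul, hl, fun x => (h x).1, fun x => (h x).2.1, fun x => (h x).2.2.1,
      fun x => (h x).2.2.2.1, fun x => (h x).2.2.2.2.1, fun x => (h x).2.2.2.2.2]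
    ring
  have h2 : theta L (stdRho f) = imTrace f L • stdPsi f := by
    refine form_ext_three fun x y z => ?_
    simp only [theta_three, stdPsi_apply, AlternatingMap.smul_apply, stdRho_apply, coForm_three,
      smul_eq_mul, hl, fun x => (h x).1, fun x => (h x).2.1, fun x => (h x).2.2.1,
      fun x => (h x).2.2.2.1, fun x => (h x).2.2.2.2.1, fun x => (h x).2.2.2.2.2]
    ring
  rw [h1, theta_smul_right, h2, smul_smul]
  congr 1
  ring

set_option maxHeartbeats 4000000 in
/-- The linear system for a soliton: the action of `𝔰𝔭(6)` on the stabilizer of `ψ`. -/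
theorem soliton_linear_system {E : End ℝ V} {x₀ : V} {δ : ℝ}
    (hE : ∀ x y, stdOmega f ![E x, y] = -stdOmega f ![x, E y])
    (h : ∀ x y z, theta E (stdPsi f) ![x, y, z] + δ * stdPsi f ![x, y, z]
      + (stdOmega f ![x₀, x] * stdOmega f ![y, z] - stdOmega f ![x₀, y] * stdOmega f ![x, z]
        + stdOmega f ![x₀, z] * stdOmega f ![x, y]) = 0) :
    δ = 0 ∧ ∀ i j, f.coord i (E (f j)) = -f.coord j (E (f i)) := by
  have H := fun i j => hE (f i) (f j)
  simp only [stdOmega_apply, coord_self] at H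
  have K := fun i j k => h (f i) (f j) (f k)
  simp only [theta_three, stdOmega_apply, stdPsi_apply, coForm_three, coord_self] at K
  have a01 := H 0 1
  have a02 := H 0 2
  have a03 := H 0 3
  have a04 := H 0 4
  have a05 := H 0 5
  have a12 := H 1 2
  have a13 := H 1 3
  have a14 := H 1 4
  have a15 := H 1 5
  have a23 := H 2 3
  have a24 := H 2 4
  have a25 := H 2 5
  have a34 := H 3 4
  have a35 := H 3 5
  have a45 := H 4 5
  have b012 := K 0 1 2
  have b013 := K 0 1 3
  have b014 := K 0 1 4
  have b015 := K 0 1 5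
  have b023 := K 0 2 3
  have b024 := K 0 2 4
  have b025 := K 0 2 5
  have b034 := K 0 3 4
  have b035 := K 0 3 5
  have b045 := K 0 4 5
  have b123 := K 1 2 3
  have b124 := K 1 2 4
  have b125 := K 1 2 5
  have b134 := K 1 3 4
  have b135 := K 1 3 5
  have b145 := K 1 4 5
  have b234 := K 2 3 4
  have b235 := K 2 3 5
  have b245 := K 2 4 5
  have b345 := K 3 4 5
  clear H K h hE
  have hfin : ∀ i j : Fin 6, (i = j) = (i.val = j.val) := fun i j => propext Fin.ext_iff
  simp only [hfin] at a01 a02 a03 a04 a05 a12 a13 a14 a15 a23 a24 a25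
  norm_num at a01 a02 a03 a04 a05 a12 a13 a14 a15 a23 a24 a25
  simp only [← Basis.coord_apply] at a01 a02 a03 a04 a05 a12 a13 a14 a15 a23 a24 a25
  simp only [hfin] at a34 a35 a45 b012 b013 b014 b015 b023 b024 b025 b034 b035
  norm_num at a34 a35 a45 b012 b013 b014 b015 b023 b024 b025 b034 b035
  simp only [← Basis.coord_apply] at a34 a35 a45 b012 b013 b014 b015 b023 b024 b025 b034 b035
  simp only [hfin] at b045 b123 b124 b125 b134 b135 b145 b234 b235 b245 b345
  norm_num at b045 b123 b124 b125 b134 b135 b145 b234 b235 b245 b345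
  simp only [← Basis.coord_apply] at b045 b123 b124 b125 b134 b135 b145 b234 b235 b245 b345
  -- The system decouples by type. Under 𝔲(3), E splits into a unitary part, which sends ψ to a
  -- multiple of ρ, and a symmetric part anticommuting with J, which sends ψ injectively into the
  -- primitive forms of type (2,1) + (1,2). These are independent of ψ and of the forms x₀⌟½ω² ∈
  -- ω∧Λ¹, so δ and the symmetric part of E vanish.
  have hδ : δ = 0 := by linarith
  subst hδ
  refine ⟨rfl, fun i j => ?_⟩
  fin_cases i <;> fin_cases j <;> simp only [Fin.isValue, Fin.reduceFinMk, Fin.mk_one, Fin.zero_eta] <;> linarith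

end Theta

/-! ### Commutation with a normal endomorphism -/

section Normal

open Matrix

variable {n : Type*} [Fintype n]

theorem eq_zero_of_trace_mul_transpose {M : Matrix n n ℝ} (h : (M * Mᵀ).trace = 0) : M = 0 := by
  rw [← conjTranspose_eq_transpose_of_trivial] at h
  exact trace_mul_conjTranspose_self_eq_zero_iff.1 h

/-- A matrix commuting with a real normal matrix commutes with its transpose. -/
theorem commute_transpose_of_normal {K M : Matrix n n ℝ} (hM : M * Mᵀ = Mᵀ * M)
    (h : K * M = M * K) : K * Mᵀ = Mᵀ * K := by
  rw [← sub_eq_zero]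
  -- The squared Frobenius norm of [K, Mᵀ] expands into four traces; by normality and [K, M] = 0
  -- each equals tr(M K Kᵀ Mᵀ), and their signs cancel.
  refine eq_zero_of_trace_mul_transpose ?_
  have h' : Mᵀ * Kᵀ = Kᵀ * Mᵀ := by rw [← transpose_mul, ← transpose_mul, h]
  rw [transpose_sub, transpose_mul, transpose_mul, transpose_transpose, sub_mul, mul_sub, mul_sub,
    trace_sub, trace_sub, trace_sub]
  have e1 : (K * Mᵀ * (M * Kᵀ)).trace = (M * K * (Kᵀ * Mᵀ)).trace := by
    rw [← h, ← h', show K * Mᵀ * (M * Kᵀ) = K * (Mᵀ * M) * Kᵀ by simp only [Matrix.mul_assoc], ← hM]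
    simp only [Matrix.mul_assoc]
  have e2 : (Mᵀ * K * (Kᵀ * M)).trace = (M * K * (Kᵀ * Mᵀ)).trace := by
    rw [trace_mul_comm, show Kᵀ * M * (Mᵀ * K) = Kᵀ * (M * Mᵀ) * K by simp only [Matrix.mul_assoc],
      hM, trace_mul_comm (M * K), show Kᵀ * Mᵀ * (M * K) = Kᵀ * (Mᵀ * M) * K by
        simp only [Matrix.mul_assoc]]
  have e3 : (K * Mᵀ * (Kᵀ * M)).trace = (M * K * (Kᵀ * Mᵀ)).trace := by
    rw [trace_mul_comm, show Kᵀ * M * (K * Mᵀ) = Kᵀ * (M * K) * Mᵀ by simp only [Matrix.mul_assoc],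
      trace_mul_comm, ← Matrix.mul_assoc, h', trace_mul_comm]
  have e4 : (Mᵀ * K * (M * Kᵀ)).trace = (M * K * (Kᵀ * Mᵀ)).trace := by
    rw [show Mᵀ * K * (M * Kᵀ) = Mᵀ * (K * M * Kᵀ) by simp only [Matrix.mul_assoc], h,
      trace_mul_comm]
    simp only [Matrix.mul_assoc]
  rw [e1, e2, e3, e4]
  ring

/-- Pairing with Mᵀ: tr([K, M]Mᵀ) = tr(K[M, Mᵀ]) = 0, whereas tr(M Mᵀ) ≠ 0. -/
theorem eq_zero_of_commutator_eq_smul {K M : Matrix n n ℝ} {t : ℝ} (hM : M * Mᵀ = Mᵀ * M)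
    (h : K * M - M * K = t • M) (hne : M ≠ 0) : t = 0 := by
  have h1 : ((K * M - M * K) * Mᵀ).trace = 0 := by
    rw [sub_mul, trace_sub, trace_mul_comm (M * K), ← Matrix.mul_assoc, ← hM, trace_mul_comm (M * Mᵀ),
      Matrix.mul_assoc, sub_self]
  rw [h, smul_mul, trace_smul, smul_eq_mul] at h1
  exact (mul_eq_zero.1 h1).resolve_right fun h => hne (eq_zero_of_trace_mul_transpose h)

variable [DecidableEq n] {V : Type*} [AddCommGroup V] [Module ℝ V] {f : Basis n ℝ V} {A A' : End ℝ V}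

theorem toMatrix_adjoint (hadj : ∀ i j, f.coord i (A' (f j)) = f.coord j (A (f i))) :
    LinearMap.toMatrixAlgEquiv f A' = (LinearMap.toMatrixAlgEquiv f A)ᵀ := by
  ext i j
  rw [transpose_apply, LinearMap.toMatrixAlgEquiv_apply, LinearMap.toMatrixAlgEquiv_apply]
  exact hadj i j

theorem toMatrix_normal (hadj : ∀ i j, f.coord i (A' (f j)) = f.coord j (A (f i)))
    (hn : A * A' = A' * A) : LinearMap.toMatrixAlgEquiv f A * (LinearMap.toMatrixAlgEquiv f A)ᵀ
      = (LinearMap.toMatrixAlgEquiv f A)ᵀ * LinearMap.toMatrixAlgEquiv f A := by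
  rw [← toMatrix_adjoint hadj, ← map_mul, ← map_mul, hn]

/-- If an endomorphism commutes with a normal endomorphism `A`, then its symmetric part commutes
with `A` and with the transpose of `A`. -/
theorem symmetric_part_commute (hadj : ∀ i j, f.coord i (A' (f j)) = f.coord j (A (f i)))
    (hn : A * A' = A' * A) {C T : End ℝ V} (hC : C * A = A * C)
    (hT : ∀ i j, f.coord i (C (f j)) + f.coord j (C (f i)) = f.coord i (T (f j))) :
    T * A = A * T ∧ T * A' = A' * T := by
  set φ := LinearMap.toMatrixAlgEquiv f
  have hφT : φ T = φ C + (φ C)ᵀ := by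
    ext i j
    rw [Matrix.add_apply, transpose_apply, LinearMap.toMatrixAlgEquiv_apply,
      LinearMap.toMatrixAlgEquiv_apply, LinearMap.toMatrixAlgEquiv_apply]
    exact (hT i j).symm
  have hN := toMatrix_normal hadj hn
  have h1 : φ C * φ A = φ A * φ C := by rw [← map_mul, hC, map_mul]
  have h2 := commute_transpose_of_normal hN h1
  have h3 : φ A * (φ C)ᵀ = (φ C)ᵀ * φ A := by
    have := congrArg transpose h2
    rwa [transpose_mul, transpose_mul, transpose_transpose] at this
  have h4 : φ T * φ A = φ A * φ T := by rw [hφT, add_mul, mul_add, h1, h3]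
  have h5 := commute_transpose_of_normal hN h4
  rw [← toMatrix_adjoint hadj] at h5
  constructor
  · apply φ.injective
    rw [map_mul, map_mul, h4]
  · apply φ.injective
    rw [map_mul, map_mul]
    exact h5

theorem eq_zero_of_commutator (hadj : ∀ i j, f.coord i (A' (f j)) = f.coord j (A (f i)))
    (hn : A * A' = A' * A) {C : End ℝ V} {t : ℝ} (hC : C * A - A * C = t • A) (hne : A ≠ 0) :
    t = 0 := by
  refine eq_zero_of_commutator_eq_smul (K := LinearMap.toMatrixAlgEquiv f C)
    (toMatrix_normal hadj hn) ?_ ?_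
  · rw [← map_mul, ← map_mul, ← map_sub, hC, map_smul]
  · rwa [Ne, map_eq_zero_iff _ (LinearMap.toMatrixAlgEquiv f).injective]

/-- For normal M, (M Mᵀ)² = M²(Mᵀ)², so M² = 0 forces M Mᵀ = 0 and then M = 0. -/
theorem eq_zero_of_sq_eq_zero (hadj : ∀ i j, f.coord i (A' (f j)) = f.coord j (A (f i)))
    (hn : A * A' = A' * A) (h : A * A = 0) : A = 0 := by
  set φ := LinearMap.toMatrixAlgEquiv f
  have hN := toMatrix_normal hadj hn
  have h2 : φ A * φ A = 0 := by rw [← map_mul, h, map_zero]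
  have h3 : φ A * (φ A)ᵀ = 0 := by
    refine eq_zero_of_trace_mul_transpose ?_
    rw [transpose_mul, transpose_transpose]
    conv_lhs => rw [show φ A * (φ A)ᵀ * (φ A * (φ A)ᵀ) = φ A * ((φ A)ᵀ * φ A) * (φ A)ᵀ by
      simp only [Matrix.mul_assoc]]
    rw [← hN, ← Matrix.mul_assoc, h2]
    simp
  have h4 : φ A = 0 := eq_zero_of_trace_mul_transpose (by rw [h3, trace_zero])
  exact φ.injective (by rw [h4, map_zero])

end Normal

/-! ### Derivations of ℝ ⋉_A 𝔥 -/

section Derivation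

variable {𝔤 : Type*} [LieRing 𝔤] [LieAlgebra ℝ 𝔤] {𝔥 : LieIdeal ℝ 𝔤}
  {f : Basis (Fin 6) ℝ 𝔥} {F : Basis (Fin 7) ℝ 𝔤} {A A' : End ℝ 𝔥}

/-- The projection to the hyperplane. -/
def proj (F : Basis (Fin 7) ℝ 𝔤) (f : Basis (Fin 6) ℝ 𝔥) : 𝔤 →ₗ[ℝ] 𝔥 :=
  ∑ i : Fin 6, (F.coord i.castSucc).smulRight (f i)

theorem eq_proj_add (hF : ∀ i, F i.castSucc = f i) (x : 𝔤) :
    x = (proj F f x : 𝔤) + F.coord 6 x • F 6 := by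
  conv_lhs => rw [eq_add_smul hF x]
  simp [proj]

theorem proj_mem (hF : ∀ i, F i.castSucc = f i) (x : 𝔥) : proj F f (x : 𝔤) = x := by
  have := eq_proj_add hF (x : 𝔤)
  rw [coord_last_mem hF, zero_smul, add_zero] at this
  exact (Subtype.ext this).symm

theorem proj_last (F : Basis (Fin 7) ℝ 𝔤) (f : Basis (Fin 6) ℝ 𝔥) : proj F f (F 6) = 0 := by
  have : ∀ i : Fin 6, F.coord i.castSucc (F 6) = 0 := fun i => by
    rw [coord_self, if_neg (show (6 : Fin 7) ≠ i.castSucc from (Fin.castSucc_lt_last i).ne')]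
  simp only [proj, LinearMap.sum_apply, LinearMap.smulRight_apply, this, zero_smul,
    Finset.sum_const_zero]

theorem lie_eq (h_ab : ∀ x y : 𝔥, ⁅(x : 𝔤), (y : 𝔤)⁆ = 0) (hF : ∀ i, F i.castSucc = f i)
    (hA : ∀ x : 𝔥, ⁅F 6, (x : 𝔤)⁆ = A x) (x y : 𝔤) :
    ⁅x, y⁆ = F.coord 6 x • (A (proj F f y) : 𝔤) - F.coord 6 y • (A (proj F f x) : 𝔤) := by
  conv_lhs => rw [eq_proj_add hF x, eq_proj_add hF y]
  rw [add_lie, lie_add, lie_add, h_ab, smul_lie, smul_lie, lie_smul, lie_smul, lie_self, hA,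
    ← lie_skew, hA]
  module

/-- A derivation of an almost abelian Lie algebra `ℝ ⋉_A 𝔥` with `A ≠ 0` normal and trace free. -/
theorem derivation_structure (h_ab : ∀ x y : 𝔥, ⁅(x : 𝔤), (y : 𝔤)⁆ = 0)
    (hF : ∀ i, F i.castSucc = f i) (hA : ∀ x : 𝔥, ⁅F 6, (x : 𝔤)⁆ = A x)
    (hadj : ∀ i j, f.coord i (A' (f j)) = f.coord j (A (f i))) (hn : A * A' = A' * A)
    (htr : ∑ i, f.coord i (A (f i)) = 0) (hne : A ≠ 0) (D : LieDerivation ℝ 𝔤 𝔤) :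
    ∃ (B : End ℝ 𝔥) (x₀ : 𝔥), (∀ x : 𝔥, D (x : 𝔤) = B x) ∧ D (F 6) = x₀ ∧ B * A = A * B := by
  let δ : 𝔥 →ₗ[ℝ] ℝ := F.coord 6 ∘ₗ D.toLinearMap ∘ₗ 𝔥.toSubmodule.subtype
  let B : End ℝ 𝔥 := proj F f ∘ₗ D.toLinearMap ∘ₗ 𝔥.toSubmodule.subtype
  have hD : ∀ x : 𝔥, D (x : 𝔤) = (B x : 𝔤) + δ x • F 6 := fun x => eq_proj_add hF _
  have hδA : ∀ x y : 𝔥, δ x • A y = δ y • A x := by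
    intro x y
    have h := D.apply_lie_eq_add (x : 𝔤) (y : 𝔤)
    rw [h_ab, map_zero, lie_eq h_ab hF hA, lie_eq h_ab hF hA, coord_last_mem hF, coord_last_mem hF,
      proj_mem hF, proj_mem hF, zero_smul, zero_smul, zero_sub, sub_zero] at h
    apply Subtype.ext
    have h' : F.coord 6 (D (x : 𝔤)) • (A y : 𝔤) - F.coord 6 (D (y : 𝔤)) • (A x : 𝔤) = 0 := by
      rw [h]; abel
    exact sub_eq_zero.1 h'
  -- If D moved 𝔥 out of itself, `hδA` would give A rank one, A = δ(·)w. Then tr A = δ(w) = 0 makes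
  -- A² = 0, impossible for a nonzero normal A.
  have hδ : ∀ x, δ x = 0 := by
    by_contra hcon
    push Not at hcon
    obtain ⟨u, hu⟩ := hcon
    obtain ⟨w, hw⟩ : ∃ w : 𝔥, ∀ y, A y = δ y • w := by
      refine ⟨(δ u)⁻¹ • A u, fun y => ?_⟩
      rw [smul_comm, ← hδA, smul_smul, inv_mul_cancel₀ hu, one_smul]
    have hδw : δ w = 0 := by
      rw [← htr]
      conv_lhs => rw [← f.sum_repr w, map_sum]
      refine Finset.sum_congr rfl fun i _ => ?_
      rw [hw, map_smul, map_smul, smul_eq_mul, smul_eq_mul, mul_comm]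
      rfl
    refine hne (eq_zero_of_sq_eq_zero hadj hn ?_)
    ext1 x
    rw [Module.End.mul_apply, hw x, map_smul, hw w, hδw, zero_smul, smul_zero, LinearMap.zero_apply]
  have hDB : ∀ x : 𝔥, D (x : 𝔤) = B x := fun x => by rw [hD, hδ, zero_smul, add_zero]
  -- D applied to [F₆, x], with D F₆ allowed a component along F₆; normality of A then removes that
  -- component.
  have hcomm : B * A - A * B = F.coord 6 (D (F 6)) • A := by
    ext1 x
    have h := D.apply_lie_eq_add (F 6) (x : 𝔤)
    rw [hA, hDB, hDB, hA, lie_eq h_ab hF hA (D (F 6)), coord_last_mem hF, proj_mem hF, zero_smul,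
      sub_zero] at h
    apply Subtype.ext
    rw [LinearMap.sub_apply, Module.End.mul_apply, Module.End.mul_apply, LinearMap.smul_apply]
    exact sub_eq_iff_eq_add'.2 h
  have ht := eq_zero_of_commutator hadj hn hcomm hne
  refine ⟨B, proj F f (D (F 6)), hDB, ?_, ?_⟩
  · conv_lhs => rw [eq_proj_add hF (D (F 6)), ht, zero_smul, add_zero]
  · rw [ht, zero_smul] at hcomm
    exact sub_eq_zero.1 hcomm

/-- An endomorphism commuting with `A` extends to a derivation. -/
theorem exists_derivation (h_ab : ∀ x y : 𝔥, ⁅(x : 𝔤), (y : 𝔤)⁆ = 0)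
    (hF : ∀ i, F i.castSucc = f i) (hA : ∀ x : 𝔥, ⁅F 6, (x : 𝔤)⁆ = A x) {B : End ℝ 𝔥}
    (hB : B * A = A * B) :
    ∃ D : LieDerivation ℝ 𝔤 𝔤, (∀ x : 𝔥, D (x : 𝔤) = B x) ∧ D (F 6) = 0 := by
  have hB' : ∀ x, B (A x) = A (B x) := fun x => LinearMap.congr_fun hB x
  let D₀ : 𝔤 →ₗ[ℝ] 𝔤 := 𝔥.toSubmodule.subtype ∘ₗ B ∘ₗ proj F f
  have hD₀ : ∀ x, D₀ x = (B (proj F f x) : 𝔤) := fun _ => rfl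
  refine ⟨⟨D₀, fun x y => ?_⟩, fun x => ?_, ?_⟩
  · rw [hD₀ x, hD₀ y, lie_eq h_ab hF hA x (B (proj F f y) : 𝔤),
      lie_eq h_ab hF hA y (B (proj F f x) : 𝔤), lie_eq h_ab hF hA x y, map_sub, map_smul, map_smul,
      hD₀, hD₀]
    simp only [proj_mem hF, coord_last_mem hF, hB', zero_smul, sub_zero]
  · change D₀ (x : 𝔤) = _
    rw [hD₀, proj_mem hF]
  · change D₀ (F 6) = 0
    rw [hD₀, proj_last, map_zero]
    rfl

theorem res_theta {k : ℕ} {D : End ℝ 𝔤} {B : End ℝ 𝔥} (hD : ∀ x : 𝔥, D (x : 𝔤) = B x)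
    (α : Form 𝔤 k) : res 𝔥 (theta D α) = theta B (res 𝔥 α) := by
  ext v
  rw [res_apply, theta_apply, theta_apply]
  congr 1
  refine Finset.sum_congr rfl fun i _ => ?_
  rw [res_apply, hD]
  congr 1
  funext j
  by_cases h : j = i
  · subst h; simp
  · simp [h]

theorem res_theta_curryLeft {D : End ℝ 𝔤} {B : End ℝ 𝔥} (hD : ∀ x : 𝔥, D (x : 𝔤) = B x) {u : 𝔤}
    {x₀ : 𝔥} (hu : D u = x₀) (α : Form 𝔤 4) (x y z : 𝔥) :
    res 𝔥 ((theta D α).curryLeft u) ![x, y, z]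
      = -res 𝔥 α ![x₀, x, y, z] + theta B (res 𝔥 (α.curryLeft u)) ![x, y, z] := by
  rw [theta_three]
  simp only [res_vec_three, res_vec_four, AlternatingMap.curryLeft_apply_apply]
  have := theta_four D α u (x : 𝔤) (y : 𝔤) (z : 𝔤)
  rw [hu, hD, hD, hD] at this
  refine this.trans ?_
  change _ = -α ![(x₀ : 𝔤), (x : 𝔤), (y : 𝔤), (z : 𝔤)] + -(α ![u, (B x : 𝔤), (y : 𝔤), (z : 𝔤)]
    + α ![u, (x : 𝔤), (B y : 𝔤), (z : 𝔤)] + α ![u, (x : 𝔤), (y : 𝔤), (B z : 𝔤)])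
  ring

end Derivation

/-! ### The symplectic algebra and the endomorphism Σ -/

section Symplectic

variable {V : Type*} [AddCommGroup V] [Module ℝ V]

/-- The transpose of an element of `𝔰𝔭(ω)` with respect to a compatible scalar product is again in
`𝔰𝔭(ω)`. -/
theorem symplectic_transpose {B : LinearMap.BilinForm ℝ V} (hB : ∀ x y, B x y = B y x)
    {ω : Form V 2} {J : End ℝ V} (hJ : ∀ x y, B (J x) y = ω ![x, y]) (hJ2 : ∀ x, J (J x) = -x)
    {A A' : End ℝ V} (hA : ∀ x y, ω ![A x, y] = -ω ![x, A y])
    (hA' : ∀ x y, B (A x) y = B x (A' y)) (x y : V) : ω ![A' x, y] = -ω ![x, A' y] := by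
  -- In operator form: the transpose is A' = JAJ.
  have hweak : ∀ x z, B (A' x) z = ω ![A (J x), z] := by
    intro x z
    rw [hA, ← hJ, hJ2, B.map_neg, LinearMap.neg_apply, neg_neg, hB, ← hA', hB]
  rw [two_swap, ← hJ, hB, hweak, two_swap, ← hJ, hJ2, B.map_neg, LinearMap.neg_apply, neg_neg, hB,
    ← hJ, ← hA']

theorem two_add_left (ω : Form V 2) (x x' y : V) :
    ω ![x + x', y] = ω ![x, y] + ω ![x', y] := by
  have h : ∀ x, ω ![x, y] = ω.curryLeft x ![y] := fun _ => rfl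
  simp only [h, map_add, AlternatingMap.add_apply]

theorem two_add_right (ω : Form V 2) (x y y' : V) :
    ω ![x, y + y'] = ω ![x, y] + ω ![x, y'] := by
  rw [two_swap, two_add_left, two_swap ω y, two_swap ω y']
  ring

theorem two_smul_left (ω : Form V 2) (c : ℝ) (x y : V) :
    ω ![c • x, y] = c * ω ![x, y] := by
  have h : ∀ x, ω ![x, y] = ω.curryLeft x ![y] := fun _ => rfl
  simp only [h, map_smul, AlternatingMap.smul_apply, smul_eq_mul]

variable {f : Basis (Fin 6) ℝ V}

theorem trace_eq_zero_of_symplectic {A : End ℝ V}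
    (hA : ∀ x y, stdOmega f ![A x, y] = -stdOmega f ![x, A y]) :
    ∑ i, f.coord i (A (f i)) = 0 := by
  have h0 := hA (f 0) (f 1)
  have h1 := hA (f 2) (f 3)
  have h2 := hA (f 4) (f 5)
  simp only [stdOmega_apply, coord_self] at h0 h1 h2
  simp only [show ∀ i j : Fin 6, (i = j) = (i.val = j.val) from fun i j => propext Fin.ext_iff]
    at h0 h1 h2
  norm_num at h0 h1 h2
  simp only [← Basis.coord_apply] at h0 h1 h2
  rw [Fin.sum_univ_six]
  linarith

variable {S : End ℝ V} {θ : ℝ} {s : Fin 3 → ℝ}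

theorem bigSigma_symplectic (x y : V) :
    stdOmega f ![bigSigma f θ s x, y] = -stdOmega f ![x, bigSigma f θ s y] := by
  have h := bigSigma_coord f θ s
  simp only [stdOmega_apply, fun x => (h x).1, fun x => (h x).2.1, fun x => (h x).2.2.1,
    fun x => (h x).2.2.2.1, fun x => (h x).2.2.2.2.1, fun x => (h x).2.2.2.2.2]
  ring

theorem bigSigma_symmetric (i j : Fin 6) :
    f.coord i (bigSigma f θ s (f j)) = f.coord j (bigSigma f θ s (f i)) := by
  have h := bigSigma_coord f θ s
  have key : ∀ x y, metric f x (bigSigma f θ s y) = metric f y (bigSigma f θ s x) := by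
    intro x y
    simp only [metric_apply, Fin.sum_univ_six, fun x => (h x).1, fun x => (h x).2.1,
      fun x => (h x).2.2.1, fun x => (h x).2.2.2.1, fun x => (h x).2.2.2.2.1,
      fun x => (h x).2.2.2.2.2]
    ring
  rw [← metric_basis_left, key, metric_basis_left]

/-- In each plane Σ and S are symmetric and trace free, with directions −2θ and θ, so their
commutator is a multiple of the rotation by a right angle. The multiple is the same in all three
planes: the scalar on the right up to sign, where 4b(1 − 4a²) = −4 sin 3θ. -/
theorem bigSigma_commute_iff (hS : IsNormalForm S f θ s) :
    bigSigma f θ s * S = S * bigSigma f θ s ↔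
      4 * Real.sin θ * (1 - 4 * Real.cos θ ^ 2) * s 0 * s 1 * s 2 = 0 := by
  have h := bigSigma_coord f θ s
  have hN := normalForm_coord hS
  have h01 : ∀ x, f.coord 0 (bigSigma f θ s (S x)) - f.coord 0 (S (bigSigma f θ s x))
      = -(4 * Real.sin θ * (1 - 4 * Real.cos θ ^ 2) * s 0 * s 1 * s 2) * f.coord 1 x := by
    intro x
    rw [(h (S x)).1, (hN x).1, (hN x).2.1, (hN (bigSigma f θ s x)).1, (h x).1, (h x).2.1]
    ring
  constructor
  · intro hc
    have := h01 (f 1)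
    rw [show bigSigma f θ s (S (f 1)) = S (bigSigma f θ s (f 1)) from LinearMap.congr_fun hc (f 1),
      coord_self, if_pos rfl, sub_self] at this
    linarith
  · intro hc
    refine LinearMap.ext fun x => f.ext_elem fun i => ?_
    change f.coord i (bigSigma f θ s (S x)) = f.coord i (S (bigSigma f θ s x))
    fin_cases i
    · have := h01 x
      rw [hc] at this
      change f.coord 0 _ = f.coord 0 _
      linarith
    · change f.coord 1 _ = f.coord 1 _
      rw [(h (S x)).2.1, (hN x).1, (hN x).2.1, (hN (bigSigma f θ s x)).2.1, (h x).1, (h x).2.1]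
      linear_combination f.coord 0 x * hc
    · change f.coord 2 _ = f.coord 2 _
      rw [(h (S x)).2.2.1, (hN x).2.2.1, (hN x).2.2.2.1, (hN (bigSigma f θ s x)).2.2.1,
        (h x).2.2.1, (h x).2.2.2.1]
      linear_combination -f.coord 3 x * hc
    · change f.coord 3 _ = f.coord 3 _
      rw [(h (S x)).2.2.2.1, (hN x).2.2.1, (hN x).2.2.2.1, (hN (bigSigma f θ s x)).2.2.2.1,
        (h x).2.2.1, (h x).2.2.2.1]
      linear_combination f.coord 2 x * hc
    · change f.coord 4 _ = f.coord 4 _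
      rw [(h (S x)).2.2.2.2.1, (hN x).2.2.2.2.1, (hN x).2.2.2.2.2, (hN (bigSigma f θ s x)).2.2.2.2.1,
        (h x).2.2.2.2.1, (h x).2.2.2.2.2]
      linear_combination -f.coord 5 x * hc
    · change f.coord 5 _ = f.coord 5 _
      rw [(h (S x)).2.2.2.2.2, (hN x).2.2.2.2.1, (hN x).2.2.2.2.2, (hN (bigSigma f θ s x)).2.2.2.2.2,
        (h x).2.2.2.2.1, (h x).2.2.2.2.2]
      linear_combination f.coord 4 x * hc

theorem eq_zero_of_normalForm_zero (h : IsNormalForm (0 : End ℝ V) f θ s) (i : Fin 3) :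
    s i = 0 := by
  have hN := normalForm_coord h
  have key : ∀ t : ℝ, 0 = t * Real.cos θ → 0 = t * Real.sin θ → t = 0 := by
    intro t h1 h2
    have := Real.cos_sq_add_sin_sq θ
    linear_combination (-Real.cos θ) * h1 - Real.sin θ * h2 - t * this
  have h0 := hN (f 0)
  have h1 := hN (f 2)
  have h2 := hN (f 4)
  simp only [LinearMap.zero_apply, map_zero, coord_self] at h0 h1 h2
  fin_cases i
  · exact key _ (by simpa using h0.1) (by simpa using h0.2.1)
  · exact key _ (by simpa using h1.2.2.1) (by simpa using h1.2.2.2.1)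
  · exact key _ (by simpa using h2.2.2.2.2.1) (by simpa using h2.2.2.2.2.2)

end Symplectic

/-- The data of a coclosed `G₂`-structure on `ℝ ⋉_A 𝔥`, `A = S + L` normal, in a frame `F` whose
last vector is normal to `𝔥` and whose first vectors form an `SU(3)`-frame `f` in which `S` has the
normal form. -/
structure IsSolitonFrame {𝔤 : Type*} [LieRing 𝔤] [LieAlgebra ℝ 𝔤] {𝔥 : LieIdeal ℝ 𝔤}
    (e : Basis (Fin 7) ℝ 𝔤) (Φ : Form 𝔤 4) (F : Basis (Fin 7) ℝ 𝔤) (f : Basis (Fin 6) ℝ 𝔥)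
    (S L : End ℝ 𝔥) (θ : ℝ) (s : Fin 3 → ℝ) : Prop where
  lie_mem : ∀ x y : 𝔥, ⁅(x : 𝔤), (y : 𝔤)⁆ = 0
  castSucc : ∀ i, F i.castSucc = f i
  metric_eq : metric e = metric F
  lie_last : ∀ x : 𝔥, ⁅F 6, (x : 𝔤)⁆ = (S + L) x
  symm : ∀ x y, metric f (S x) y = metric f x (S y)
  skew : ∀ x y, metric f (L x) y = -metric f x (L y)
  comm : S * L = L * S
  closed : d Φ = 0
  symplectic_symm : ∀ x y, stdOmega f ![S x, y] = -stdOmega f ![x, S y]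
  symplectic_skew : ∀ x y, stdOmega f ![L x, y] = -stdOmega f ![x, L y]
  halfSquare : IsHalfSquare (stdOmega f) (res 𝔥 Φ)
  curry : res 𝔥 (Φ.curryLeft (F 6)) = -stdPsi f
  normalForm : IsNormalForm S f θ s

/-! ### The soliton equation in an adapted frame -/

namespace IsSolitonFrame

variable {𝔤 : Type*} [LieRing 𝔤] [LieAlgebra ℝ 𝔤] {𝔥 : LieIdeal ℝ 𝔤}
  {e F : Basis (Fin 7) ℝ 𝔤} {Φ : Form 𝔤 4} {f : Basis (Fin 6) ℝ 𝔥}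
  {S L : End ℝ 𝔥} {θ : ℝ} {s : Fin 3 → ℝ}

theorem symplectic (h : IsSolitonFrame e Φ F f S L θ s) (x y : 𝔥) :
    stdOmega f ![(S + L) x, y] = -stdOmega f ![x, (S + L) y] := by
  rw [LinearMap.add_apply, LinearMap.add_apply, two_add_left, two_add_right, h.symplectic_symm,
    h.symplectic_skew]
  ring

theorem adjoint (h : IsSolitonFrame e Φ F f S L θ s) (i j : Fin 6) :
    f.coord i ((S - L) (f j)) = f.coord j ((S + L) (f i)) := by
  have h1 := h.symm (f i) (f j)
  have h2 := h.skew (f i) (f j)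
  rw [metric_comm, metric_basis_left, metric_basis_left] at h1 h2
  rw [LinearMap.add_apply, LinearMap.sub_apply, map_add, map_sub]
  linarith

theorem normal (h : IsSolitonFrame e Φ F f S L θ s) : (S + L) * (S - L) = (S - L) * (S + L) := by
  rw [add_mul, mul_sub, mul_sub, sub_mul, mul_add, mul_add, h.comm]
  abel

/-- As S and L commute, the cross terms of ϑ(S + L)ϑ(S − L) cancel, leaving ϑ(S)² − ϑ(L)². The
overall minus comes from e₇⌟Φ = −ψ. -/
theorem laplacian_curryLeft (h : IsSolitonFrame e Φ F f S L θ s) :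
    res 𝔥 ((laplacian e Φ).curryLeft (F 6))
      = -((imTrace f L ^ 2 + (s 0 ^ 2 + s 1 ^ 2 + s 2 ^ 2)) • stdPsi f
        + theta (bigSigma f θ s) (stdPsi f)) := by
  have hL : ∀ i j, f.coord i (L (f j)) = -f.coord j (L (f i)) := by
    intro i j
    have := h.skew (f i) (f j)
    rw [metric_comm, metric_basis_left, metric_basis_left] at this
    linarith
  have h1 := theta_theta_normalForm h.normalForm
  have h2 := theta_theta_unitary hL h.symplectic_skew
  have h3 := theta_comm h.comm (stdPsi f)
  rw [res_laplacian_curryLeft h.lie_mem h.castSucc h.metric_eq (S + L) (S - L) h.lie_last ?_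
    (trace_eq_zero_of_symplectic h.symplectic) h.closed, h.curry, theta_neg_right, theta_neg_right,
    sub_eq_add_neg, theta_add_left, theta_add_left, theta_neg_left, theta_add_right,
    theta_add_right, theta_neg_right, theta_neg_right, h1, h2, h3]
  · module
  · intro x y
    have h1 := h.symm x y
    have h2 := h.skew x y
    rw [metric_mem h.castSucc, metric_mem h.castSucc, LinearMap.add_apply, LinearMap.sub_apply,
      map_add, map_sub, LinearMap.add_apply]
    linarith

/-- The soliton equation, split into its part on `𝔥` and its part involving the normal vector. -/
theorem soliton_equation_iff (h : IsSolitonFrame e Φ F f S L θ s) {D : End ℝ 𝔤} {B : End ℝ 𝔥}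
    {x₀ : 𝔥} (hD : ∀ x : 𝔥, D (x : 𝔤) = B x) (hu : D (F 6) = x₀) (c : ℝ) :
    -laplacian e Φ = (-4 * c) • Φ + theta D Φ ↔
      theta B (res 𝔥 Φ) = (2 * (2 * c)) • res 𝔥 Φ ∧
      ∀ x y z, theta (B + c • 1 + bigSigma f θ s) (stdPsi f) ![x, y, z]
        + (imTrace f L ^ 2 + (s 0 ^ 2 + s 1 ^ 2 + s 2 ^ 2) - c) * stdPsi f ![x, y, z]
        + (stdOmega f ![x₀, x] * stdOmega f ![y, z] - stdOmega f ![x₀, y] * stdOmega f ![x, z]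
          + stdOmega f ![x₀, z] * stdOmega f ![x, y]) = 0 := by
  have hlap := res_laplacian h.lie_mem e h.closed
  -- Shifting B by c·1 places it in 𝔰𝔭(ω) and, since the identity acts by −3 on 3-forms, absorbs 3c
  -- of the coefficient 4c; this leaves l² + s² − c.
  have hE : theta (B + c • 1 + bigSigma f θ s) (stdPsi f) = theta B (stdPsi f)
      - (3 * c) • stdPsi f + theta (bigSigma f θ s) (stdPsi f) := by
    rw [theta_add_left, theta_add_left, theta_smul_left, theta_one]
    push_cast
    module
  have e0 : res 𝔥 (-laplacian e Φ) = 0 := by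
    rw [← neg_eq_zero.2 hlap]
    rfl
  have e0' : res 𝔥 ((-4 * c) • Φ + theta D Φ) = (-4 * c) • res 𝔥 Φ + theta B (res 𝔥 Φ) := by
    rw [← res_theta hD]
    rfl
  have e1 : ∀ x y z, res 𝔥 ((-laplacian e Φ).curryLeft (F 6)) ![x, y, z]
      = ((imTrace f L ^ 2 + (s 0 ^ 2 + s 1 ^ 2 + s 2 ^ 2)) • stdPsi f
        + theta (bigSigma f θ s) (stdPsi f)) ![x, y, z] := by
    intro x y z
    rw [← neg_neg (_ • stdPsi f + _), ← h.laplacian_curryLeft]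
    rfl
  have e1' : ∀ x y z, res 𝔥 (((-4 * c) • Φ + theta D Φ).curryLeft (F 6)) ![x, y, z]
      = (-4 * c) * res 𝔥 (Φ.curryLeft (F 6)) ![x, y, z]
        + res 𝔥 ((theta D Φ).curryLeft (F 6)) ![x, y, z] := fun _ _ _ => rfl
  have key : ∀ x y z, (res 𝔥 ((-laplacian e Φ).curryLeft (F 6)) ![x, y, z]
        = res 𝔥 (((-4 * c) • Φ + theta D Φ).curryLeft (F 6)) ![x, y, z]) ↔
      theta (B + c • 1 + bigSigma f θ s) (stdPsi f) ![x, y, z]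
        + (imTrace f L ^ 2 + (s 0 ^ 2 + s 1 ^ 2 + s 2 ^ 2) - c) * stdPsi f ![x, y, z]
        + (stdOmega f ![x₀, x] * stdOmega f ![y, z] - stdOmega f ![x₀, y] * stdOmega f ![x, z]
          + stdOmega f ![x₀, z] * stdOmega f ![x, y]) = 0 := by
    intro x y z
    rw [e1, e1', res_theta_curryLeft hD hu, h.curry, theta_neg_right, h.halfSquare, hE]
    simp only [AlternatingMap.add_apply, AlternatingMap.sub_apply, AlternatingMap.neg_apply,
      AlternatingMap.smul_apply, smul_eq_mul]
    constructor <;> intro h' <;> linear_combination h'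
  constructor
  · intro heq
    constructor
    · rw [heq, e0'] at e0
      rw [← sub_eq_zero, ← e0]
      module
    · intro x y z
      rw [← key, heq]
  · rintro ⟨h0, h1⟩
    refine form_ext h.castSucc ?_ (form_ext_three fun x y z => (key x y z).2 (h1 x y z))
    rw [e0, e0', h0]
    module

/-- The derivation has B = −c − Σ and x₀ = 0, so that B + c + Σ = 0 and every term of the equation
along e₇ vanishes. -/
theorem isSolitonWith (h : IsSolitonFrame e Φ F f S L θ s)
    (h1 : 4 * Real.sin θ * (1 - 4 * Real.cos θ ^ 2) * s 0 * s 1 * s 2 = 0)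
    (h2 : ⁅bigSigma f θ s, L⁆ = 0) :
    IsSolitonWith e Φ (imTrace f L ^ 2 + (s 0 ^ 2 + s 1 ^ 2 + s 2 ^ 2)) := by
  set c := imTrace f L ^ 2 + (s 0 ^ 2 + s 1 ^ 2 + s 2 ^ 2) with hc
  have h1' := (bigSigma_commute_iff h.normalForm).2 h1
  have h2' : bigSigma f θ s * L = L * bigSigma f θ s := by
    rwa [Ring.lie_def, sub_eq_zero] at h2
  obtain ⟨D, hD, hD6⟩ := exists_derivation h.lie_mem h.castSucc h.lie_last
    (B := -(c • (1 : End ℝ 𝔥)) - bigSigma f θ s) (by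
      rw [sub_mul, mul_sub, mul_add (bigSigma f θ s), add_mul S L (bigSigma f θ s), h1', h2']
      simp)
  refine ⟨D, (h.soliton_equation_iff (x₀ := 0) hD hD6 c).2 ⟨?_, fun x y z => ?_⟩⟩
  · refine theta_halfSquare_of_eq_smul h.halfSquare _ _ ?_
    rw [sub_eq_add_neg, theta_add_left, theta_neg_left, theta_neg_left, theta_smul_left, theta_one]
    have : theta (bigSigma f θ s) (stdOmega f) = 0 := by
      refine form_ext_two fun x y => ?_
      rw [theta_two, bigSigma_symplectic]
      simp
    rw [this]
    push_cast
    module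
  · rw [← hc]
    have : -(c • (1 : End ℝ 𝔥)) - bigSigma f θ s + c • 1 + bigSigma f θ s = (0 : ℝ) • 1 := by
      module
    rw [this, theta_smul_left, stdOmega_apply f 0, stdOmega_apply f 0, stdOmega_apply f 0]
    simp

theorem conditions_of_isSolitonWith (h : IsSolitonFrame e Φ F f S L θ s) (hne : S + L ≠ 0) {c : ℝ}
    (hc : IsSolitonWith e Φ c) :
    imTrace f L ^ 2 + (s 0 ^ 2 + s 1 ^ 2 + s 2 ^ 2) - c = 0 ∧
      4 * Real.sin θ * (1 - 4 * Real.cos θ ^ 2) * s 0 * s 1 * s 2 = 0 ∧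
      ⁅bigSigma f θ s, L⁆ = 0 := by
  obtain ⟨D, heq⟩ := hc
  obtain ⟨B, x₀, hD, hD6, hB⟩ := derivation_structure h.lie_mem h.castSucc h.lie_last h.adjoint
    h.normal (trace_eq_zero_of_symplectic h.symplectic) hne D
  obtain ⟨h0, h1⟩ := (h.soliton_equation_iff hD hD6 c).1 heq
  have hBω := theta_eq_smul_of_halfSquare h.halfSquare B (2 * c) h0
  obtain ⟨hδ, hE⟩ := soliton_linear_system (fun x y => by
    have h2 := DFunLike.congr_fun hBω ![x, y]
    have h3 := bigSigma_symplectic (f := f) (θ := θ) (s := s) x y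
    rw [theta_two, AlternatingMap.smul_apply, smul_eq_mul] at h2
    simp only [LinearMap.add_apply, LinearMap.smul_apply, Module.End.one_apply, two_add_left,
      two_add_right, two_smul_left]
    rw [two_swap (stdOmega f) x (c • y), two_smul_left, two_swap (stdOmega f) y x]
    linear_combination h3 - h2) h1
  have hC : (B + c • 1) * (S + L) = (S + L) * (B + c • 1) := by
    rw [add_mul, hB, mul_add (S + L)]
    simp
  -- B + c + Σ is skew and Σ symmetric, so B + c plus its transpose is −2Σ.
  obtain ⟨h3, h4⟩ := symmetric_part_commute h.adjoint h.normal
    (T := (-2 : ℝ) • bigSigma f θ s) hC fun i j => by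
      have h5 := hE i j
      have h6 := bigSigma_symmetric (f := f) (θ := θ) (s := s) i j
      rw [LinearMap.add_apply _ (bigSigma f θ s), LinearMap.add_apply _ (bigSigma f θ s), map_add,
        map_add] at h5
      rw [LinearMap.smul_apply, map_smul, smul_eq_mul]
      linarith
  rw [smul_mul_assoc, mul_smul_comm] at h3 h4
  have h3' := smul_right_injective _ (show (-2 : ℝ) ≠ 0 by norm_num) h3
  have h4' := smul_right_injective _ (show (-2 : ℝ) ≠ 0 by norm_num) h4
  simp only [mul_add, add_mul, mul_sub, sub_mul] at h3' h4'
  -- Adding the commutation relations with S + L and with S − L separates S from L.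
  have hS : bigSigma f θ s * S = S * bigSigma f θ s := by
    have : (2 : ℝ) • (bigSigma f θ s * S) = (2 : ℝ) • (S * bigSigma f θ s) := by
      have e : bigSigma f θ s * S + bigSigma f θ s * S = (bigSigma f θ s * S + bigSigma f θ s * L)
          + (bigSigma f θ s * S - bigSigma f θ s * L) := by abel
      rw [two_smul, two_smul, e, h3', h4']
      abel
    exact smul_right_injective _ (show (2 : ℝ) ≠ 0 by norm_num) this
  have hL : bigSigma f θ s * L = L * bigSigma f θ s := by
    rw [hS] at h3'
    exact add_left_cancel h3'
  exact ⟨hδ, (bigSigma_commute_iff h.normalForm).1 hS, by rw [Ring.lie_def, hL, sub_self]⟩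

theorem isSoliton_iff (h : IsSolitonFrame e Φ F f S L θ s) : IsSoliton e Φ ↔
    4 * Real.sin θ * (1 - 4 * Real.cos θ ^ 2) * s 0 * s 1 * s 2 = 0 ∧
      ⁅bigSigma f θ s, L⁆ = 0 := by
  refine ⟨?_, fun hc => ⟨_, h.isSolitonWith hc.1 hc.2⟩⟩
  rintro ⟨c, hc⟩
  -- For A = 0 the structure of derivations used otherwise is not available, but then S = L = 0 and
  -- all sᵢ vanish, so both conditions hold trivially.
  by_cases hne : S + L = 0
  · have hSL : ∀ i j, f.coord i (S (f j)) = 0 ∧ f.coord i (L (f j)) = 0 := by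
      intro i j
      have h1 := h.adjoint i j
      have h2 := congrArg (f.coord i) (LinearMap.congr_fun hne (f j))
      rw [hne] at h1
      rw [LinearMap.add_apply, LinearMap.zero_apply, map_add, map_zero] at h2
      rw [LinearMap.sub_apply, LinearMap.zero_apply, map_sub, map_zero] at h1
      constructor <;> linarith
    have hS : S = 0 := f.ext fun j => f.ext_elem fun i => by simpa using (hSL i j).1
    have hL : L = 0 := f.ext fun j => f.ext_elem fun i => by simpa using (hSL i j).2
    have hN := h.normalForm
    rw [hS] at hN
    rw [eq_zero_of_normalForm_zero hN 0, hL, Ring.lie_def]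
    simp
  · exact (h.conditions_of_isSolitonWith hne hc).2

end IsSolitonFrame

/-! ### Consequences of coclosedness -/

section Frame

variable {𝔤 : Type*} [LieRing 𝔤] [LieAlgebra ℝ 𝔤] {𝔥 : LieIdeal ℝ 𝔤}
  {e : Basis (Fin 7) ℝ 𝔤} {φ : Form 𝔤 3} {e₇ : 𝔤}

/-- An `SU(3)`-frame of the orthogonal complement of a unit vector: `⋆φ` restricts to half the
square of the fundamental form. -/
theorem isHalfSquare_of_isSU3Frame (he : IsG2Frame φ e) (h_unit : metric e e₇ e₇ = 1)
    (h_perp : ∀ x ∈ 𝔥, metric e e₇ x = 0) {f : Basis (Fin 6) ℝ 𝔥}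
    (hf : IsSU3Frame (resMetric e 𝔥) (res 𝔥 (φ.curryLeft e₇))
      (-res 𝔥 ((hodgeStar e (by norm_num : 3 + 4 = 7) φ).curryLeft e₇)) f) :
    IsHalfSquare (stdOmega f) (res 𝔥 (hodgeStar e (by norm_num : 3 + 4 = 7) φ)) := by
  obtain ⟨F, hF, rfl, hmet⟩ := exists_extend_basis e h_unit h_perp f hf.1
  intro x y z w
  rw [res_hodgeStar_of_frame he hmet hF hf.2.1 (res_of_frame he hmet hF hf.2.1 hf.2.2), hf.2.1]
  rfl

/-- If `⋆φ` is closed, then `ad e₇` preserves the fundamental form. -/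
theorem symplectic_of_coclosed (he : IsG2Frame φ e) (h_unit : metric e e₇ e₇ = 1)
    (h_perp : ∀ x ∈ 𝔥, metric e e₇ x = 0) (h_dim : finrank ℝ 𝔥 = 6)
    (h_ab : ∀ x y : 𝔥, ⁅(x : 𝔤), (y : 𝔤)⁆ = 0)
    (hd : d (hodgeStar e (by norm_num : 3 + 4 = 7) φ) = 0) {A : End ℝ 𝔥}
    (hA : ∀ x : 𝔥, ⁅e₇, (x : 𝔤)⁆ = A x) (x y : 𝔥) :
    res 𝔥 (φ.curryLeft e₇) ![A x, y] = -res 𝔥 (φ.curryLeft e₇) ![x, A y] := by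
  -- Only some SU(3)-frame is needed here. It is obtained with the zero endomorphism in place of S,
  -- because the symplectic property of S is not yet known.
  obtain ⟨f, -, -, -, hf, -⟩ := exists_su3Frame_normalForm he h_unit h_perp h_dim 0
    (fun x y => by simp) (fun x y => by
      have := two_smul_left (res 𝔥 (φ.curryLeft e₇)) 0 0 y
      rw [LinearMap.zero_apply, LinearMap.zero_apply, two_swap _ x]
      rw [zero_smul, zero_mul] at this
      have h2 := two_smul_left (res 𝔥 (φ.curryLeft e₇)) 0 0 x
      rw [zero_smul, zero_mul] at h2
      rw [this, h2, neg_zero, neg_zero])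
  have hsq := isHalfSquare_of_isSU3Frame he h_unit h_perp hf
  have h0 : theta A (res 𝔥 (hodgeStar e (by norm_num : 3 + 4 = 7) φ)) = 0 := by
    rw [← res_d_curryLeft h_ab e₇ A hA, hd]
    rfl
  have h1 := theta_eq_smul_of_halfSquare hsq A 0 (by rw [h0, mul_zero, zero_smul])
  have h2 := DFunLike.congr_fun h1 ![x, y]
  rw [theta_two, zero_smul, AlternatingMap.zero_apply] at h2
  rw [show res 𝔥 (φ.curryLeft e₇) = stdOmega f from hf.2.1]
  linarith

end Frame

end Coflow

end

/-! ### The theorem -/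

theorem corollary4p4 {𝔤 : Type*} [LieRing 𝔤] [LieAlgebra ℝ 𝔤]
    -- the almost-abelian Lie algebra: an abelian ideal of codimension one
    (𝔥 : LieIdeal ℝ 𝔤) (h_ab : IsLieAbelian 𝔥) (h_dim : Module.finrank ℝ 𝔥 = 6)
    -- the `G₂`-structure, with an adapted frame giving its metric and orientation
    (φ : Coflow.Form 𝔤 3) (e : Module.Basis (Fin 7) ℝ 𝔤) (he : Coflow.IsG2Frame φ e)
    -- the dual `4`-form `Φ = ⋆φ` is closed
    (Φ : Coflow.Form 𝔤 4) (hΦ : Φ = Coflow.hodgeStar e (by norm_num : 3 + 4 = 7) φ)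
    (h_coclosed : Coflow.d Φ = 0)
    -- the unit normal `e₇` of `𝔥`
    (e₇ : 𝔤) (h_unit : Coflow.metric e e₇ e₇ = 1) (h_perp : ∀ x ∈ 𝔥, Coflow.metric e e₇ x = 0)
    -- the induced metric and `SU(3)`-structure on `𝔥`
    (g : LinearMap.BilinForm ℝ 𝔥)
    (hg : g = (Coflow.metric e).restrict 𝔥.toSubmodule)
    (ω : Coflow.Form 𝔥 2) (hω : ω = (φ.curryLeft e₇).compLinearMap 𝔥.toSubmodule.subtype)
    (ψ : Coflow.Form 𝔥 3) (hψ : ψ = -(Φ.curryLeft e₇).compLinearMap 𝔥.toSubmodule.subtype)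
    -- `A = ad e₇` on `𝔥`, its transpose, and its symmetric and skew-symmetric parts
    (A A' S L : Module.End ℝ 𝔥) (hA : A = LieModule.toEnd ℝ 𝔤 𝔥 e₇)
    (hA' : ∀ x y : 𝔥, g (A x) y = g x (A' y))
    (hS : S = (2⁻¹ : ℝ) • (A + A')) (hL : L = (2⁻¹ : ℝ) • (A - A'))
    (h_normal : A * A' = A' * A) :
    -- an adapted frame in which `S` has the normal form exists
    (∃ (f : Module.Basis (Fin 6) ℝ 𝔥) (θ : ℝ) (s : Fin 3 → ℝ), θ ∈ Set.Icc 0 (2 * Real.pi) ∧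
      Coflow.IsSU3Frame g ω ψ f ∧ Coflow.IsNormalForm S f θ s) ∧
    -- and for every such frame:
    ∀ (f : Module.Basis (Fin 6) ℝ 𝔥) (θ : ℝ) (s : Fin 3 → ℝ),
      Coflow.IsSU3Frame g ω ψ f → Coflow.IsNormalForm S f θ s →
      (Coflow.IsSoliton e Φ ↔
        4 * Real.sin θ * (1 - 4 * Real.cos θ ^ 2) * s 0 * s 1 * s 2 = 0 ∧
          ⁅Coflow.bigSigma f θ s, L⁆ = 0) ∧
      (Coflow.IsSoliton e Φ →
        -- the soliton equation holds with `c = l² + s²`, that is with `δ = 0`,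
        Coflow.IsSolitonWith e Φ
          (Coflow.imTrace f L ^ 2 + (s 0 ^ 2 + s 1 ^ 2 + s 2 ^ 2)) ∧
        -- and, unless `𝔤` is abelian, only with this constant
        (A ≠ 0 → ∀ c : ℝ, Coflow.IsSolitonWith e Φ c →
          Coflow.imTrace f L ^ 2 + (s 0 ^ 2 + s 1 ^ 2 + s 2 ^ 2) - c = 0 ∧ 0 ≤ c)) := by
  have h_ab' : ∀ x y : 𝔥, ⁅(x : 𝔤), (y : 𝔤)⁆ = 0 := fun x y =>
    congrArg Subtype.val (trivial_lie_zero 𝔥 𝔥 x y)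
  have hAe : ∀ x : 𝔥, ⁅e₇, (x : 𝔤)⁆ = A x := fun x => by
    rw [hA]
    rfl
  have hAS : A = S + L := by rw [hS, hL]; module
  have hAS' : A' = S - L := by rw [hS, hL]; module
  have hψ' : ψ = -Coflow.res 𝔥 (Φ.curryLeft e₇) := by
    rw [hψ]
    ext v
    rfl
  clear hψ
  subst hΦ hg hω hψ'
  obtain ⟨J, hJ, hJ2, -⟩ := Coflow.exists_complexStructure he h_unit h_perp h_dim
  have hsp := Coflow.symplectic_of_coclosed he h_unit h_perp h_dim h_ab' h_coclosed hAe
  -- With A and its transpose both in 𝔰𝔭(ω), so are S and L; this is what the normal form of S and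
  -- the trace formula for L require.
  have hsp' := Coflow.symplectic_transpose Coflow.resMetric_comm hJ hJ2 hsp hA'
  have hspS : ∀ x y, Coflow.res 𝔥 (φ.curryLeft e₇) ![S x, y]
      = -Coflow.res 𝔥 (φ.curryLeft e₇) ![x, S y] := fun x y => by
    have h1 := hsp x y
    have h2 := hsp' x y
    rw [hS, LinearMap.smul_apply, LinearMap.smul_apply, Coflow.two_smul_left, Coflow.two_swap _ x,
      Coflow.two_smul_left, LinearMap.add_apply, LinearMap.add_apply, Coflow.two_add_left,
      Coflow.two_add_left, Coflow.two_swap _ (A y), Coflow.two_swap _ (A' y), h1, h2]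
    ring
  have hspL : ∀ x y, Coflow.res 𝔥 (φ.curryLeft e₇) ![L x, y]
      = -Coflow.res 𝔥 (φ.curryLeft e₇) ![x, L y] := fun x y => by
    have h1 := hsp x y
    rw [hAS, LinearMap.add_apply, LinearMap.add_apply, Coflow.two_add_left, Coflow.two_add_right,
      hspS] at h1
    linarith
  have hA'' : ∀ x y, Coflow.resMetric e 𝔥 (A' x) y = Coflow.resMetric e 𝔥 x (A y) := fun x y => by
    rw [Coflow.resMetric_comm, ← hA', Coflow.resMetric_comm]
  have hSsymm : ∀ x y, Coflow.resMetric e 𝔥 (S x) y = Coflow.resMetric e 𝔥 x (S y) := fun x y => by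
    have h1 := hA' x y
    have h2 := hA'' x y
    simp only [hS, LinearMap.smul_apply, LinearMap.add_apply, map_smul, map_add, smul_eq_mul]
    linarith
  have hLskew : ∀ x y, Coflow.resMetric e 𝔥 (L x) y = -Coflow.resMetric e 𝔥 x (L y) :=
    fun x y => by
      have h1 := hA' x y
      have h2 := hA'' x y
      simp only [hL, LinearMap.smul_apply, LinearMap.sub_apply, map_smul, map_sub, smul_eq_mul]
      linarith
  have hcomm : S * L = L * S := by
    have h1 : (A + A') * (A - A') = (A - A') * (A + A') := by
      rw [add_mul, mul_sub, mul_sub, sub_mul, mul_add, mul_add, h_normal]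
      abel
    rw [hS, hL, smul_mul_assoc, mul_smul_comm, h1, smul_mul_assoc, mul_smul_comm]
  refine ⟨Coflow.exists_su3Frame_normalForm he h_unit h_perp h_dim S hSsymm hspS, ?_⟩
  intro f θ s hf hN
  obtain ⟨F, hF, hF6, hmet⟩ := Coflow.exists_extend_basis e h_unit h_perp f hf.1
  have hω : Coflow.res 𝔥 (φ.curryLeft e₇) = Coflow.stdOmega f := hf.2.1
  have hB := Coflow.resMetric_eq_metric (e := e) hmet hF
  rw [hω] at hspS hspL
  have h : Coflow.IsSolitonFrame e (Coflow.hodgeStar e (by norm_num : 3 + 4 = 7) φ) F f S L θ s :=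
    { lie_mem := h_ab'
      castSucc := hF
      metric_eq := hmet
      lie_last := by rw [hF6, ← hAS]; exact hAe
      symm := fun x y => by rw [← hB, ← hB]; exact hSsymm x y
      skew := fun x y => by rw [← hB, ← hB]; exact hLskew x y
      comm := hcomm
      closed := h_coclosed
      symplectic_symm := hspS
      symplectic_skew := hspL
      halfSquare := Coflow.isHalfSquare_of_isSU3Frame he h_unit h_perp hf
      curry := by rw [hF6]; exact neg_eq_iff_eq_neg.1 hf.2.2
      normalForm := hN }
  refine ⟨h.isSoliton_iff, fun hsol => ?_⟩
  obtain ⟨h1, h2⟩ := h.isSoliton_iff.1 hsol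
  refine ⟨h.isSolitonWith h1 h2, fun hne c hc => ?_⟩
  have hδ := (h.conditions_of_isSolitonWith (hAS ▸ hne) hc).1
  refine ⟨hδ, ?_⟩
  -- From δ = 0, c is the sum of squares l² + s².
  nlinarith [sq_nonneg (Coflow.imTrace f L), sq_nonneg (s 0), sq_nonneg (s 1), sq_nonneg (s 2)]
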